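/- **Setting.** For $x,q,r\in\mathbb C$ with $|q|,|r|<1$ put $(x;q)=\prod_{j\ge0}(1-xq^j)$, $(x;q,r)=\prod_{j,k\ge0}(1-xq^jr^k)$, and extend these to $|q|\ne1\ne|r|$ by $(x;q^{-1})=1/(qx;q)$, $(x;q^{-1},r)=1/(qx;q,r)$, $(x;q,r^{-1})=1/(rx;q,r)$. For $z\in\mathbb C$, $\tau,\sigma\in\mathbb C\setminus\mathbb R$ and $x=e^{2\pi iz}$, $q=e^{2\pi i\tau}$, $r=e^{2\pi i\sigma}$ let $$\theta_0(z,\tau)=(x;q)(q/x;q),\qquad \Gamma(z,\tau,\sigma)=\frac{(qr/x;q,r)}{(x;q,r)} .$$ Let $G=\mathrm{SL}(3,\mathbb Z)\ltimes\mathbb Z^3$ act on $X=\mathbb C\times\mathbb C^3$ by $(A,\vec n)(z,\vec x)=(z+\vec n\cdot\vec x,A\vec x)$. It is generated by the elementary matrices $e_{i,j}$ ($1\le i\ne j\le3$; the $(i,j)$ entry is $1$) and the canonical generators $t_1,t_2,t_3$ of $\mathbb Z^3$. An invertible analytic function on $X$ is a class of pairs $(f,D)$ with $D\subset X$ dense open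 and $f$ holomorphic and nowhere zero on $D$; $(f_1,D_1)\sim(f_2,D_2)$ if $f_1=f_2$ on $D_1\cap D_2$. Let $N$ be the multiplicative group of those that satisfy $f(\lambda z,\lambda\vec x)=f(z,\vec x)$ for all $\lambda\in\mathbb C\setminus\{0\}$, and $M\subset N$ the subgroup of the functions $\exp(2\pi if)$ with $f\in\mathbb Q(x_1/x_3,x_2/x_3)[z/x_3]$. These are $G$-modules by $(\rho(g)f)(p)=f(g^{-1}p)$. Let $\delta_*:H^1(G,N/M)\to H^2(G,M)$ be the connecting homomorphism of $1\to M\to N\to N/M\to1$. Define elements $\phi_j^k=\exp(i\pi L_j^k)$, $\phi_{j,k}^l=\exp(i\pi L_{j,k}^l)$, $\phi_{j,k}^{l,m}=\exp(i\pi L_{j,k}^{l,m})$ of $M$ by $$L_{1,2}^2=\frac{x_2\,(6z^2-6(x_3+2x_2)z+x_2x_1-x_1^2+6x_2^2+6x_2x_3+x_3^2)}{6x_3x_1(x_2-x_1)},$$ $$L_{1,2}^1=\frac{-6z^2+6(x_1+x_3+2x_2)z-x_3^2-6x_2x_1-3x_1x_3-6x_2x_3-6x_2^2-x_1^2}{6x_1x_3},$$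 $$L_{1,3}^2=\frac{6z^2-6(x_3+2x_2)z+6x_2x_3-x_1^2+6x_2^2+x_3^2+x_1x_3}{6(x_3-x_1)x_1},\qquad L_3^2=\frac{2z-2x_2-2x_3+x_1}{x_1},$$ $$L_{1,3}^{3,2}=\frac{(2z-x_2)(2z^2-2zx_2-x_1^2+x_1x_3-x_3^2+x_2x_1)}{12(x_3-x_1)x_3(x_2-x_1)},$$ $$L_{3,1}^{1,2}=\frac{(2z-x_2)(2z^2-2zx_2+x_2x_3-x_1^2+x_1x_3-x_3^2)}{12x_1(x_2-x_3)(x_3-x_1)},$$ $$L_{1,2}^{3,2}=\frac{x_2(2z-x_2)(2z^2-2zx_2+x_2x_3-x_3^2-x_1^2+x_2x_1)}{12x_1(x_2-x_1)x_3(x_2-x_3)},$$ $L_{3,2}^{1,2}=-L_{1,2}^{3,2}$, $L_2^3=-L_3^2$, and all other $L$'s are zero. Let $E$ be the group generated by $\hat e_{i,j}$ ($1\le i\ne j\le3$), $\hat t_i$ ($1\le i\le3$) and the elements of $M$, with the following defining relations. a) The product of elements of $M$ in $E$ is the product in $M$. b) $\hat e_{i,j}u=\rho(e_{i,j})(u)\,\hat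 e_{i,j}$ and $\hat t_iu=\rho(t_i)(u)\,\hat t_i$ for $u\in M$. c) $\hat e_{i,j}\hat e_{k,l}=\phi_{i,j}^{k,l}\hat e_{k,l}\hat e_{i,j}$ if $i\ne l$ and $j\ne k$; $\hat e_{i,j}\hat e_{j,k}=\phi_{i,j}^{j,k}\hat e_{i,k}\hat e_{j,k}\hat e_{i,j}$ for distinct $i,j,k$; $(\hat e_{1,3}\hat e_{3,1}^{-1}\hat e_{1,3})^4=1$. d) $\hat t_i\hat t_j=\phi_i^j\hat t_j\hat t_i$. e) $\hat e_{i,j}\hat t_k=\phi_{i,j}^k\hat t_k\hat e_{i,j}$ if $k\ne i$; $\hat t_j\hat e_{i,j}\hat t_i=\phi_{i,j}^i\hat t_i\hat e_{i,j}$. **Theorem.** There is a 1-cocycle $u:G\to N/M$ whose values on generators are the classes modulo $M$ of $$u(e_{1,2})=\Gamma\Big(\frac{z-x_2}{x_3},\frac{x_1-x_2}{x_3},-\frac{x_1}{x_3}\Big)^{-1},\quad u(e_{3,2})=\Gamma\Big(\frac z{x_1},\frac{x_2-x_3}{x_1},\frac{x_3}{x_1}\Big),\quad u(t_2)=\theta_0\Big(\frac{z-x_2}{x_1},\frac{x_3}{x_1}\Big),$$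 $u(e_{i,j})=1$ for $j\ne2$ and $u(t_j)=1$ for $j\ne2$. The natural map $M\to E$ fits into a group extension $$1\to M\to E\to G\to1$$ of the $G$-module $M$, in which $\hat e_{i,j}\mapsto e_{i,j}$ and $\hat t_i\mapsto t_i$, and conjugation in $E$ induces the given action of $G$ on $M$. The characteristic class of this extension in $H^2(G,M)$ (the class of the 2-cocycle $\phi$ defined by $s(g)s(h)=\phi(g,h)s(gh)$, for any set-theoretic section $s:G\to E$) is $\delta_*[u]$. -/

import Mathlib

noncomputable section

namespace EllGamma

open CategoryTheory

/-! ### The elliptic gamma function and the theta function for periods in `ℂ ∖ ℝ` -/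

/-- `(x; q)`: the product `∏ (1 - x q^j)` for `|q| < 1`, and `(x; q) = 1 / (x q⁻¹; q⁻¹)` for
`|q| > 1`. -/
def poch (x q : ℂ) : ℂ :=
  if ‖q‖ < 1 then ∏' j : ℕ, (1 - x * q ^ j)
  else (∏' j : ℕ, (1 - q⁻¹ * x * q⁻¹ ^ j))⁻¹

/-- The double product `∏ (1 - x q^j r^k)` over `j, k ≥ 0`, convergent for `|q|, |r| < 1`. -/
def dprod (x q r : ℂ) : ℂ := ∏' p : ℕ × ℕ, (1 - x * q ^ p.1 * r ^ p.2)

/-- `(x; q, r)`, extended to `|q| ≠ 1 ≠ |r|` by `(x; q⁻¹, r) = 1 / (q x; q, r)` and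
`(x; q, r⁻¹) = 1 / (r x; q, r)`. -/
def poch₂ (x q r : ℂ) : ℂ :=
  if ‖q‖ < 1 then
    if ‖r‖ < 1 then dprod x q r else (dprod (r⁻¹ * x) q r⁻¹)⁻¹
  else
    if ‖r‖ < 1 then (dprod (q⁻¹ * x) q⁻¹ r)⁻¹ else dprod (q⁻¹ * r⁻¹ * x) q⁻¹ r⁻¹

/-- `ee z = exp (2 π i z)`. -/
def ee (z : ℂ) : ℂ := Complex.exp (2 * Real.pi * Complex.I * z)

/-- The theta function `θ₀(z, τ) = (x; q) (q / x; q)`, where `x = ee z`, `q = ee τ`. -/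
def theta₀ (z τ : ℂ) : ℂ := poch (ee z) (ee τ) * poch (ee τ / ee z) (ee τ)

/-- The elliptic gamma function `Γ(z, τ, σ) = (q r / x; q, r) / (x; q, r)`, where `x = ee z`,
`q = ee τ`, `r = ee σ`. -/
def ellGamma (z τ σ : ℂ) : ℂ :=
  poch₂ (ee τ * ee σ / ee z) (ee τ) (ee σ) / poch₂ (ee z) (ee τ) (ee σ)

/-! ### The group `G = SL(3, ℤ) ⋉ ℤ³` and its action on `X = ℂ × ℂ³` -/

/-- The complex manifold `X = ℂ × ℂ³`; a point is `(z, x)` with `x = (x₁, x₂, x₃)`. The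
coordinates `x₁, x₂, x₃` are `x 0, x 1, x 2`. -/
abbrev X : Type := ℂ × (Fin 3 → ℂ)

/-- The set `SL(3, ℤ) × ℤ³` underlying the group `G`. -/
@[ext]
structure G : Type where
  /-- the matrix part -/
  A : Matrix.SpecialLinearGroup (Fin 3) ℤ
  /-- the translation part -/
  n : Fin 3 → ℤ

namespace G

/-- The product for which `(A, n)(z, x) = (z + n · x, A x)` is a left action: since
`n · (B x) = (Bᵀ n) · x`, it is `(A, n)(B, m) = (A B, m + Bᵀ n)`. -/
instance : Mul G := ⟨fun g h => ⟨g.A * h.A, h.n + Matrix.vecMul g.n h.A.1⟩⟩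
instance : One G := ⟨⟨1, 0⟩⟩
instance : Inv G := ⟨fun g => ⟨g.A⁻¹, -Matrix.vecMul g.n (g.A⁻¹).1⟩⟩

theorem mul_A (g h : G) : (g * h).A = g.A * h.A := rfl
theorem mul_n (g h : G) : (g * h).n = h.n + Matrix.vecMul g.n h.A.1 := rfl
theorem one_A : (1 : G).A = 1 := rfl
theorem one_n : (1 : G).n = 0 := rfl
theorem inv_A (g : G) : (g⁻¹).A = g.A⁻¹ := rfl
theorem inv_n (g : G) : (g⁻¹).n = -Matrix.vecMul g.n (g.A⁻¹).1 := rfl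

instance : Group G :=
  Group.ofLeftAxioms
    (fun a b c => by
      ext1
      · simp only [mul_A, mul_assoc]
      · simp only [mul_n, mul_A, Matrix.add_vecMul, Matrix.vecMul_vecMul,
          Matrix.SpecialLinearGroup.coe_mul]
        abel)
    (fun a => by
      ext1
      · simp only [mul_A, one_A, one_mul]
      · simp only [mul_n, one_n, Matrix.zero_vecMul, add_zero])
    (fun a => by
      ext1
      · simp only [mul_A, inv_A, one_A, inv_mul_cancel]
      · simp only [mul_n, inv_n, one_n, Matrix.neg_vecMul, Matrix.vecMul_vecMul]
        rw [← Matrix.SpecialLinearGroup.coe_mul, inv_mul_cancel,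
          Matrix.SpecialLinearGroup.coe_one, Matrix.vecMul_one, add_neg_cancel])

/-- The elementary matrix `e_{i,j}`, as an element of `G`. -/
def elem (i j : Fin 3) (h : i ≠ j) : G :=
  ⟨⟨Matrix.transvection i j (1 : ℤ), Matrix.det_transvection_of_ne i j h 1⟩, 0⟩

/-- The canonical generators `t_i` of the subgroup `ℤ³` of `G`. -/
def trans (i : Fin 3) : G := ⟨1, Pi.single i 1⟩

/-- An integral matrix, viewed as a complex matrix. -/
def cmat (A : Matrix.SpecialLinearGroup (Fin 3) ℤ) : Matrix (Fin 3) (Fin 3) ℂ :=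
  A.1.map (Int.cast : ℤ → ℂ)

theorem cmat_mul (A B : Matrix.SpecialLinearGroup (Fin 3) ℤ) :
    cmat (A * B) = cmat A * cmat B := by
  simp only [cmat, Matrix.SpecialLinearGroup.coe_mul]
  exact Matrix.map_mul (f := Int.castRingHom ℂ)

theorem cmat_one : cmat 1 = 1 := by
  simp only [cmat, Matrix.SpecialLinearGroup.coe_one]
  exact Matrix.map_one _ Int.cast_zero Int.cast_one

/-- The action `(A, n)(z, x) = (z + n · x, A x)` of `G` on `X`. -/
def act (g : G) (p : X) : X :=
  (p.1 + ∑ i, (g.n i : ℂ) * p.2 i, (cmat g.A).mulVec p.2)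

theorem act_one (p : X) : act 1 p = p := by
  simp [act, one_A, one_n, cmat_one]

theorem act_mul (g h : G) (p : X) : act (g * h) p = act g (act h p) := by
  refine Prod.ext ?_ ?_
  · simp only [act, mul_n, cmat, Matrix.mulVec, dotProduct, Matrix.vecMul, Pi.add_apply,
      Matrix.map_apply, Fin.sum_univ_three]
    push_cast
    ring
  · simp only [act, mul_A, cmat_mul, Matrix.mulVec_mulVec]

instance : MulAction G X where
  smul := act
  one_smul := act_one
  mul_smul := act_mul

theorem smul_def (g : G) (p : X) :
    g • p = (p.1 + ∑ i, (g.n i : ℂ) * p.2 i, (cmat g.A).mulVec p.2) := rfl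

theorem differentiable_smul (g : G) : Differentiable ℂ (fun p : X => g • p) := by
  refine Differentiable.prodMk (by fun_prop) (differentiable_pi.2 fun i => ?_)
  simp only [Matrix.mulVec, dotProduct]
  fun_prop

end G

/-! ### Invertible analytic functions -/

/-- A pair `(f, D)`: a dense open set `D ⊆ X` and a holomorphic nowhere vanishing function on `D`
(the values of `toFun` outside `D` play no role). -/
structure InvPair : Type where
  toFun : X → ℂ
  dom : Set X
  isOpen_dom : IsOpen dom
  dense_dom : Dense dom
  holo : DifferentiableOn ℂ toFun dom
  ne_zero : ∀ p ∈ dom, toFun p ≠ 0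

namespace InvPair

/-- Two pairs are equivalent if the functions agree on the intersection of the domains. -/
def Agree (f g : InvPair) : Prop := Set.EqOn f.toFun g.toFun (f.dom ∩ g.dom)

theorem agree_of_dense {f g : InvPair} {D : Set X} (hD : Dense D)
    (h : Set.EqOn f.toFun g.toFun (D ∩ (f.dom ∩ g.dom))) : f.Agree g := by
  have ho : IsOpen (f.dom ∩ g.dom) := f.isOpen_dom.inter g.isOpen_dom
  have hc1 : ContinuousOn f.toFun (f.dom ∩ g.dom) :=
    f.holo.continuousOn.mono Set.inter_subset_left
  have hc2 : ContinuousOn g.toFun (f.dom ∩ g.dom) :=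
    g.holo.continuousOn.mono Set.inter_subset_right
  refine Set.EqOn.of_subset_closure h hc1 hc2 Set.inter_subset_right ?_
  rw [Set.inter_comm D]
  exact hD.open_subset_closure_inter ho

instance setoid : Setoid InvPair where
  r := Agree
  iseqv :=
    { refl := fun _ _ _ => rfl
      symm := fun h _ hp => (h hp.symm).symm
      trans := fun {_ g _} h h' => agree_of_dense g.dense_dom
        fun _ hp => (h ⟨hp.2.1, hp.1⟩).trans (h' ⟨hp.1, hp.2.2⟩) }

/-- The product of two pairs. -/
def mul (f g : InvPair) : InvPair where
  toFun := fun p => f.toFun p * g.toFun p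
  dom := f.dom ∩ g.dom
  isOpen_dom := f.isOpen_dom.inter g.isOpen_dom
  dense_dom := f.dense_dom.inter_of_isOpen_left g.dense_dom f.isOpen_dom
  holo := (f.holo.mono Set.inter_subset_left).mul (g.holo.mono Set.inter_subset_right)
  ne_zero := fun p hp => mul_ne_zero (f.ne_zero p hp.1) (g.ne_zero p hp.2)

/-- The constant function `1`. -/
def one : InvPair where
  toFun := fun _ => 1
  dom := Set.univ
  isOpen_dom := isOpen_univ
  dense_dom := dense_univ
  holo := differentiableOn_const 1
  ne_zero := fun _ _ => one_ne_zero

/-- The pointwise inverse. -/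
def inv (f : InvPair) : InvPair where
  toFun := fun p => (f.toFun p)⁻¹
  dom := f.dom
  isOpen_dom := f.isOpen_dom
  dense_dom := f.dense_dom
  holo := f.holo.inv f.ne_zero
  ne_zero := fun p hp => inv_ne_zero (f.ne_zero p hp)

/-- The composition with a biholomorphic map of `X`. -/
def comp (φ : X ≃ₜ X) (hφ : Differentiable ℂ φ) (f : InvPair) : InvPair where
  toFun := fun p => f.toFun (φ p)
  dom := φ ⁻¹' f.dom
  isOpen_dom := f.isOpen_dom.preimage φ.continuous
  dense_dom := f.dense_dom.preimage φ.isOpenMap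
  holo := f.holo.comp hφ.differentiableOn (Set.mapsTo_preimage _ _)
  ne_zero := fun p hp => f.ne_zero (φ p) hp

end InvPair

/-- The group of invertible analytic functions on `X`: equivalence classes of pairs `(f, D)`. -/
def InvFun : Type := Quotient InvPair.setoid

namespace InvFun

/-- The class of a pair. -/
def mk (f : InvPair) : InvFun := Quotient.mk _ f

theorem mk_eq {f g : InvPair} : mk f = mk g ↔ f.Agree g :=
  ⟨fun h => Quotient.exact h, fun h => Quotient.sound h⟩

instance : Mul InvFun :=
  ⟨Quotient.map₂ InvPair.mul fun _ _ h _ _ h' _ hp =>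
    congrArg₂ (· * ·) (h ⟨hp.1.1, hp.2.1⟩) (h' ⟨hp.1.2, hp.2.2⟩)⟩
instance : One InvFun := ⟨mk InvPair.one⟩
instance : Inv InvFun :=
  ⟨Quotient.map InvPair.inv fun _ _ h _ hp => congrArg (·⁻¹) (h hp)⟩

theorem mk_mul (f g : InvPair) : mk f * mk g = mk (f.mul g) := rfl
theorem one_def : (1 : InvFun) = mk InvPair.one := rfl
theorem mk_inv (f : InvPair) : (mk f)⁻¹ = mk f.inv := rfl

instance : CommGroup InvFun where
  mul_assoc a b c := by
    obtain ⟨a, rfl⟩ := Quotient.exists_rep a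
    obtain ⟨b, rfl⟩ := Quotient.exists_rep b
    obtain ⟨c, rfl⟩ := Quotient.exists_rep c
    exact mk_eq.2 fun p _ => mul_assoc (a.toFun p) (b.toFun p) (c.toFun p)
  one_mul a := by
    obtain ⟨a, rfl⟩ := Quotient.exists_rep a
    exact mk_eq.2 fun p _ => one_mul (a.toFun p)
  mul_one a := by
    obtain ⟨a, rfl⟩ := Quotient.exists_rep a
    exact mk_eq.2 fun p _ => mul_one (a.toFun p)
  inv_mul_cancel a := by
    obtain ⟨a, rfl⟩ := Quotient.exists_rep a
    exact mk_eq.2 fun p hp => inv_mul_cancel₀ (a.ne_zero p hp.1.1)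
  mul_comm a b := by
    obtain ⟨a, rfl⟩ := Quotient.exists_rep a
    obtain ⟨b, rfl⟩ := Quotient.exists_rep b
    exact mk_eq.2 fun p _ => mul_comm (a.toFun p) (b.toFun p)

/-- The pull-back of invertible analytic functions by a biholomorphic map of `X`. -/
def comp (φ : X ≃ₜ X) (hφ : Differentiable ℂ φ) : InvFun →* InvFun where
  toFun := Quotient.map (InvPair.comp φ hφ) fun _ _ h _ hp => h ⟨hp.1, hp.2⟩
  map_one' := rfl
  map_mul' a b := by
    obtain ⟨a, rfl⟩ := Quotient.exists_rep a
    obtain ⟨b, rfl⟩ := Quotient.exists_rep b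
    rfl

theorem comp_mk (φ : X ≃ₜ X) (hφ : Differentiable ℂ φ) (f : InvPair) :
    comp φ hφ (mk f) = mk (f.comp φ hφ) := rfl

/-- `a` is the class of the function `F`: it has a representative `(f, D)` with `f = F` on the
dense open set `D`. There is at most one such `a`. -/
def IsClassOf (a : InvFun) (F : X → ℂ) : Prop :=
  ∃ f : InvPair, mk f = a ∧ Set.EqOn f.toFun F f.dom

theorem IsClassOf.unique {a b : InvFun} {F : X → ℂ} (ha : a.IsClassOf F) (hb : b.IsClassOf F) :
    a = b := by
  obtain ⟨f, rfl, hf⟩ := ha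
  obtain ⟨g, rfl, hg⟩ := hb
  exact mk_eq.2 fun p hp => (hf hp.1).trans (hg hp.2).symm

theorem IsClassOf.mul {a b : InvFun} {F H : X → ℂ} (ha : a.IsClassOf F) (hb : b.IsClassOf H) :
    (a * b).IsClassOf fun p => F p * H p := by
  obtain ⟨f, rfl, hf⟩ := ha
  obtain ⟨g, rfl, hg⟩ := hb
  exact ⟨f.mul g, rfl, fun p hp => congrArg₂ (· * ·) (hf hp.1) (hg hp.2)⟩

theorem IsClassOf.inv {a : InvFun} {F : X → ℂ} (ha : a.IsClassOf F) :
    (a⁻¹).IsClassOf fun p => (F p)⁻¹ := by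
  obtain ⟨f, rfl, hf⟩ := ha
  exact ⟨f.inv, rfl, fun p hp => congrArg (·⁻¹) (hf hp)⟩

theorem IsClassOf.comp {a : InvFun} {F : X → ℂ} (ha : a.IsClassOf F) (φ : X ≃ₜ X)
    (hφ : Differentiable ℂ φ) : (InvFun.comp φ hφ a).IsClassOf fun p => F (φ p) := by
  obtain ⟨f, rfl, hf⟩ := ha
  exact ⟨f.comp φ hφ, rfl, fun p hp => hf hp⟩

theorem IsClassOf.congr {a : InvFun} {F H : X → ℂ} (ha : a.IsClassOf F) {D : Set X}
    (ho : IsOpen D) (hd : Dense D) (h : Set.EqOn F H D) : a.IsClassOf H := by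
  obtain ⟨f, rfl, hf⟩ := ha
  let g : InvPair :=
    { toFun := f.toFun
      dom := f.dom ∩ D
      isOpen_dom := f.isOpen_dom.inter ho
      dense_dom := f.dense_dom.inter_of_isOpen_left hd f.isOpen_dom
      holo := f.holo.mono Set.inter_subset_left
      ne_zero := fun p hp => f.ne_zero p hp.1 }
  exact ⟨g, mk_eq.2 fun _ _ => rfl, fun p hp => (hf hp.1).trans (h hp.2)⟩

end InvFun

instance : ContinuousConstSMul G X := ⟨fun g => (G.differentiable_smul g).continuous⟩

/-- `G` acts on invertible analytic functions by `(g f)(p) = f(g⁻¹ p)`. -/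
instance : MulDistribMulAction G InvFun where
  smul g a := InvFun.comp (Homeomorph.smul g⁻¹) (G.differentiable_smul g⁻¹) a
  one_smul a := by
    obtain ⟨a, rfl⟩ := Quotient.exists_rep a
    refine InvFun.mk_eq.2 fun p _ => ?_
    change a.toFun ((1 : G)⁻¹ • p) = a.toFun p
    rw [inv_one, one_smul]
  mul_smul g h a := by
    obtain ⟨a, rfl⟩ := Quotient.exists_rep a
    refine InvFun.mk_eq.2 fun p _ => ?_
    change a.toFun ((g * h)⁻¹ • p) = a.toFun (h⁻¹ • (g⁻¹ • p))
    rw [mul_inv_rev, mul_smul]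
  smul_mul g a b := map_mul _ a b
  smul_one g := map_one _

theorem smul_invFun_def (g : G) (a : InvFun) :
    g • a = InvFun.comp (Homeomorph.smul g⁻¹) (G.differentiable_smul g⁻¹) a := rfl

theorem InvFun.IsClassOf.smul {a : InvFun} {F : X → ℂ} (ha : a.IsClassOf F) (g : G) :
    (g • a).IsClassOf fun p => F (g⁻¹ • p) := ha.comp _ _

/-- The dilation `(z, x) ↦ (c z, c x)`, `c ≠ 0`. -/
def dilation (c : ℂˣ) : X ≃ₜ X := Homeomorph.smul c

theorem differentiable_dilation (c : ℂˣ) : Differentiable ℂ (dilation c) :=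
  (differentiable_id.const_smul (c : ℂ) : Differentiable ℂ fun p : X => (c : ℂ) • p)

theorem smul_dilation (g : G) (c : ℂˣ) (p : X) : g • dilation c p = dilation c (g • p) := by
  change g • ((c : ℂ) • p) = (c : ℂ) • (g • p)
  refine Prod.ext ?_ ?_
  · simp only [G.smul_def, Prod.smul_fst, Prod.smul_snd, Pi.smul_apply, smul_eq_mul, mul_add,
      Finset.mul_sum]
    congr 1
    exact Finset.sum_congr rfl fun i _ => by ring
  · simp only [G.smul_def, Prod.smul_snd, Matrix.mulVec_smul]

/-- The group `N` of invertible analytic functions with `f(c z, c x) = f(z, x)` for `c ≠ 0`. -/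
def N : Subgroup InvFun where
  carrier := {a | ∀ c : ℂˣ, InvFun.comp (dilation c) (differentiable_dilation c) a = a}
  one_mem' c := map_one _
  mul_mem' ha hb c := by rw [map_mul, ha c, hb c]
  inv_mem' ha c := by rw [map_inv, ha c]

theorem N.smul_mem (g : G) {a : InvFun} (ha : a ∈ N) : g • a ∈ N := by
  intro c
  refine Eq.trans ?_ (congrArg (fun b => g • b) (ha c))
  obtain ⟨a, rfl⟩ := Quotient.exists_rep a
  refine InvFun.mk_eq.2 fun p _ => ?_
  change a.toFun (g⁻¹ • dilation c p) = a.toFun (dilation c (g⁻¹ • p))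
  rw [smul_dilation]

/-- `N` is a `G`-module. -/
instance : MulDistribMulAction G N where
  smul g a := ⟨g • a.1, N.smul_mem g a.2⟩
  one_smul a := Subtype.ext (one_smul G a.1)
  mul_smul g h a := Subtype.ext (mul_smul g h a.1)
  smul_mul g a b := Subtype.ext (smul_mul' g a.1 b.1)
  smul_one g := Subtype.ext (smul_one g)

theorem N.coe_smul (g : G) (a : N) : ((g • a : N) : InvFun) = g • (a : InvFun) := rfl

/-! ### The submodule `M` -/

/-- The point `(x₁/x₃, x₂/x₃)`. -/
def crdX (p : X) : Fin 2 → ℂ := ![p.2 0 / p.2 2, p.2 1 / p.2 2]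

/-- The point `(x₁/x₃, x₂/x₃, z/x₃)`. -/
def crd (p : X) : Fin 3 → ℂ := ![p.2 0 / p.2 2, p.2 1 / p.2 2, p.1 / p.2 2]

theorem crd_castSucc (p : X) : crd p ∘ Fin.castSucc = crdX p := by
  funext i
  fin_cases i <;> rfl

/-- The set of points where `x₃ ≠ 0` and the polynomial `Q` does not vanish at
`(x₁/x₃, x₂/x₃)`. -/
def domQ (Q : MvPolynomial (Fin 2) ℚ) : Set X :=
  {p | p.2 2 ≠ 0 ∧ MvPolynomial.aeval (crdX p) Q ≠ 0}

theorem continuousOn_crdX : ContinuousOn crdX {p : X | p.2 2 ≠ 0} := by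
  refine continuousOn_pi.2 fun i => ?_
  fin_cases i
  · exact ContinuousOn.div (by fun_prop) (by fun_prop) fun p hp => hp
  · exact ContinuousOn.div (by fun_prop) (by fun_prop) fun p hp => hp

theorem differentiableOn_div {D : Set X} {F H : X → ℂ} (hF : DifferentiableOn ℂ F D)
    (hH : DifferentiableOn ℂ H D) (h : ∀ p ∈ D, H p ≠ 0) :
    DifferentiableOn ℂ (fun p => F p / H p) D := by
  simp only [div_eq_mul_inv]
  exact hF.mul (hH.inv h)

theorem differentiableOn_crd (i : Fin 3) :
    DifferentiableOn ℂ (fun p => crd p i) {p : X | p.2 2 ≠ 0} := by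
  fin_cases i
  · exact differentiableOn_div (by fun_prop) (by fun_prop) fun p hp => hp
  · exact differentiableOn_div (by fun_prop) (by fun_prop) fun p hp => hp
  · exact differentiableOn_div (by fun_prop) (by fun_prop) fun p hp => hp

theorem differentiableOn_aeval_crd (P : MvPolynomial (Fin 3) ℚ) :
    DifferentiableOn ℂ (fun p => MvPolynomial.aeval (crd p) P) {p : X | p.2 2 ≠ 0} := by
  induction P using MvPolynomial.induction_on with
  | C r => simp
  | add P Q hP hQ =>
    simp only [map_add]
    exact hP.add hQ
  | mul_X P i hP =>
    simp only [map_mul, MvPolynomial.aeval_X]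
    exact hP.mul (differentiableOn_crd i)

theorem aeval_rename_crd (p : X) (Q : MvPolynomial (Fin 2) ℚ) :
    MvPolynomial.aeval (crd p) (MvPolynomial.rename Fin.castSucc Q) =
      MvPolynomial.aeval (crdX p) Q := by
  rw [MvPolynomial.aeval_rename, crd_castSucc]

theorem isOpen_x₃ : IsOpen {p : X | p.2 2 ≠ 0} :=
  isOpen_ne_fun (by fun_prop) continuous_const

theorem isOpen_domQ (Q : MvPolynomial (Fin 2) ℚ) : IsOpen (domQ Q) := by
  have h := (differentiableOn_aeval_crd (MvPolynomial.rename Fin.castSucc Q)).continuousOn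
  have h2 := h.isOpen_inter_preimage isOpen_x₃ (isOpen_ne (x := (0 : ℂ)))
  simp only [aeval_rename_crd] at h2
  exact h2

theorem exists_aeval_ne_zero {Q : MvPolynomial (Fin 2) ℚ} (hQ : Q ≠ 0) (s : Fin 2 → Set ℂ)
    (hs : ∀ i, (s i).Infinite) :
    ∃ y : Fin 2 → ℂ, (∀ i, y i ∈ s i) ∧ MvPolynomial.aeval y Q ≠ 0 := by
  by_contra! h
  apply hQ
  apply MvPolynomial.map_injective (algebraMap ℚ ℂ) (algebraMap ℚ ℂ).injective
  rw [map_zero]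
  refine MvPolynomial.funext_set s hs fun y hy => ?_
  rw [map_zero, MvPolynomial.eval_map, ← MvPolynomial.aeval_def]
  exact h y fun i => hy i (Set.mem_univ i)

theorem dense_domQ {Q : MvPolynomial (Fin 2) ℚ} (hQ : Q ≠ 0) : Dense (domQ Q) := by
  refine Metric.dense_iff.2 fun p r hr => ?_
  have inf : ∀ (y : ℂ) {r : ℝ}, 0 < r → (Metric.ball y r).Infinite := fun y r hr =>
    infinite_of_mem_nhds y (Metric.ball_mem_nhds y hr)
  obtain ⟨c, hc, hc0⟩ : ∃ c ∈ Metric.ball (p.2 2) r, c ≠ 0 := by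
    obtain ⟨c, hc, h⟩ := (inf (p.2 2) hr).exists_notMem_finite (Set.finite_singleton 0)
    exact ⟨c, hc, h⟩
  let s : Fin 2 → Set ℂ := fun i => (fun y => y / c) '' Metric.ball (p.2 (Fin.castSucc i)) r
  obtain ⟨y, hy, hQy⟩ := exists_aeval_ne_zero hQ s fun i =>
    (inf _ hr).image (fun a _ b _ hab => by simpa [div_left_inj' hc0] using hab)
  obtain ⟨a, ha, ha'⟩ := hy 0
  obtain ⟨b, hb, hb'⟩ := hy 1
  refine ⟨(p.1, ![a, b, c]), ?_, hc0, ?_⟩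
  · rw [Metric.mem_ball, Prod.dist_eq, dist_self]
    refine max_lt hr ((dist_pi_lt_iff hr).2 fun i => ?_)
    fin_cases i
    · exact ha
    · exact hb
    · exact hc
  · have h : crdX (p.1, ![a, b, c]) = y := by
      funext i
      fin_cases i
      · exact ha'
      · exact hb'
    rw [h]
    exact hQy

/-- `F` is (on a dense open set) the function `P(x₁/x₃, x₂/x₃, z/x₃) / Q(x₁/x₃, x₂/x₃)`. -/
def IsRatWith (F : X → ℂ) (P : MvPolynomial (Fin 3) ℚ) (Q : MvPolynomial (Fin 2) ℚ) : Prop :=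
  ∃ D : Set X, IsOpen D ∧ Dense D ∧
    ∀ p ∈ D, F p = MvPolynomial.aeval (crd p) P / MvPolynomial.aeval (crdX p) Q

theorem IsRatWith.restrict {F : X → ℂ} {P : MvPolynomial (Fin 3) ℚ} {Q : MvPolynomial (Fin 2) ℚ}
    (h : IsRatWith F P Q) (hQ : Q ≠ 0) : ∃ D : Set X, IsOpen D ∧ Dense D ∧ D ⊆ domQ Q ∧
    ∀ p ∈ D, F p = MvPolynomial.aeval (crd p) P / MvPolynomial.aeval (crdX p) Q := by
  obtain ⟨D, ho, hd, h⟩ := h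
  exact ⟨D ∩ domQ Q, ho.inter (isOpen_domQ Q), hd.inter_of_isOpen_left (dense_domQ hQ) ho,
    Set.inter_subset_right, fun p hp => h p hp.1⟩

/-- The algebra `ℚ(x₁/x₃, x₂/x₃)[z/x₃]` of polynomials in `z/x₃` whose coefficients are rational
functions of `x₁/x₃` and `x₂/x₃` over `ℚ`, as functions on `X` (the values outside a dense open
set play no role): with a common denominator, its elements are the quotients `P / Q` with
`P ∈ ℚ[x₁/x₃, x₂/x₃, z/x₃]` and `0 ≠ Q ∈ ℚ[x₁/x₃, x₂/x₃]`. -/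
def K : Subalgebra ℚ (X → ℂ) where
  carrier := {F | ∃ (P : MvPolynomial (Fin 3) ℚ) (Q : MvPolynomial (Fin 2) ℚ),
    Q ≠ 0 ∧ IsRatWith F P Q}
  algebraMap_mem' r := ⟨MvPolynomial.C r, 1, one_ne_zero, Set.univ, isOpen_univ, dense_univ,
    fun p _ => by simp⟩
  add_mem' := by
    rintro F H ⟨P, Q, hQ, h⟩ ⟨P', Q', hQ', h'⟩
    obtain ⟨D, ho, hd, hs, h⟩ := h.restrict hQ
    obtain ⟨D', ho', hd', hs', h'⟩ := h'.restrict hQ'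
    refine ⟨P * MvPolynomial.rename Fin.castSucc Q' + MvPolynomial.rename Fin.castSucc Q * P',
      Q * Q', mul_ne_zero hQ hQ', D ∩ D', ho.inter ho', hd.inter_of_isOpen_left hd' ho,
      fun p hp => ?_⟩
    rw [Pi.add_apply, h p hp.1, h' p hp.2, div_add_div _ _ (hs hp.1).2 (hs' hp.2).2]
    simp only [map_add, map_mul, aeval_rename_crd]
  mul_mem' := by
    rintro F H ⟨P, Q, hQ, D, ho, hd, h⟩ ⟨P', Q', hQ', D', ho', hd', h'⟩
    refine ⟨P * P', Q * Q', mul_ne_zero hQ hQ', D ∩ D', ho.inter ho',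
      hd.inter_of_isOpen_left hd' ho, fun p hp => ?_⟩
    rw [Pi.mul_apply, h p hp.1, h' p hp.2, div_mul_div_comm, map_mul, map_mul]

theorem K_congr {F H : X → ℂ} (hF : F ∈ K) {D : Set X} (ho : IsOpen D) (hd : Dense D)
    (h : ∀ p ∈ D, H p = F p) : H ∈ K := by
  obtain ⟨P, Q, hQ, D', ho', hd', h'⟩ := hF
  exact ⟨P, Q, hQ, D ∩ D', ho.inter ho', hd.inter_of_isOpen_left hd' ho,
    fun p hp => (h p hp.1).trans (h' p hp.2)⟩

/-- The functions in `K` that do not depend on `z`. -/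
def InKX (F : X → ℂ) : Prop := ∃ S T : MvPolynomial (Fin 2) ℚ, T ≠ 0 ∧ ∃ D : Set X, IsOpen D ∧
  Dense D ∧ ∀ p ∈ D, F p = MvPolynomial.aeval (crdX p) S / MvPolynomial.aeval (crdX p) T

theorem InKX.mem_K {F : X → ℂ} (h : InKX F) : F ∈ K := by
  obtain ⟨S, T, hT, D, ho, hd, h⟩ := h
  exact ⟨MvPolynomial.rename Fin.castSucc S, T, hT, D, ho, hd,
    fun p hp => by rw [h p hp, aeval_rename_crd]⟩

theorem InKX.const (r : ℚ) : InKX (fun _ => (algebraMap ℚ ℂ r)) :=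
  ⟨MvPolynomial.C r, 1, one_ne_zero, Set.univ, isOpen_univ, dense_univ, fun p _ => by simp⟩

theorem InKX.add {F H : X → ℂ} (hF : InKX F) (hH : InKX H) : InKX (fun p => F p + H p) := by
  obtain ⟨S, T, hT, D, ho, hd, h⟩ := hF
  obtain ⟨S', T', hT', D', ho', hd', h'⟩ := hH
  have ho1 := ho.inter (isOpen_domQ T)
  have ho2 := ho'.inter (isOpen_domQ T')
  refine ⟨S * T' + T * S', T * T', mul_ne_zero hT hT', _, ho1.inter ho2,
    (hd.inter_of_isOpen_left (dense_domQ hT) ho).inter_of_isOpen_left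
      (hd'.inter_of_isOpen_left (dense_domQ hT') ho') ho1, fun p hp => ?_⟩
  beta_reduce
  rw [h p hp.1.1, h' p hp.2.1, div_add_div _ _ hp.1.2.2 hp.2.2.2]
  simp only [map_add, map_mul]

theorem InKX.mul {F H : X → ℂ} (hF : InKX F) (hH : InKX H) : InKX (fun p => F p * H p) := by
  obtain ⟨S, T, hT, D, ho, hd, h⟩ := hF
  obtain ⟨S', T', hT', D', ho', hd', h'⟩ := hH
  refine ⟨S * S', T * T', mul_ne_zero hT hT', _, ho.inter ho', hd.inter_of_isOpen_left hd' ho,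
    fun p hp => ?_⟩
  beta_reduce
  rw [h p hp.1, h' p hp.2, div_mul_div_comm, map_mul, map_mul]

theorem InKX.inv {F : X → ℂ} (hF : InKX F) {D' : Set X} (hd' : Dense D') (h' : ∀ p ∈ D', F p ≠ 0) :
    InKX (fun p => (F p)⁻¹) := by
  obtain ⟨S, T, hT, D, ho, hd, h⟩ := hF
  refine ⟨T, S, ?_, D, ho, hd, fun p hp => by beta_reduce; rw [h p hp, inv_div]⟩
  rintro rfl
  obtain ⟨p, hp, hp'⟩ := hd'.inter_open_nonempty D ho hd.nonempty
  exact h' p hp' (by rw [h p hp]; simp)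

theorem InKX.aeval {f : Fin 2 → X → ℂ} (hf : ∀ i, InKX (f i)) (Q : MvPolynomial (Fin 2) ℚ) :
    InKX (fun p => MvPolynomial.aeval (fun i => f i p) Q) := by
  induction Q using MvPolynomial.induction_on with
  | C r => simpa using InKX.const r
  | add P Q hP hQ => simpa using hP.add hQ
  | mul_X P i hP => simpa using hP.mul (hf i)

theorem K_aeval {f : Fin 3 → X → ℂ} (hf : ∀ i, f i ∈ K) (P : MvPolynomial (Fin 3) ℚ) :
    (fun p => MvPolynomial.aeval (fun i => f i p) P) ∈ K := by
  induction P using MvPolynomial.induction_on with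
  | C r =>
    simp only [MvPolynomial.aeval_C]
    exact K.algebraMap_mem r
  | add P Q hP hQ =>
    simp only [map_add]
    exact K.add_mem hP hQ
  | mul_X P i hP =>
    simp only [map_mul, MvPolynomial.aeval_X]
    exact K.mul_mem hP (hf i)

theorem dense_x₃ : Dense {p : X | p.2 2 ≠ 0} :=
  (dense_domQ (one_ne_zero (α := MvPolynomial (Fin 2) ℚ))).mono fun _ hp => hp.1

theorem dense_smul_x₃ (g : G) : Dense {p : X | (g • p).2 2 ≠ 0} :=
  dense_x₃.preimage (Homeomorph.smul g).isOpenMap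

theorem InKX.linear (g : G) (i : Fin 3) : InKX (fun p : X => (g • p).2 i / p.2 2) := by
  refine ⟨MvPolynomial.C (g.A.1 i 0 : ℚ) * MvPolynomial.X 0 +
    MvPolynomial.C (g.A.1 i 1 : ℚ) * MvPolynomial.X 1 + MvPolynomial.C (g.A.1 i 2 : ℚ), 1,
    one_ne_zero, _, isOpen_x₃, dense_x₃, fun p hp => ?_⟩
  have hp' : p.2 2 ≠ 0 := hp
  simp only [G.smul_def, G.cmat, Matrix.mulVec, dotProduct, Fin.sum_univ_three, map_add, map_mul,
    MvPolynomial.aeval_C, MvPolynomial.aeval_X, map_one, crdX, Matrix.map_apply, div_one]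
  simp
  field_simp

theorem InKX.inv_linear (g : G) : InKX (fun p : X => ((g • p).2 2 / p.2 2)⁻¹) :=
  (InKX.linear g 2).inv (dense_x₃.inter_of_isOpen_left (dense_smul_x₃ g) isOpen_x₃)
    fun _ hp => div_ne_zero hp.2 hp.1

theorem div_eq_aux {a b c : ℂ} (hc : c ≠ 0) : a / b = a / c * (b / c)⁻¹ := by
  rw [inv_div, div_mul_div_cancel₀ hc]

theorem InKX.crdX_smul (g : G) (i : Fin 2) : InKX (fun p : X => crdX (g • p) i) := by
  obtain ⟨S, T, hT, D, ho, hd, h⟩ := (InKX.linear g (Fin.castSucc i)).mul (InKX.inv_linear g)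
  refine ⟨S, T, hT, _, ho.inter isOpen_x₃, hd.inter_of_isOpen_left dense_x₃ ho, fun p hp => ?_⟩
  have hp' : p.2 2 ≠ 0 := hp.2
  rw [← h p hp.1]
  fin_cases i
  · exact div_eq_aux hp'
  · exact div_eq_aux hp'

theorem K_crd_smul (g : G) (i : Fin 3) : (fun p : X => crd (g • p) i) ∈ K := by
  have hz : (fun p : X => (g • p).1 / p.2 2) ∈ K := by
    refine ⟨MvPolynomial.X 2 + MvPolynomial.C (g.n 0 : ℚ) * MvPolynomial.X 0 +
      MvPolynomial.C (g.n 1 : ℚ) * MvPolynomial.X 1 + MvPolynomial.C (g.n 2 : ℚ), 1,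
      one_ne_zero, _, isOpen_x₃, dense_x₃, fun p hp => ?_⟩
    have hp' : p.2 2 ≠ 0 := hp
    simp only [G.smul_def, Fin.sum_univ_three, map_add, map_mul,
      MvPolynomial.aeval_C, MvPolynomial.aeval_X, map_one, crd, div_one]
    simp
    field_simp
    ring
  fin_cases i
  · exact (InKX.crdX_smul g 0).mem_K
  · exact (InKX.crdX_smul g 1).mem_K
  · refine K_congr (K.mul_mem hz (InKX.inv_linear g).mem_K) isOpen_x₃ dense_x₃ fun p hp => ?_
    have hp' : p.2 2 ≠ 0 := hp
    exact div_eq_aux hp'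

/-- `K` is stable under the action of `G`. -/
theorem K_comp_smul (g : G) {F : X → ℂ} (hF : F ∈ K) : (fun p => F (g • p)) ∈ K := by
  obtain ⟨P, Q, hQ, D, ho, hd, h⟩ := hF
  have h1 := K_aeval (K_crd_smul g) P
  have h2 := InKX.inv (InKX.aeval (InKX.crdX_smul g) Q) (D' := (fun p => g • p) ⁻¹' domQ Q)
    ((dense_domQ hQ).preimage (Homeomorph.smul g).isOpenMap) fun p hp => hp.2
  refine K_congr (K.mul_mem h1 h2.mem_K) (D := (fun p => g • p) ⁻¹' D)
    (ho.preimage (Homeomorph.smul g).continuous)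
    (hd.preimage (Homeomorph.smul g).isOpenMap) fun p hp => ?_
  exact (h (g • p) hp).trans (div_eq_mul_inv _ _)

theorem ee_add (a b : ℂ) : ee (a + b) = ee a * ee b := by
  simp only [ee, mul_add, Complex.exp_add]

theorem ee_neg (a : ℂ) : ee (-a) = (ee a)⁻¹ := by
  simp only [ee, mul_neg, Complex.exp_neg]

/-- The group `M ⊆ N` of functions of the form `exp (2 π i f)` with
`f ∈ ℚ(x₁/x₃, x₂/x₃)[z/x₃]`. -/
def M : Subgroup N where
  carrier := {a | ∃ f ∈ K, (a : InvFun).IsClassOf fun p => ee (f p)}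
  one_mem' := ⟨0, K.zero_mem, InvPair.one, rfl, fun p _ => by simp [ee, InvPair.one]⟩
  mul_mem' := by
    rintro a b ⟨f, hf, ha⟩ ⟨g, hg, hb⟩
    refine ⟨f + g, K.add_mem hf hg, ?_⟩
    simp only [Pi.add_apply, ee_add]
    exact ha.mul hb
  inv_mem' := by
    rintro a ⟨f, hf, ha⟩
    refine ⟨-f, K.neg_mem hf, ?_⟩
    simp only [Pi.neg_apply, ee_neg]
    exact ha.inv

theorem M.smul_mem (g : G) {a : N} (ha : a ∈ M) : g • a ∈ M := by
  obtain ⟨f, hf, ha⟩ := ha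
  exact ⟨_, K_comp_smul g⁻¹ hf, ha.smul g⟩

/-- `M` is a `G`-module. -/
instance : MulDistribMulAction G M where
  smul g a := ⟨g • a.1, M.smul_mem g a.2⟩
  one_smul a := Subtype.ext (one_smul G a.1)
  mul_smul g h a := Subtype.ext (mul_smul g h a.1)
  smul_mul g a b := Subtype.ext (smul_mul' g a.1 b.1)
  smul_one g := Subtype.ext (smul_one g)

/-- `N / M` is a `G`-module. -/
instance : MulDistribMulAction G (N ⧸ M) where
  smul g := QuotientGroup.map M M (MulDistribMulAction.toMonoidHom N g) fun _ => M.smul_mem g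
  one_smul a := by
    obtain ⟨a, rfl⟩ := QuotientGroup.mk_surjective a
    exact congrArg QuotientGroup.mk (one_smul G a)
  mul_smul g h a := by
    obtain ⟨a, rfl⟩ := QuotientGroup.mk_surjective a
    exact congrArg QuotientGroup.mk (mul_smul g h a)
  smul_mul g a b := map_mul _ a b
  smul_one g := map_one _

/-- Every `f ∈ ℚ(x₁/x₃, x₂/x₃)[z/x₃]` defines an element of `M`. -/
theorem exists_mem_M {f : X → ℂ} (hf : f ∈ K) :
    ∃ a : M, ((a : N) : InvFun).IsClassOf fun p => ee (f p) := by
  have hf' := hf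
  obtain ⟨P, Q, hQ, D, ho, hd, h⟩ := hf
  have hsub : domQ Q ⊆ {p : X | p.2 2 ≠ 0} := fun p hp => hp.1
  let F : InvPair :=
    { toFun := fun p => ee (MvPolynomial.aeval (crd p) P / MvPolynomial.aeval (crdX p) Q)
      dom := domQ Q
      isOpen_dom := isOpen_domQ Q
      dense_dom := dense_domQ hQ
      holo := by
        simp only [ee, ← aeval_rename_crd]
        refine DifferentiableOn.cexp (DifferentiableOn.const_mul (differentiableOn_div
          ((differentiableOn_aeval_crd _).mono hsub) ((differentiableOn_aeval_crd _).mono hsub)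
          fun p hp => ?_) _)
        rw [aeval_rename_crd]
        exact hp.2
      ne_zero := fun p _ => Complex.exp_ne_zero _ }
  have hF : (InvFun.mk F).IsClassOf fun p => ee (f p) :=
    InvFun.IsClassOf.congr ⟨F, rfl, fun _ _ => rfl⟩ ho hd fun p hp => by rw [h p hp]
  have hN : InvFun.mk F ∈ N := by
    intro c
    refine InvFun.mk_eq.2 fun p _ => ?_
    have hc : (c : ℂ) ≠ 0 := c.ne_zero
    have h1 : ∀ a b : ℂ, (c : ℂ) * a / (c * b) = a / b := fun a b => mul_div_mul_left a b hc
    have h2 : crdX (dilation c p) = crdX p := by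
      funext i
      fin_cases i <;> exact h1 _ _
    have h3 : crd (dilation c p) = crd p := by
      funext i
      fin_cases i <;> exact h1 _ _
    change ee (_ / _) = ee (_ / _)
    rw [h2, h3]
  exact ⟨⟨⟨InvFun.mk F, hN⟩, f, hf', hF⟩, hF⟩

/-- The element `exp (i π L)` of `M`, for `L ∈ ℚ(x₁/x₃, x₂/x₃)[z/x₃]`. -/
def expPiI (L : K) : M :=
  (exists_mem_M (Subalgebra.smul_mem K L.2 (1 / 2 : ℚ))).choose

theorem expPiI_isClassOf (L : K) :
    ((expPiI L : N) : InvFun).IsClassOf fun p => Complex.exp (Complex.I * Real.pi * L.1 p) := by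
  have h := (exists_mem_M (Subalgebra.smul_mem K L.2 (1 / 2 : ℚ))).choose_spec
  have h2 : (fun p => ee (((1 / 2 : ℚ) • L.1) p)) =
      fun p => Complex.exp (Complex.I * Real.pi * L.1 p) := by
    funext p
    rw [ee, Pi.smul_apply, Rat.smul_def]
    congr 1
    push_cast
    ring
  exact h2 ▸ h

theorem mem_K_of {F : X → ℂ} (P : MvPolynomial (Fin 3) ℚ) (Q : MvPolynomial (Fin 2) ℚ)
    (hQ : Q ≠ 0)
    (h : ∀ a b w c : ℂ, c ≠ 0 → MvPolynomial.aeval ![a, b] Q ≠ 0 →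
      F (w * c, ![a * c, b * c, c]) =
        MvPolynomial.aeval ![a, b, w] P / MvPolynomial.aeval ![a, b] Q) : F ∈ K := by
  refine ⟨P, Q, hQ, domQ Q, isOpen_domQ Q, dense_domQ hQ, fun p hp => ?_⟩
  have hc : p.2 2 ≠ 0 := hp.1
  have hp' : p = (p.1 / p.2 2 * p.2 2, ![p.2 0 / p.2 2 * p.2 2, p.2 1 / p.2 2 * p.2 2, p.2 2]) := by
    refine Prod.ext (by simp [hc]) (funext fun i => ?_)
    fin_cases i <;> simp [hc]
  have := h (p.2 0 / p.2 2) (p.2 1 / p.2 2) (p.1 / p.2 2) (p.2 2) hc hp.2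
  rw [← hp'] at this
  exact this

theorem ne_zero_of_eval {Q : MvPolynomial (Fin 2) ℚ} (h : MvPolynomial.eval ![2, 3] Q ≠ 0) :
    Q ≠ 0 := by
  rintro rfl
  exact h (map_zero _)

/-! ### The functions `L` -/

/-- `L_{1,2}^2` -/
def L122 (p : X) : ℂ :=
  let z := p.1; let x₁ := p.2 0; let x₂ := p.2 1; let x₃ := p.2 2
  x₂ * (6 * z ^ 2 - 6 * (x₃ + 2 * x₂) * z + x₂ * x₁ - x₁ ^ 2 + 6 * x₂ ^ 2 + 6 * x₂ * x₃ + x₃ ^ 2) /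
    (6 * x₃ * x₁ * (x₂ - x₁))

/-- `L_{1,2}^1` -/
def L121 (p : X) : ℂ :=
  let z := p.1; let x₁ := p.2 0; let x₂ := p.2 1; let x₃ := p.2 2
  (-6 * z ^ 2 + 6 * (x₁ + x₃ + 2 * x₂) * z - x₃ ^ 2 - 6 * x₂ * x₁ - 3 * x₁ * x₃ - 6 * x₂ * x₃
    - 6 * x₂ ^ 2 - x₁ ^ 2) / (6 * x₁ * x₃)

/-- `L_{1,3}^2` -/
def L132 (p : X) : ℂ :=
  let z := p.1; let x₁ := p.2 0; let x₂ := p.2 1; let x₃ := p.2 2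
  (6 * z ^ 2 - 6 * (x₃ + 2 * x₂) * z + 6 * x₂ * x₃ - x₁ ^ 2 + 6 * x₂ ^ 2 + x₃ ^ 2 + x₁ * x₃) /
    (6 * (x₃ - x₁) * x₁)

/-- `L_3^2` -/
def L32 (p : X) : ℂ :=
  let z := p.1; let x₁ := p.2 0; let x₂ := p.2 1; let x₃ := p.2 2
  (2 * z - 2 * x₂ - 2 * x₃ + x₁) / x₁

/-- `L_{1,3}^{3,2}` -/
def L1332 (p : X) : ℂ :=
  let z := p.1; let x₁ := p.2 0; let x₂ := p.2 1; let x₃ := p.2 2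
  (2 * z - x₂) * (2 * z ^ 2 - 2 * z * x₂ - x₁ ^ 2 + x₁ * x₃ - x₃ ^ 2 + x₂ * x₁) /
    (12 * (x₃ - x₁) * x₃ * (x₂ - x₁))

/-- `L_{3,1}^{1,2}` -/
def L3112 (p : X) : ℂ :=
  let z := p.1; let x₁ := p.2 0; let x₂ := p.2 1; let x₃ := p.2 2
  (2 * z - x₂) * (2 * z ^ 2 - 2 * z * x₂ + x₂ * x₃ - x₁ ^ 2 + x₁ * x₃ - x₃ ^ 2) /
    (12 * x₁ * (x₂ - x₃) * (x₃ - x₁))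

/-- `L_{1,2}^{3,2}` -/
def L1232 (p : X) : ℂ :=
  let z := p.1; let x₁ := p.2 0; let x₂ := p.2 1; let x₃ := p.2 2
  x₂ * (2 * z - x₂) * (2 * z ^ 2 - 2 * z * x₂ + x₂ * x₃ - x₃ ^ 2 - x₁ ^ 2 + x₂ * x₁) /
    (12 * x₁ * (x₂ - x₁) * x₃ * (x₂ - x₃))

/-- Polynomial variables. -/
abbrev v₂ (i : Fin 2) : MvPolynomial (Fin 2) ℚ := MvPolynomial.X i

/-- Polynomial variables. -/
abbrev v₃ (i : Fin 3) : MvPolynomial (Fin 3) ℚ := MvPolynomial.X i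

theorem L122_mem : L122 ∈ K := by
  refine mem_K_of
    (v₃ 1 * (6 * v₃ 2 ^ 2 - 6 * (1 + 2 * v₃ 1) * v₃ 2 + v₃ 1 * v₃ 0 - v₃ 0 ^ 2 + 6 * v₃ 1 ^ 2 + 6 * v₃ 1 + 1))
    (6 * v₂ 0 * (v₂ 1 - v₂ 0)) (ne_zero_of_eval (by norm_num [v₂])) fun a b w c hc h => ?_
  simp [L122, v₂, v₃] at h ⊢
  obtain ⟨h1, h2⟩ := h
  have h3 : b * c - a * c ≠ 0 := by rw [← sub_mul]; exact mul_ne_zero h2 hc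
  field_simp

theorem L121_mem : L121 ∈ K := by
  refine mem_K_of
    (-6 * v₃ 2 ^ 2 + 6 * (v₃ 0 + 1 + 2 * v₃ 1) * v₃ 2 - 1 - 6 * v₃ 1 * v₃ 0 - 3 * v₃ 0 - 6 * v₃ 1
      - 6 * v₃ 1 ^ 2 - v₃ 0 ^ 2)
    (6 * v₂ 0) (ne_zero_of_eval (by norm_num [v₂])) fun a b w c hc h => ?_
  simp [L121, v₂, v₃] at h ⊢
  field_simp

theorem L132_mem : L132 ∈ K := by
  refine mem_K_of
    (6 * v₃ 2 ^ 2 - 6 * (1 + 2 * v₃ 1) * v₃ 2 + 6 * v₃ 1 - v₃ 0 ^ 2 + 6 * v₃ 1 ^ 2 + 1 + v₃ 0)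
    (6 * (1 - v₂ 0) * v₂ 0) (ne_zero_of_eval (by norm_num [v₂])) fun a b w c hc h => ?_
  simp [L132, v₂, v₃] at h ⊢
  field_simp

theorem L32_mem : L32 ∈ K := by
  refine mem_K_of (2 * v₃ 2 - 2 * v₃ 1 - 2 + v₃ 0) (v₂ 0) (ne_zero_of_eval (by norm_num [v₂]))
    fun a b w c hc h => ?_
  simp [L32, v₂, v₃] at h ⊢
  field_simp

theorem L1332_mem : L1332 ∈ K := by
  refine mem_K_of
    ((2 * v₃ 2 - v₃ 1) * (2 * v₃ 2 ^ 2 - 2 * v₃ 2 * v₃ 1 - v₃ 0 ^ 2 + v₃ 0 - 1 + v₃ 1 * v₃ 0))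
    (12 * (1 - v₂ 0) * (v₂ 1 - v₂ 0)) (ne_zero_of_eval (by norm_num [v₂])) fun a b w c hc h => ?_
  simp [L1332, v₂, v₃] at h ⊢
  field_simp

theorem L3112_mem : L3112 ∈ K := by
  refine mem_K_of
    ((2 * v₃ 2 - v₃ 1) * (2 * v₃ 2 ^ 2 - 2 * v₃ 2 * v₃ 1 + v₃ 1 - v₃ 0 ^ 2 + v₃ 0 - 1))
    (12 * v₂ 0 * (v₂ 1 - 1) * (1 - v₂ 0)) (ne_zero_of_eval (by norm_num [v₂])) fun a b w c hc h => ?_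
  simp [L3112, v₂, v₃] at h ⊢
  field_simp

theorem L1232_mem : L1232 ∈ K := by
  refine mem_K_of
    (v₃ 1 * (2 * v₃ 2 - v₃ 1) * (2 * v₃ 2 ^ 2 - 2 * v₃ 2 * v₃ 1 + v₃ 1 - 1 - v₃ 0 ^ 2 + v₃ 1 * v₃ 0))
    (12 * v₂ 0 * (v₂ 1 - v₂ 0) * (v₂ 1 - 1)) (ne_zero_of_eval (by norm_num [v₂])) fun a b w c hc h => ?_
  simp [L1232, v₂, v₃] at h ⊢
  field_simp



/-- The functions `L_j^k`. Indices `1, 2, 3` are `0, 1, 2` here. -/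
def Lt : Fin 3 → Fin 3 → K
  | 2, 1 => ⟨L32, L32_mem⟩
  | 1, 2 => -⟨L32, L32_mem⟩
  | _, _ => 0

/-- The functions `L_{i,j}^k`. -/
def Let : Fin 3 → Fin 3 → Fin 3 → K
  | 0, 1, 1 => ⟨L122, L122_mem⟩
  | 0, 1, 0 => ⟨L121, L121_mem⟩
  | 0, 2, 1 => ⟨L132, L132_mem⟩
  | _, _, _ => 0

/-- The functions `L_{i,j}^{k,l}`. -/
def Lee : Fin 3 → Fin 3 → Fin 3 → Fin 3 → K
  | 0, 2, 2, 1 => ⟨L1332, L1332_mem⟩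
  | 2, 0, 0, 1 => ⟨L3112, L3112_mem⟩
  | 0, 1, 2, 1 => ⟨L1232, L1232_mem⟩
  | 2, 1, 0, 1 => -⟨L1232, L1232_mem⟩
  | _, _, _, _ => 0

/-! ### The group `E` -/

/-- The generators of `E`: `ê_{i,j}` for `i ≠ j`, `t̂_i`, and the elements of `M`. -/
inductive Gen : Type
  | e (i j : Fin 3) (h : i ≠ j)
  | t (i : Fin 3)
  | m (u : M)

/-- `ê_{i,j}` in the free group. -/
def fe (i j : Fin 3) (h : i ≠ j) : FreeGroup Gen := FreeGroup.of (Gen.e i j h)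

/-- `t̂_i` in the free group. -/
def ft (i : Fin 3) : FreeGroup Gen := FreeGroup.of (Gen.t i)

/-- `u ∈ M` in the free group. -/
def fm (u : M) : FreeGroup Gen := FreeGroup.of (Gen.m u)

/-- The defining relations `lhs = rhs` of `E`. -/
inductive DefRel : FreeGroup Gen → FreeGroup Gen → Prop
  | m_mul (u v : M) : DefRel (fm u * fm v) (fm (u * v))
  | e_m (i j : Fin 3) (h : i ≠ j) (u : M) :
      DefRel (fe i j h * fm u) (fm (G.elem i j h • u) * fe i j h)
  | t_m (i : Fin 3) (u : M) : DefRel (ft i * fm u) (fm (G.trans i • u) * ft i)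
  | e_e_comm (i j k l : Fin 3) (hij : i ≠ j) (hkl : k ≠ l) (hil : i ≠ l) (hjk : j ≠ k) :
      DefRel (fe i j hij * fe k l hkl) (fm (expPiI (Lee i j k l)) * fe k l hkl * fe i j hij)
  | e_e (i j k : Fin 3) (hij : i ≠ j) (hjk : j ≠ k) (hik : i ≠ k) :
      DefRel (fe i j hij * fe j k hjk)
        (fm (expPiI (Lee i j j k)) * fe i k hik * fe j k hjk * fe i j hij)
  | e_pow : DefRel
      ((fe 0 2 (by decide) * (fe 2 0 (by decide))⁻¹ * fe 0 2 (by decide)) ^ 4) 1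
  | t_t (i j : Fin 3) : DefRel (ft i * ft j) (fm (expPiI (Lt i j)) * ft j * ft i)
  | e_t (i j k : Fin 3) (hij : i ≠ j) (hik : i ≠ k) :
      DefRel (fe i j hij * ft k) (fm (expPiI (Let i j k)) * ft k * fe i j hij)
  | t_e_t (i j : Fin 3) (hij : i ≠ j) :
      DefRel (ft j * fe i j hij * ft i) (fm (expPiI (Let i j i)) * ft i * fe i j hij)

/-- The relators `lhs * rhs⁻¹` of `E`. -/
def relators : Set (FreeGroup Gen) := {r | ∃ a b, DefRel a b ∧ r = a * b⁻¹}

/-- The group `E` generated by `ê_{i,j}`, `t̂_i` and the elements of `M`, with the defining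
relations above. -/
abbrev E : Type := PresentedGroup relators

theorem E.mk_eq {a b : FreeGroup Gen} (h : DefRel a b) :
    PresentedGroup.mk relators a = PresentedGroup.mk relators b := by
  rw [← mul_inv_eq_one, ← map_inv, ← map_mul]
  exact PresentedGroup.one_of_mem ⟨a, b, h, rfl⟩

/-- The generators `ê_{i,j}` of `E`. -/
def E.e (i j : Fin 3) (h : i ≠ j) : E := PresentedGroup.of (Gen.e i j h)

/-- The generators `t̂_i` of `E`. -/
def E.t (i : Fin 3) : E := PresentedGroup.of (Gen.t i)

/-- The natural homomorphism `M → E`. -/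
def E.ofM : M →* E := MonoidHom.mk' (fun u => PresentedGroup.of (Gen.m u)) fun u v =>
  ((map_mul (PresentedGroup.mk relators) (fm u) (fm v)).symm.trans
    (E.mk_eq (DefRel.m_mul u v))).symm

/-! ### Cohomology -/

/-- The exact sequence `1 → M → N → N/M → 1` of `G`-modules. -/
def coeffSeq : ShortComplex (Rep ℤ G) where
  X₁ := Rep.ofMulDistribMulAction G M
  X₂ := Rep.ofMulDistribMulAction G N
  X₃ := Rep.ofMulDistribMulAction G (N ⧸ M)
  f := Rep.ofHom
    { toLinearMap := (MonoidHom.toAdditive M.subtype).toIntLinearMap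
      isIntertwining' := fun _ => rfl }
  g := Rep.ofHom
    { toLinearMap := (MonoidHom.toAdditive (QuotientGroup.mk' M)).toIntLinearMap
      isIntertwining' := fun _ => rfl }
  zero := by
    ext a
    exact (QuotientGroup.eq_one_iff (N := M) _).2 (Subtype.property (p := (· ∈ M)) a)

theorem rep_exact {k Γ : Type} [CommRing k] [Group Γ] (S : ShortComplex (Rep.{0} k Γ))
    (h : ∀ x : S.X₂, S.g.hom x = 0 → ∃ y : S.X₁, S.f.hom y = x) : S.Exact := by
  have h' : (S.map (forget₂ (Rep.{0} k Γ) (ModuleCat.{0} k))).Exact :=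
    (ShortComplex.moduleCat_exact_iff _).2 h
  rwa [ShortComplex.exact_map_iff_of_faithful] at h'

theorem coeffSeq_shortExact : coeffSeq.ShortExact where
  exact := rep_exact _ fun (x : Additive N)
    (hx : Additive.ofMul (QuotientGroup.mk' M x.toMul) = 0) =>
    ⟨Additive.ofMul ⟨x.toMul, (QuotientGroup.eq_one_iff (N := M) _).1 hx⟩, rfl⟩
  mono_f := (Rep.mono_iff_injective _).2 (Subtype.val_injective (p := (· ∈ M)))
  epi_g := (Rep.epi_iff_surjective _).2 (QuotientGroup.mk'_surjective M)

/-- The connecting homomorphism `δ_* : H¹(G, N/M) → H²(G, M)`. -/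
def connecting : groupCohomology.H1 (Rep.ofMulDistribMulAction G (N ⧸ M)) ⟶
    groupCohomology.H2 (Rep.ofMulDistribMulAction G M) :=
  groupCohomology.δ coeffSeq_shortExact 1 2 rfl

/-- `S` is an extension of the `Γ`-module `A`: conjugation by elements of `B` on `A`
is the given action of `Γ`. -/
def IsExtensionOfModule {Γ A B : Type} [Group Γ] [CommGroup A] [MulDistribMulAction Γ A] [Group B]
    (S : GroupExtension A B Γ) : Prop :=
  ∀ (x : B) (a : A), x * S.inl a * x⁻¹ = S.inl (S.rightHom x • a)

open groupCohomology in
/-- `c ∈ H²(Γ, A)` is the characteristic class of the extension `S`: for every set-theoretic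
section `σ`, it is the class of the 2-cocycle `φ` with `σ(g) σ(h) = φ(g, h) σ(g h)`. -/
def IsCharacteristicClass {Γ A B : Type} [Group Γ] [CommGroup A] [MulDistribMulAction Γ A]
    [Group B] (S : GroupExtension A B Γ) (c : H2 (Rep.ofMulDistribMulAction Γ A)) : Prop :=
  ∀ σ : S.Section, ∃ (φ : Γ × Γ → A) (hφ : IsMulCocycle₂ φ),
    (∀ g h : Γ, σ g * σ h = S.inl (φ (g, h)) * σ (g * h)) ∧
    H2π (Rep.ofMulDistribMulAction Γ A) (cocyclesOfIsMulCocycle₂ hφ) = c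

/-- `a ∈ N/M` is the class of the function `F` on `X`. -/
def IsClassModM (a : N ⧸ M) (F : X → ℂ) : Prop :=
  ∃ b : N, (b : InvFun).IsClassOf F ∧ (QuotientGroup.mk b : N ⧸ M) = a

/-- The prescribed values on the generators `e_{i,j}`, `t_i` of `G` of the 1-cocycle `u` with
values in `N/M`. -/
structure HasGammaValues (u : G → N ⧸ M) : Prop where
  e₁₂ : IsClassModM (u (G.elem 0 1 (by decide))) fun p =>
    (ellGamma ((p.1 - p.2 1) / p.2 2) ((p.2 0 - p.2 1) / p.2 2) (-(p.2 0 / p.2 2)))⁻¹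
  e₃₂ : IsClassModM (u (G.elem 2 1 (by decide))) fun p =>
    ellGamma (p.1 / p.2 0) ((p.2 1 - p.2 2) / p.2 0) (p.2 2 / p.2 0)
  e_other : ∀ (i j : Fin 3) (h : i ≠ j), j ≠ 1 → u (G.elem i j h) = 1
  t₂ : IsClassModM (u (G.trans 1)) fun p =>
    theta₀ ((p.1 - p.2 1) / p.2 0) (p.2 2 / p.2 0)
  t_other : ∀ i : Fin 3, i ≠ 1 → u (G.trans i) = 1

end EllGamma

end

set_option linter.unusedSectionVars false

/-! Two independent facts are combined. One is combinatorial: `E` modulo the image of `M` is `G`.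
The other is analytic: the prescribed gamma and theta functions satisfy the relations of `E`
exactly, as functions, and not only modulo `M`.

Given elements `U`, `V`, `T` of `N` attached to `ê₁₂`, `ê₃₂`, `t̂₂` (and `1` to the other `ê` and
`t̂`) that satisfy the defining relations, sending each generator to the pair of its element of `N`
and its image in `G` defines a homomorphism `E → N ⋊ G`. Its restriction to `M` is the inclusion `M
⊆ N`, so `M → E` is injective. Its first component modulo `M` depends only on the image in `G`, and
this is the cocycle `u`. For a section `s` of `E → G`, the first components of `s(g)` form a cochain
in `N` lifting `u`; its coboundary is the 2-cocycle of `s`. That is the recipe for `δ_*[u]`. The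
argument is carried by `liftE`, `extE_isCharacteristicClass` and `main_of_isLift`.

Exactness at `E` requires the presentation of `SL(3, ℤ)` by the commutator relations and one fourth
power (`eq_one_of_rank_three`). It is proved by descent: a coset of the expected stabiliser of a
basis vector is attached to every nonzero integral vector by reducing the vector with elementary
moves, and the relations show that the result does not depend on the reduction (`predict_eq`). Hence
a word fixing a basis vector lies in the subgroup generated by the obvious stabilisers
(`smul_base_eq`). This reduces rank three to rank two, and rank two to powers of one element.

The relations for `U`, `V`, `T` come from period shifts of `θ₀` and `Γ` and from their modular
properties, which say that `thetaQuot` and `gammaQuot` equal `1`. Liouville's theorem shows that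
`thetaQuot` is constant in `z`; duplication formulas show that its cube is `1`. Then `gammaQuot` is
invariant under three periods independent over `ℤ`, which generate a non-discrete group, so it is
constant. Reflection and one more duplication give the value `1`, and the period shift of
`gammaQuot` returns `thetaQuot = 1`. The functions `L` are, up to sign and scale, the Bernoulli
polynomials in these identities or differences of them. All identities are checked at generic
points, which are dense by Baire's theorem. -/

noncomputable section

namespace EllGamma

/-! ### Commutator relations, Weyl elements and braid relations. -/

section Steinberg

variable {ι : Type} {H : Type} [Group H]

/-- The element `x_{ij} x_{ji}⁻¹ x_{ij}`. -/
def weyl (x : ι → ι → H) (i j : ι) : H := x i j * (x j i)⁻¹ * x i j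

/-- The commutator relations between elementary matrices. -/
structure IsCommutatorSystem (x : ι → ι → H) : Prop where
  comm : ∀ i j k l, i ≠ j → k ≠ l → i ≠ l → j ≠ k → x i j * x k l = x k l * x i j
  mul : ∀ i j k, i ≠ j → j ≠ k → i ≠ k → x i j * x j k = x i k * x j k * x i j

/-- The commutator relations and the braid relations between elementary matrices. -/
structure IsElementarySystem (x : ι → ι → H) : Prop extends IsCommutatorSystem x where
  braid : ∀ i j, i ≠ j → x i j * (x j i)⁻¹ * x i j = (x j i)⁻¹ * x i j * (x j i)⁻¹

namespace IsCommutatorSystem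

variable {x : ι → ι → H} (hx : IsCommutatorSystem x)
include hx

/-- Conjugation goes through the three factors of the Weyl element in turn: `x i j` fixes `x i k`,
`(x j i)⁻¹` turns it into `(x j k)⁻¹ * x i k`, and `x i j` turns that into `(x j k)⁻¹`. The three
companions below are the same computation for the other positions sharing one index with `i, j`. -/
theorem weyl_ik {i j k : ι} (hij : i ≠ j) (hik : i ≠ k) (hjk : j ≠ k) :
    SemiconjBy (weyl x i j) (x i k) (x j k)⁻¹ := by
  have a1 : SemiconjBy (x i j) (x i k) (x i k) := hx.comm i j i k hij hik hik hij.symm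
  have a2 : SemiconjBy (x i j) (x j k) (x i k * x j k) := hx.mul i j k hij hjk hik
  have d1 : SemiconjBy (x j i) (x i k) (x j k * x i k) := hx.mul j i k hij.symm hik hjk
  have d2 : SemiconjBy (x j i) (x j k) (x j k) := hx.comm j i j k hij.symm hjk hjk hij
  have d3 := (d2.inv_right.mul_right d1).inv_symm_left
  rw [inv_mul_cancel_left] at d3
  have a3 := a2.inv_right.mul_right a1
  rw [mul_inv_rev, inv_mul_cancel_right] at a3
  exact (a3.mul_left d3).mul_left a1

theorem weyl_jk {i j k : ι} (hij : i ≠ j) (hik : i ≠ k) (hjk : j ≠ k) :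
    SemiconjBy (weyl x i j) (x j k) (x i k) := by
  have a1 : SemiconjBy (x i j) (x i k) (x i k) := hx.comm i j i k hij hik hik hij.symm
  have a2 : SemiconjBy (x i j) (x j k) (x i k * x j k) := hx.mul i j k hij hjk hik
  have d1 : SemiconjBy (x j i) (x i k) (x j k * x i k) := hx.mul j i k hij.symm hik hjk
  have d2 : SemiconjBy (x j i) (x j k) (x j k) := hx.comm j i j k hij.symm hjk hjk hij
  have c : x i k * x j k = x j k * x i k := hx.comm i k j k hik hjk hik hjk.symm
  rw [← c] at d1
  have d3 : SemiconjBy (x j i) (x i k) (x i k * x j k) := d1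
  exact (a1.mul_left d3.inv_symm_left).mul_left a2

theorem weyl_kj {i j k : ι} (hij : i ≠ j) (hik : i ≠ k) (hjk : j ≠ k) :
    SemiconjBy (weyl x i j) (x k j) (x k i) := by
  have a1 : SemiconjBy (x i j) (x k j) (x k j) := hx.comm i j k j hij hjk.symm hij hjk.symm.symm
  have c : x k i * x k j = x k j * x k i :=
    hx.comm k i k j hik.symm hjk.symm hjk.symm hik
  have a2 : SemiconjBy (x i j) (x k i) ((x k j)⁻¹ * x k i) := by
    have := hx.mul k i j hik.symm hij hjk.symm
    rw [SemiconjBy, mul_assoc, this]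
    group
  have d1 : SemiconjBy (x j i) (x k j) ((x k i)⁻¹ * x k j) := by
    have := hx.mul k j i hjk.symm hij.symm hik.symm
    rw [SemiconjBy, mul_assoc, this]
    group
  have d2 : SemiconjBy (x j i) (x k i) (x k i) := hx.comm j i k i hij.symm hik.symm hij.symm hik
  have d3 := (d2.mul_right d1).inv_symm_left
  rw [mul_inv_cancel_left] at d3
  have a3 := a2.mul_right a1
  rw [show (x k j)⁻¹ * x k i * x k j = x k i by rw [mul_assoc, c, inv_mul_cancel_left]] at a3
  exact (a3.mul_left d3).mul_left a1

theorem weyl_ki {i j k : ι} (hij : i ≠ j) (hik : i ≠ k) (hjk : j ≠ k) :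
    SemiconjBy (weyl x i j) (x k i) (x k j)⁻¹ := by
  have a1 : SemiconjBy (x i j) (x k j) (x k j) := hx.comm i j k j hij hjk.symm hij hjk.symm.symm
  have a2 : SemiconjBy (x i j) (x k i) ((x k j)⁻¹ * x k i) := by
    have := hx.mul k i j hik.symm hij hjk.symm
    rw [SemiconjBy, mul_assoc, this]
    group
  have d1 : SemiconjBy (x j i) (x k j) ((x k i)⁻¹ * x k j) := by
    have := hx.mul k j i hjk.symm hij.symm hik.symm
    rw [SemiconjBy, mul_assoc, this]
    group
  have d3 := d1.inv_right.inv_symm_left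
  rw [mul_inv_rev, inv_inv] at d3
  exact (a1.inv_right.mul_left d3).mul_left a2

/-- In rank at least three the commutator relations imply the braid relations. -/
theorem isElementarySystem (h3 : ∀ i j : ι, ∃ k, k ≠ i ∧ k ≠ j) : IsElementarySystem x where
  toIsCommutatorSystem := hx
  braid := by
    intro i j hij
    obtain ⟨k, hki, hkj⟩ := h3 i j
    have w1 := hx.weyl_ik hij hki.symm hkj.symm
    have w2 := hx.weyl_kj hij hki.symm hkj.symm
    have e1 : x i j = x i k * x k j * (x i k)⁻¹ * (x k j)⁻¹ := by
      rw [hx.mul i k j hki.symm hkj hij]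
      group
    have e2 : (x j k)⁻¹ * x k i * (x j k)⁻¹⁻¹ * (x k i)⁻¹ = (x j i)⁻¹ := by
      have h1 := hx.mul j k i hkj.symm hki hij.symm
      have h2 : Commute (x j k)⁻¹ (x j i) :=
        Commute.inv_left (hx.comm j k j i hkj.symm hij.symm hij.symm hkj)
      rw [inv_inv, mul_inv_eq_iff_eq_mul, eq_inv_mul_iff_mul_eq, mul_assoc, ← mul_assoc,
        ← h2.eq, mul_assoc, ← mul_assoc (x j i), ← h1, inv_mul_cancel_left]
    -- `x i j` is the commutator of `x i k` and `x k j`, so its conjugate by the Weyl element is the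
    -- commutator of `(x j k)⁻¹` and `x k i`, which is `(x j i)⁻¹`. Cancelling `x i j` on the right
    -- of `w * x i j = (x j i)⁻¹ * w` leaves the braid relation.
    have w3 := ((w1.mul_right w2).mul_right w1.inv_right).mul_right w2.inv_right
    rw [← e1, e2] at w3
    have := w3.eq
    rw [weyl, mul_assoc, mul_assoc, mul_assoc] at this
    have h4 : x i j * ((x j i)⁻¹ * x i j) * x i j =
      (x j i)⁻¹ * x i j * (x j i)⁻¹ * x i j := by
      simpa only [mul_assoc] using this
    have := mul_right_cancel h4
    rwa [← mul_assoc] at this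

end IsCommutatorSystem

namespace IsElementarySystem

variable {x : ι → ι → H} (hx : IsElementarySystem x)
include hx

/-- The braid relation gives two words for the Weyl element. The second word times `x i j` is `(x j
i)⁻¹` times the first. -/
theorem weyl_ij {i j : ι} (hij : i ≠ j) : SemiconjBy (weyl x i j) (x i j) (x j i)⁻¹ := by
  have h := hx.braid i j hij
  rw [SemiconjBy, weyl, h]
  conv_lhs => rw [← h]
  rw [h]
  simp only [mul_assoc] at h ⊢
  rw [h]

theorem weyl_ji {i j : ι} (hij : i ≠ j) : SemiconjBy (weyl x i j) (x j i) (x i j)⁻¹ := by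
  have h := hx.braid i j hij
  rw [SemiconjBy, weyl, h, inv_mul_cancel_right, ← h]
  group

/-- Weyl elements permute the elementary generators up to inversion. This transports a reducing move
of a vector to a reducing move of its image under a Weyl element. -/
theorem conj (i j k l : ι) (hij : i ≠ j) (hkl : k ≠ l) : ∃ k' l', k' ≠ l' ∧ ∃ η : ℤˣ,
    weyl x i j * x k l = x k' l' ^ (η : ℤ) * weyl x i j := by
  have pos : ∀ {k' l'}, k' ≠ l' → SemiconjBy (weyl x i j) (x k l) (x k' l') →
      ∃ k' l', k' ≠ l' ∧ ∃ η : ℤˣ, weyl x i j * x k l = x k' l' ^ (η : ℤ) * weyl x i j :=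
    fun {k' l'} h e => ⟨k', l', h, 1, by simpa using e.eq⟩
  have neg : ∀ {k' l'}, k' ≠ l' → SemiconjBy (weyl x i j) (x k l) (x k' l')⁻¹ →
      ∃ k' l', k' ≠ l' ∧ ∃ η : ℤˣ, weyl x i j * x k l = x k' l' ^ (η : ℤ) * weyl x i j :=
    fun {k' l'} h e => ⟨k', l', h, -1, by simpa using e.eq⟩
  by_cases hki : k = i
  · subst hki
    by_cases hlj : l = j
    · subst hlj
      exact neg hij.symm (hx.weyl_ij hij)
    · exact neg (Ne.symm hlj) (hx.weyl_ik hij hkl (Ne.symm hlj))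
  by_cases hkj : k = j
  · subst hkj
    by_cases hli : l = i
    · subst hli
      exact neg hij (hx.weyl_ji hij)
    · exact pos (Ne.symm hli) (hx.weyl_jk hij (Ne.symm hli) hkl)
  by_cases hli : l = i
  · subst hli
    exact neg hkj (hx.weyl_ki hij (Ne.symm hki) (Ne.symm hkj))
  by_cases hlj : l = j
  · subst hlj
    exact pos hki (hx.weyl_kj hij (Ne.symm hki) (Ne.symm hkj))
  have h1 : SemiconjBy (x i j) (x k l) (x k l) :=
    hx.comm i j k l hij hkl (Ne.symm hli) (Ne.symm hkj)
  have h2 : SemiconjBy (x j i) (x k l) (x k l) :=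
    hx.comm j i k l hij.symm hkl (Ne.symm hlj) (Ne.symm hki)
  exact pos hkl ((h1.mul_left h2.inv_symm_left).mul_left h1)

theorem weyl_symm {i j : ι} (hij : i ≠ j) : weyl x j i = (weyl x i j)⁻¹ := by
  rw [weyl, weyl, hx.braid i j hij]
  group

theorem comm' {i j k l : ι} (hij : i ≠ j) (hkl : k ≠ l) (hil : i ≠ l) (hjk : j ≠ k) (ε δ : ℤˣ) :
    x i j ^ (ε : ℤ) * x k l ^ (δ : ℤ) = x k l ^ (δ : ℤ) * x i j ^ (ε : ℤ) :=
  Commute.zpow_zpow (hx.comm i j k l hij hkl hil hjk) _ _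

/-- Since `x i k` commutes with both factors, the commutator of the signed factors is `x i k` to the
power `η = ε δ`. -/
theorem mul' {i j k : ι} (hij : i ≠ j) (hjk : j ≠ k) (hik : i ≠ k) (ε δ : ℤˣ) : ∃ η : ℤˣ,
    x i j ^ (ε : ℤ) * x j k ^ (δ : ℤ) = x i k ^ (η : ℤ) * (x j k ^ (δ : ℤ) * x i j ^ (ε : ℤ)) := by
  have h := hx.mul i j k hij hjk hik
  have h1 := hx.comm i k i j hik hij hij hik.symm
  have h2 := hx.comm i k j k hik hjk hik hjk.symm
  generalize x i j = a at *
  generalize x j k = b at *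
  generalize x i k = c at *
  have c1 : Commute c a := h1
  have c2 : Commute c b := h2
  rcases Int.units_eq_one_or ε with rfl | rfl <;> rcases Int.units_eq_one_or δ with rfl | rfl
  · exact ⟨1, by simpa [mul_assoc] using h⟩
  · refine ⟨-1, ?_⟩
    simp only [Units.val_one, zpow_one, Units.val_neg, zpow_neg]
    have : a = b⁻¹ * (c⁻¹ * (a * b)) := by rw [h]; group
    calc a * b⁻¹ = b⁻¹ * (c⁻¹ * (a * b)) * b⁻¹ := by rw [← this]
      _ = c⁻¹ * (b⁻¹ * a) := by
        rw [← mul_assoc b⁻¹, ← (c2.inv_inv).eq]; group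
  · refine ⟨-1, ?_⟩
    simp only [Units.val_one, zpow_one, Units.val_neg, zpow_neg]
    have : b = c⁻¹ * (a * b) * a⁻¹ := by rw [h]; group
    calc a⁻¹ * b = a⁻¹ * (c⁻¹ * (a * b) * a⁻¹) := by rw [← this]
      _ = c⁻¹ * (b * a⁻¹) := by
        rw [← mul_assoc, ← mul_assoc, ← (c1.inv_inv).eq]; group
  · refine ⟨1, ?_⟩
    simp only [Units.val_one, zpow_one, Units.val_neg, zpow_neg]
    have : b * a * c = a * b := by rw [mul_assoc, ← c1.eq, ← mul_assoc, ← c2.eq, h]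
    rw [← mul_inv_rev, ← mul_inv_rev, ← this]
    group

theorem braid' {i j : ι} (hij : i ≠ j) (ε : ℤˣ) :
    x i j ^ (ε : ℤ) * (x j i ^ (ε : ℤ))⁻¹ * x i j ^ (ε : ℤ) =
      (x j i ^ (ε : ℤ))⁻¹ * x i j ^ (ε : ℤ) * (x j i ^ (ε : ℤ))⁻¹ := by
  rcases Int.units_eq_one_or ε with rfl | rfl
  · simpa using hx.braid i j hij
  · simpa using (hx.braid j i hij.symm).symm

theorem conj' {i j k l : ι} (hij : i ≠ j) (hkl : k ≠ l) (ε : ℤˣ) : ∃ k' l', k' ≠ l' ∧ ∃ η : ℤˣ,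
    weyl x i j * x k l ^ (ε : ℤ) = x k' l' ^ (η : ℤ) * weyl x i j := by
  obtain ⟨k', l', h, η, e⟩ := hx.conj i j k l hij hkl
  refine ⟨k', l', h, η * ε, ?_⟩
  have e' : SemiconjBy (weyl x i j) (x k l) (x k' l' ^ (η : ℤ)) := e
  have := (e'.zpow_right (ε : ℤ)).eq
  rwa [← zpow_mul, ← Units.val_mul] at this

/-- This word links the results of two opposite reducing moves. Being a Weyl element, it is covered
by the second half of `SectionEquivariant`. -/
theorem weyl_cases {i j : ι} (hij : i ≠ j) (ε : ℤˣ) :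
    (x i j ^ (ε : ℤ))⁻¹ * x j i ^ (ε : ℤ) * (x i j ^ (ε : ℤ))⁻¹ = weyl x i j ∨
    (x i j ^ (ε : ℤ))⁻¹ * x j i ^ (ε : ℤ) * (x i j ^ (ε : ℤ))⁻¹ = weyl x j i := by
  rcases Int.units_eq_one_or ε with rfl | rfl
  · right
    simpa [weyl] using (hx.braid j i hij.symm).symm
  · left
    simp [weyl]

end IsElementarySystem

end Steinberg

/-! ### Elementary moves on integral vectors and the section they define. -/

section Elementary

variable {ι : Type} [Fintype ι] [DecidableEq ι]

/-- The elementary transformation `v_i ↦ v_i + ε v_j` of `ℤ^ι`. -/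
def elemMove (i j : ι) (ε : ℤˣ) (v : ι → ℤ) : ι → ℤ := Function.update v i (v i + ε * v j)

/-- The `ℓ¹` norm on `ℤ^ι`. -/
def l1norm (v : ι → ℤ) : ℕ := ∑ i, (v i).natAbs

theorem elemMove_same (i j : ι) (ε : ℤˣ) (v : ι → ℤ) : elemMove i j ε v i = v i + ε * v j := by
  simp [elemMove]

theorem elemMove_ne {i k : ι} (h : k ≠ i) (j : ι) (ε : ℤˣ) (v : ι → ℤ) :
    elemMove i j ε v k = v k := by
  simp [elemMove, h]

/-- Written with sums on both sides to avoid subtraction of naturals; all later norm comparisons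
feed this to `omega`. -/
theorem l1norm_elemMove (i j : ι) (ε : ℤˣ) (v : ι → ℤ) :
    l1norm (elemMove i j ε v) + (v i).natAbs = l1norm v + (v i + ε * v j).natAbs := by
  have h : ∀ u : ι → ℤ, l1norm u = (u i).natAbs + ∑ k ∈ Finset.univ.erase i, (u k).natAbs :=
    fun u => (Finset.add_sum_erase _ (fun k => (u k).natAbs) (Finset.mem_univ i)).symm
  rw [h, h v, elemMove_same]
  have : ∑ k ∈ Finset.univ.erase i, (elemMove i j ε v k).natAbs =
      ∑ k ∈ Finset.univ.erase i, (v k).natAbs :=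
    Finset.sum_congr rfl fun k hk => by rw [elemMove_ne (Finset.ne_of_mem_erase hk)]
  omega

theorem elemMove_eq_self {i j : ι} (ε : ℤˣ) {v : ι → ℤ} (h : v j = 0) : elemMove i j ε v = v := by
  simp [elemMove, h]

theorem elemMove_ne_zero {i j : ι} (hij : i ≠ j) (ε : ℤˣ) {v : ι → ℤ} (h : v ≠ 0) :
    elemMove i j ε v ≠ 0 := by
  intro h0
  apply h
  have hj : v j = 0 := by rw [← elemMove_ne hij.symm j ε v, h0]; rfl
  rwa [elemMove_eq_self ε hj] at h0

variable {H : Type} [Group H]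

/-- The elements of an `H`-set assigned to the vectors `c e_k`, compatible with the action. -/
structure IsBaseSystem {Y : Type} [MulAction H Y] (x : ι → ι → H) (b : ι → ℤ → Y) : Prop where
  fix : ∀ i j k c, i ≠ j → j ≠ k → x i j • b k c = b k c
  weyl_right : ∀ i j c, i ≠ j → c ≠ 0 → weyl x i j • b j c = b i c
  weyl_left : ∀ i j c, i ≠ j → c ≠ 0 → weyl x i j • b i c = b j (-c)

variable {Y : Type} [MulAction H Y] [Nonempty Y]

open Classical in
/-- The map `ℤ^ι → Y` obtained from the values `b k c` at the vectors `c e_k` by reducing vectors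
with elementary transformations. -/
def redSection (x : ι → ι → H) (b : ι → ℤ → Y) (v : ι → ℤ) : Y :=
  -- The reducing move is an arbitrary choice; independence of it is the content of `predict_eq`.
  -- The final default is reached only at the zero vector.
  if h : ∃ m : ι × ι × ℤˣ, m.1 ≠ m.2.1 ∧ l1norm (elemMove m.1 m.2.1 m.2.2 v) < l1norm v then
    (x h.choose.1 h.choose.2.1 ^ (h.choose.2.2 : ℤ))⁻¹ •
      redSection x b (elemMove h.choose.1 h.choose.2.1 h.choose.2.2 v)
  else if h : ∃ k, v k ≠ 0 then b h.choose (v h.choose) else Classical.arbitrary Y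
termination_by l1norm v
decreasing_by exact h.choose_spec.2

/-- If `v i` and `v j` are nonzero and neither `v i + v j` nor `v i - v j` is smaller than `v i`,
then `|v i| < |v j|`. By symmetry two nonzero entries contradict each other. -/
theorem exists_eq_single_of_irreducible {v : ι → ℤ} (hv : v ≠ 0)
    (h : ¬ ∃ m : ι × ι × ℤˣ, m.1 ≠ m.2.1 ∧ l1norm (elemMove m.1 m.2.1 m.2.2 v) < l1norm v) :
    ∃ k c, c ≠ 0 ∧ v = Pi.single k c := by
  push Not at h
  obtain ⟨k, hk⟩ := Function.ne_iff.1 hv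
  have key : ∀ i j, i ≠ j → v i ≠ 0 → v j ≠ 0 → (v i).natAbs < (v j).natAbs := by
    intro i j hij hi hj
    have h1 := h (i, j, 1) hij
    have h2 := h (i, j, -1) hij
    have h3 := l1norm_elemMove i j 1 v
    have h4 := l1norm_elemMove i j (-1) v
    simp only [Units.val_one, Units.val_neg] at *
    omega
  refine ⟨k, v k, hk, funext fun l => ?_⟩
  by_cases hl : l = k
  · subst hl; simp
  · rw [Pi.single_eq_of_ne hl]
    by_contra h0
    exact lt_asymm (key l k hl h0 hk) (key k l (Ne.symm hl) hk h0)

theorem single_irreducible (k : ι) (c : ℤ) :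
    ¬ ∃ m : ι × ι × ℤˣ, m.1 ≠ m.2.1 ∧
      l1norm (elemMove m.1 m.2.1 m.2.2 (Pi.single k c)) < l1norm (Pi.single k c : ι → ℤ) := by
  rintro ⟨⟨i, j, ε⟩, hij, h⟩
  dsimp only at hij h
  have h3 := l1norm_elemMove i j ε (Pi.single k c : ι → ℤ)
  by_cases hi : i = k
  · subst hi
    rw [Pi.single_eq_of_ne hij.symm] at h3
    omega
  · rw [Pi.single_eq_of_ne hi] at h3
    omega

theorem redSection_single (x : ι → ι → H) (b : ι → ℤ → Y) (k : ι) {c : ℤ} (hc : c ≠ 0) :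
    redSection x b (Pi.single k c) = b k c := by
  have h : ∃ l, (Pi.single k c : ι → ℤ) l ≠ 0 := ⟨k, by simpa using hc⟩
  rw [redSection, dif_neg (single_irreducible k c), dif_pos h]
  have : h.choose = k := by
    by_contra h0
    exact h.choose_spec (Pi.single_eq_of_ne (M := fun _ => ℤ) h0 c)
  rw [this, Pi.single_eq_same]

/-- Equivariance of the section for vectors of norm less than `n`. -/
def SectionEquivariant (x : ι → ι → H) (ρ : H →* Equiv.Perm (ι → ℤ)) (b : ι → ℤ → Y) (n : ℕ) :
    Prop :=
  ∀ v : ι → ℤ, v ≠ 0 → l1norm v < n →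
    (∀ i j ε, i ≠ j → l1norm (elemMove i j ε v) ≤ l1norm v →
      redSection x b (elemMove i j ε v) = x i j ^ (ε : ℤ) • redSection x b v) ∧
    ∀ i j, i ≠ j → redSection x b (ρ (weyl x i j) v) = weyl x i j • redSection x b v

variable {x : ι → ι → H} (hx : IsElementarySystem x) {ρ : H →* Equiv.Perm (ι → ℤ)}
  (hρ : ∀ i j, i ≠ j → ∀ v, ρ (x i j) v = elemMove i j 1 v) {b : ι → ℤ → Y}

include hρ in
theorem perm_zpow {i j : ι} (hij : i ≠ j) (ε : ℤˣ) (v : ι → ℤ) :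
    ρ (x i j ^ (ε : ℤ)) v = elemMove i j ε v := by
  rcases Int.units_eq_one_or ε with rfl | rfl
  · simpa using hρ i j hij v
  · rw [Units.val_neg, Units.val_one, zpow_neg, zpow_one, map_inv, Equiv.Perm.inv_eq_iff_eq,
      hρ i j hij]
    funext k
    by_cases hk : k = i
    · subst hk
      rw [elemMove_same, elemMove_same, elemMove_ne hij.symm]
      simp
    · rw [elemMove_ne hk, elemMove_ne hk]

include hρ in
theorem elemMove_inv {i j : ι} (hij : i ≠ j) (ε : ℤˣ) (v : ι → ℤ) :
    elemMove i j (-ε) (elemMove i j ε v) = v := by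
  rw [← perm_zpow hρ hij, ← perm_zpow hρ hij, ← Equiv.Perm.mul_apply, ← map_mul, ← zpow_add]
  simp

include hρ in
theorem perm_weyl {i j : ι} (hij : i ≠ j) (v : ι → ℤ) :
    ρ (weyl x i j) v = elemMove i j 1 (elemMove j i (-1) (elemMove i j 1 v)) := by
  rw [weyl, map_mul, map_mul, Equiv.Perm.mul_apply, Equiv.Perm.mul_apply, hρ i j hij, hρ i j hij,
    ← perm_zpow hρ hij.symm]
  simp

include hρ in
theorem perm_weyl_left {i j : ι} (hij : i ≠ j) (v : ι → ℤ) : ρ (weyl x i j) v i = v j := by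
  simp [perm_weyl hρ hij, elemMove_same, elemMove_ne hij, elemMove_ne hij.symm]

include hρ in
theorem perm_weyl_right {i j : ι} (hij : i ≠ j) (v : ι → ℤ) : ρ (weyl x i j) v j = -v i := by
  simp [perm_weyl hρ hij, elemMove_same, elemMove_ne hij.symm]

include hρ in
theorem perm_weyl_ne {i j k : ι} (hij : i ≠ j) (hi : k ≠ i) (hj : k ≠ j) (v : ι → ℤ) :
    ρ (weyl x i j) v k = v k := by
  simp [perm_weyl hρ hij, elemMove_ne hi, elemMove_ne hj]

include hρ in
theorem l1norm_weyl {i j : ι} (hij : i ≠ j) (v : ι → ℤ) :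
    l1norm (ρ (weyl x i j) v) = l1norm v := by
  have h1 := l1norm_elemMove i j 1 v
  have h2 := l1norm_elemMove j i (-1) (elemMove i j 1 v)
  have h3 := l1norm_elemMove i j 1 (elemMove j i (-1) (elemMove i j 1 v))
  rw [perm_weyl hρ hij]
  simp only [elemMove_same, elemMove_ne hij, elemMove_ne hij.symm, Units.val_one,
    Units.val_neg] at h1 h2 h3
  omega

include hρ in
theorem perm_weyl_ne_zero {i j : ι} (hij : i ≠ j) {v : ι → ℤ} (hv : v ≠ 0) :
    ρ (weyl x i j) v ≠ 0 := by
  rw [perm_weyl hρ hij]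
  exact elemMove_ne_zero hij _ (elemMove_ne_zero hij.symm _ (elemMove_ne_zero hij _ hv))

/-- A move that raises the norm is the inverse of one that lowers it, so the direction of the
inequality in `SectionEquivariant` is no restriction. -/
theorem SectionEquivariant.move {n : ℕ} (IH : SectionEquivariant x ρ b n)
    (hρ : ∀ i j, i ≠ j → ∀ v, ρ (x i j) v = elemMove i j 1 v) {i j : ι} (hij : i ≠ j) (ε : ℤˣ)
    {v : ι → ℤ} (hv : v ≠ 0) (h1 : l1norm v < n) (h2 : l1norm (elemMove i j ε v) < n) :
    redSection x b (elemMove i j ε v) = x i j ^ (ε : ℤ) • redSection x b v := by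
  rcases le_total (l1norm (elemMove i j ε v)) (l1norm v) with h | h
  · exact (IH v hv h1).1 i j ε hij h
  · have := (IH _ (elemMove_ne_zero hij ε hv) h2).1 i j (-ε) hij
    rw [elemMove_inv hρ hij] at this
    rw [this h, ← mul_smul, Units.val_neg, zpow_neg, mul_inv_cancel, one_smul]

end Elementary

end EllGamma

end

noncomputable section

namespace EllGamma

/-! ### Confluence of reductions and equivariance of the section. -/

section Confluence

variable {ι : Type} [Fintype ι] [DecidableEq ι] {H : Type} [Group H]
  {Y : Type} [MulAction H Y] [Nonempty Y]
  {x : ι → ι → H} (hx : IsElementarySystem x) {ρ : H →* Equiv.Perm (ι → ℤ)}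
  (hρ : ∀ i j, i ≠ j → ∀ v, ρ (x i j) v = elemMove i j 1 v) {b : ι → ℤ → Y}

/-- The value of the section at `v` predicted by the transformation `x_{ij}^ε`. -/
def predict (x : ι → ι → H) (b : ι → ℤ → Y) (i j : ι) (ε : ℤˣ) (v : ι → ℤ) : Y :=
  (x i j ^ (ε : ℤ))⁻¹ • redSection x b (elemMove i j ε v)

theorem red_iff (i j : ι) (ε : ℤˣ) (v : ι → ℤ) :
    l1norm (elemMove i j ε v) < l1norm v ↔ (v i + ε * v j).natAbs < (v i).natAbs := by
  have := l1norm_elemMove i j ε v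
  omega

variable {n : ℕ} (IH : SectionEquivariant x ρ b n) {v : ι → ℤ} (hv : v ≠ 0) (hn : l1norm v ≤ n)
include hx hρ IH hv hn

/-- The two orders of the moves close up to a square. The bound on its fourth corner lets the
induction hypothesis be used on the two far edges. -/
theorem predict_eq_of_comm {i j k l : ι} (hij : i ≠ j) (hkl : k ≠ l) (hil : i ≠ l) (hjk : j ≠ k)
    {ε δ : ℤˣ} (h1 : l1norm (elemMove i j ε v) < l1norm v)
    (h2 : l1norm (elemMove k l δ v) < l1norm v)
    (h3 : l1norm (elemMove k l δ (elemMove i j ε v)) < l1norm v) :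
    predict x b i j ε v = predict x b k l δ v := by
  have hc := hx.comm' hij hkl hil hjk ε δ
  have e : elemMove k l δ (elemMove i j ε v) = elemMove i j ε (elemMove k l δ v) := by
    simp only [← perm_zpow hρ hij, ← perm_zpow hρ hkl, ← Equiv.Perm.mul_apply, ← map_mul, hc]
  have e1 := IH.move hρ hkl δ (elemMove_ne_zero hij ε hv) (by omega) (by omega)
  have e2 := IH.move hρ hij ε (elemMove_ne_zero hkl δ hv) (by omega) (by rw [← e]; omega)
  rw [e, e2] at e1
  rw [predict, predict, ← inv_smul_eq_iff.2 e1, smul_smul, smul_smul]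
  congr 1
  rw [mul_assoc, inv_mul_eq_iff_eq_mul, inv_mul_eq_iff_eq_mul, ← mul_assoc, ← hc,
    mul_inv_cancel_right]

theorem predict_eq_of_opposite {i j : ι} (hij : i ≠ j) {ε : ℤˣ}
    (h1 : l1norm (elemMove i j ε v) < l1norm v) (h2 : l1norm (elemMove j i ε v) < l1norm v) :
    predict x b i j ε v = predict x b j i ε v := by
  -- `u` has entries `-ε v j` and `v j + ε v i` at `i` and `j`. It is one move away from the second
  -- reduct and is the image of the first under a Weyl element, and its norm is smaller than that of
  -- `v`.
  obtain ⟨u, hu⟩ : ∃ u, u = elemMove i j (-ε) (elemMove j i ε v) := ⟨_, rfl⟩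
  have N1 := (red_iff i j ε v).1 h1
  have N2 := (red_iff j i ε v).1 h2
  have hu_norm : l1norm u < l1norm v := by
    have N3 := l1norm_elemMove j i ε v
    have N4 := l1norm_elemMove i j (-ε) (elemMove j i ε v)
    rw [elemMove_same, elemMove_ne hij, ← hu] at N4
    rcases Int.units_eq_one_or ε with rfl | rfl <;>
    · simp only [Units.val_one, Units.val_neg, neg_neg] at *
      omega
  have e1 := IH.move hρ hij (-ε) (elemMove_ne_zero hij.symm ε hv) (by omega)
    (by rw [← hu]; omega)
  rw [← hu] at e1
  have e2 : u = ρ ((x i j ^ (ε : ℤ))⁻¹ * x j i ^ (ε : ℤ) * (x i j ^ (ε : ℤ))⁻¹)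
      (elemMove i j ε v) := by
    rw [hu, ← zpow_neg, ← Units.val_neg]
    simp only [map_mul, Equiv.Perm.mul_apply, perm_zpow hρ hij, perm_zpow hρ hij.symm,
      elemMove_inv hρ hij]
  have e3 : redSection x b u =
      ((x i j ^ (ε : ℤ))⁻¹ * x j i ^ (ε : ℤ) * (x i j ^ (ε : ℤ))⁻¹) •
        redSection x b (elemMove i j ε v) := by
    rw [e2]
    rcases hx.weyl_cases hij ε with hw | hw <;> rw [hw]
    · exact (IH _ (elemMove_ne_zero hij ε hv) (by omega)).2 i j hij
    · exact (IH _ (elemMove_ne_zero hij ε hv) (by omega)).2 j i hij.symm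
  rw [e1, Units.val_neg, zpow_neg, mul_assoc, mul_smul, smul_left_cancel_iff, mul_smul] at e3
  rw [predict, predict, e3, inv_smul_smul]

theorem predict_eq_of_disjoint {i j k l : ι} (hij : i ≠ j) (hkl : k ≠ l) (hil : i ≠ l)
    (hjk : j ≠ k) (hik : i ≠ k) {ε δ : ℤˣ} (h1 : l1norm (elemMove i j ε v) < l1norm v)
    (h2 : l1norm (elemMove k l δ v) < l1norm v) :
    predict x b i j ε v = predict x b k l δ v := by
  refine predict_eq_of_comm hx hρ IH hv hn hij hkl hil hjk h1 h2 ?_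
  have N2 := (red_iff k l δ v).1 h2
  have N3 := l1norm_elemMove k l δ (elemMove i j ε v)
  rw [elemMove_ne hik.symm, elemMove_ne hil.symm] at N3
  omega

/-- If `|v i| ≤ |v j|`, the opposite move into row `j` also reduces, and it is disjoint from the
move into row `l`. Otherwise the composites in the two orders stay below the norm of `v`, and they
differ by one further move of type `l, j`, as the commutator relation says. -/
theorem predict_eq_of_chain {i j l : ι} (hij : i ≠ j) (hli : l ≠ i) (hlj : l ≠ j)
    {ε δ : ℤˣ} (h1 : l1norm (elemMove i j ε v) < l1norm v)
    (h2 : l1norm (elemMove l i δ v) < l1norm v) :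
    predict x b i j ε v = predict x b l i δ v := by
  have N1 := (red_iff i j ε v).1 h1
  have N2 := (red_iff l i δ v).1 h2
  by_cases h : (v i).natAbs ≤ (v j).natAbs
  · have h3 : l1norm (elemMove j i ε v) < l1norm v := by
      rw [red_iff]
      rcases Int.units_eq_one_or ε with rfl | rfl <;>
      · simp only [Units.val_one, Units.val_neg] at *
        omega
    rw [predict_eq_of_opposite hx hρ IH hv hn hij h1 h3]
    exact predict_eq_of_disjoint hx hρ IH hv hn hij.symm hli hij.symm hli.symm hlj.symm h3 h2
  · have N3 := l1norm_elemMove l i δ (elemMove i j ε v)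
    have N4 := l1norm_elemMove i j ε (elemMove l i δ v)
    rw [elemMove_ne hli, elemMove_same] at N3
    rw [elemMove_ne hli.symm, elemMove_ne hlj.symm] at N4
    have N5 := l1norm_elemMove i j ε v
    have hz1 : l1norm (elemMove l i δ (elemMove i j ε v)) < l1norm v := by
      rcases Int.units_eq_one_or ε with rfl | rfl <;>
      rcases Int.units_eq_one_or δ with rfl | rfl <;>
      · simp only [Units.val_one, Units.val_neg] at *
        omega
    have hz2 : l1norm (elemMove i j ε (elemMove l i δ v)) < l1norm v := by omega
    obtain ⟨η, hη⟩ := hx.mul' hli hij hlj δ ε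
    have e : elemMove l i δ (elemMove i j ε v) =
        elemMove l j η (elemMove i j ε (elemMove l i δ v)) := by
      simp only [← perm_zpow hρ hij, ← perm_zpow hρ hli, ← perm_zpow hρ hlj,
        ← Equiv.Perm.mul_apply, ← map_mul, hη]
    have e1 := IH.move hρ hli δ (elemMove_ne_zero hij ε hv) (by omega) (by omega)
    have e2 := IH.move hρ hij ε (elemMove_ne_zero hli δ hv) (by omega) (by omega)
    have e3 := IH.move hρ hlj η (elemMove_ne_zero hij ε (elemMove_ne_zero hli δ hv))
      (by omega) (by rw [← e]; omega)
    rw [← e, e1, e2] at e3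
    rw [predict, predict, ← inv_smul_eq_iff.2 e3.symm, smul_smul, smul_smul, smul_smul]
    congr 1
    rw [mul_assoc, mul_assoc, inv_mul_eq_iff_eq_mul, inv_mul_eq_iff_eq_mul, ← mul_assoc, hη,
      ← mul_assoc, mul_inv_cancel_right]

theorem predict_eq {i j k l : ι} (hij : i ≠ j) (hkl : k ≠ l) {ε δ : ℤˣ}
    (h1 : l1norm (elemMove i j ε v) < l1norm v) (h2 : l1norm (elemMove k l δ v) < l1norm v) :
    predict x b i j ε v = predict x b k l δ v := by
  have N1 := (red_iff i j ε v).1 h1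
  have N2 := (red_iff k l δ v).1 h2
  by_cases hil : i = l
  · subst hil
    by_cases hjk : j = k
    · subst hjk
      -- A reducing sign must be opposite to the sign of `v i * v j`, whichever of the two rows is
      -- changed.
      have : ε = δ := by
        rcases Int.units_eq_one_or ε with rfl | rfl <;>
        rcases Int.units_eq_one_or δ with rfl | rfl <;>
        first
        | rfl
        | simp only [Units.val_one, Units.val_neg] at *
          omega
      subst this
      exact predict_eq_of_opposite hx hρ IH hv hn hij h1 h2
    · exact predict_eq_of_chain hx hρ IH hv hn hij hkl (Ne.symm hjk) h1 h2
  by_cases hjk : j = k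
  · subst hjk
    exact (predict_eq_of_chain hx hρ IH hv hn hkl hij hil h2 h1).symm
  by_cases hik : i = k
  · subst hik
    by_cases hjl : j = l
    · subst hjl
      have : ε = δ := by
        rcases Int.units_eq_one_or ε with rfl | rfl <;>
        rcases Int.units_eq_one_or δ with rfl | rfl <;>
        first
        | rfl
        | simp only [Units.val_one, Units.val_neg] at *
          omega
      rw [this]
    -- Both moves change row `i`. If one of the added entries is at least as large as `v i`, that
    -- move is traded for its opposite and the pair becomes a chain. If both are smaller, adding
    -- both still shrinks `v i` and the moves commute.
    by_cases hl : (v i).natAbs ≤ (v l).natAbs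
    · have h3 : l1norm (elemMove l i δ v) < l1norm v := by
        rw [red_iff]
        rcases Int.units_eq_one_or δ with rfl | rfl <;>
        · simp only [Units.val_one, Units.val_neg] at *
          omega
      rw [predict_eq_of_opposite hx hρ IH hv hn hkl h2 h3]
      exact predict_eq_of_chain hx hρ IH hv hn hij hkl.symm (Ne.symm hjl) h1 h3
    by_cases hj : (v i).natAbs ≤ (v j).natAbs
    · have h3 : l1norm (elemMove j i ε v) < l1norm v := by
        rw [red_iff]
        rcases Int.units_eq_one_or ε with rfl | rfl <;>
        · simp only [Units.val_one, Units.val_neg] at *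
          omega
      rw [predict_eq_of_opposite hx hρ IH hv hn hij h1 h3]
      exact (predict_eq_of_chain hx hρ IH hv hn hkl hij.symm hjl h2 h3).symm
    refine predict_eq_of_comm hx hρ IH hv hn hij hkl hkl hij.symm h1 h2 ?_
    have N3 := l1norm_elemMove i l δ (elemMove i j ε v)
    have N4 := l1norm_elemMove i j ε v
    rw [elemMove_ne hkl.symm, elemMove_same] at N3
    rcases Int.units_eq_one_or ε with rfl | rfl <;>
    rcases Int.units_eq_one_or δ with rfl | rfl <;>
    · simp only [Units.val_one, Units.val_neg] at *
      omega
  · exact predict_eq_of_disjoint hx hρ IH hv hn hij hkl hil hjk hik h1 h2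

theorem redSection_eq_predict {i j : ι} (hij : i ≠ j) {ε : ℤˣ}
    (h : l1norm (elemMove i j ε v) < l1norm v) : redSection x b v = predict x b i j ε v := by
  have hex : ∃ m : ι × ι × ℤˣ, m.1 ≠ m.2.1 ∧ l1norm (elemMove m.1 m.2.1 m.2.2 v) < l1norm v :=
    ⟨(i, j, ε), hij, h⟩
  rw [redSection, dif_pos hex]
  exact predict_eq hx hρ IH hv hn hex.choose_spec.1 hij hex.choose_spec.2 h

variable (hb : IsBaseSystem x b)
include hb

/-- The Weyl element preserves the norm and carries a reducing move of `v` to one of its image, so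
equivariance is inherited from the reduced vector. Irreducible vectors are covered by the axioms of
a base system. -/
theorem redSection_weyl {i j : ι} (hij : i ≠ j) :
    redSection x b (ρ (weyl x i j) v) = weyl x i j • redSection x b v := by
  by_cases hex : ∃ m : ι × ι × ℤˣ, m.1 ≠ m.2.1 ∧ l1norm (elemMove m.1 m.2.1 m.2.2 v) < l1norm v
  · obtain ⟨⟨k, l, ε⟩, hkl, hlt⟩ := hex
    dsimp only at hkl hlt
    obtain ⟨k', l', hkl', η, hη⟩ := hx.conj' hij hkl ε
    have e : elemMove k' l' η (ρ (weyl x i j) v) = ρ (weyl x i j) (elemMove k l ε v) := by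
      simp only [← perm_zpow hρ hkl', ← perm_zpow hρ hkl, ← Equiv.Perm.mul_apply, ← map_mul, hη]
    have hlt' : l1norm (elemMove k' l' η (ρ (weyl x i j) v)) < l1norm (ρ (weyl x i j) v) := by
      rwa [e, l1norm_weyl hρ hij, l1norm_weyl hρ hij]
    rw [redSection_eq_predict hx hρ IH hv hn hkl hlt,
      redSection_eq_predict hx hρ IH (perm_weyl_ne_zero hρ hij hv)
        (by rwa [l1norm_weyl hρ hij]) hkl' hlt', predict, predict, e,
      (IH _ (elemMove_ne_zero hkl ε hv) (by omega)).2 i j hij, inv_smul_eq_iff, smul_smul,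
      smul_smul, ← hη, mul_inv_cancel_right]
  · obtain ⟨k, c, hc, rfl⟩ := exists_eq_single_of_irreducible hv hex
    rw [redSection_single x b k hc]
    by_cases hki : k = i
    · subst hki
      have : ρ (weyl x k j) (Pi.single k c) = Pi.single j (-c) := by
        funext l
        by_cases h1 : l = k
        · subst h1
          rw [perm_weyl_left hρ hij, Pi.single_eq_of_ne hij.symm, Pi.single_eq_of_ne hij]
        by_cases h2 : l = j
        · subst h2
          rw [perm_weyl_right hρ hij, Pi.single_eq_same, Pi.single_eq_same]
        rw [perm_weyl_ne hρ hij h1 h2, Pi.single_eq_of_ne h1, Pi.single_eq_of_ne h2]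
      rw [this, redSection_single x b j (neg_ne_zero.2 hc), hb.weyl_left k j c hij hc]
    by_cases hkj : k = j
    · subst hkj
      have : ρ (weyl x i k) (Pi.single k c) = Pi.single i c := by
        funext l
        by_cases h1 : l = i
        · subst h1
          rw [perm_weyl_left hρ hij, Pi.single_eq_same, Pi.single_eq_same]
        by_cases h2 : l = k
        · subst h2
          rw [perm_weyl_right hρ hij, Pi.single_eq_of_ne hij, Pi.single_eq_of_ne hij.symm, neg_zero]
        rw [perm_weyl_ne hρ hij h1 h2, Pi.single_eq_of_ne h1, Pi.single_eq_of_ne h2]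
      rw [this, redSection_single x b i hc, hb.weyl_right i k c hij hc]
    · have : ρ (weyl x i j) (Pi.single k c) = Pi.single k c := by
        have h1 : (Pi.single k c : ι → ℤ) i = 0 :=
          Pi.single_eq_of_ne (M := fun _ => ℤ) (Ne.symm hki) c
        have h2 : (Pi.single k c : ι → ℤ) j = 0 :=
          Pi.single_eq_of_ne (M := fun _ => ℤ) (Ne.symm hkj) c
        rw [perm_weyl hρ hij, elemMove_eq_self _ h2, elemMove_eq_self _ h1, elemMove_eq_self _ h2]
      rw [this, redSection_single x b k hc, weyl, mul_smul, mul_smul,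
        hb.fix i j k c hij (Ne.symm hkj), inv_smul_eq_iff.2 (hb.fix j i k c hij.symm
          (Ne.symm hki)).symm, hb.fix i j k c hij (Ne.symm hkj)]

/-- Row `j` is zero, so it is never the row changed by a reducing move `k, l`. Moving `x i j` past
that move costs at most a factor `x k j`, and both elements fix the value at the reduced vector by
induction. -/
theorem smul_redSection_of_eq_zero {i j : ι} (hij : i ≠ j) (ε : ℤˣ) (h : v j = 0) :
    x i j ^ (ε : ℤ) • redSection x b v = redSection x b v := by
  have fix_zpow : ∀ (g : H) (ε : ℤˣ) (y : Y), g • y = y → g ^ (ε : ℤ) • y = y := by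
    intro g ε y hy
    rcases Int.units_eq_one_or ε with rfl | rfl
    · simpa using hy
    · simpa [inv_smul_eq_iff] using hy.symm
  by_cases hex : ∃ m : ι × ι × ℤˣ, m.1 ≠ m.2.1 ∧ l1norm (elemMove m.1 m.2.1 m.2.2 v) < l1norm v
  · obtain ⟨⟨k, l, δ⟩, hkl, hlt⟩ := hex
    dsimp only at hkl hlt
    have N := (red_iff k l δ v).1 hlt
    have hjk : j ≠ k := by rintro rfl; rw [h] at N; simp at N
    have hzj : elemMove k l δ v j = 0 := by rw [elemMove_ne hjk, h]
    have hz0 := elemMove_ne_zero hkl δ hv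
    have key : ∀ i', i' ≠ j → ∀ ε : ℤˣ, x i' j ^ (ε : ℤ) • redSection x b (elemMove k l δ v) =
        redSection x b (elemMove k l δ v) := by
      intro i' hi' ε
      have := (IH _ hz0 (by omega)).1 i' j ε hi' (by rw [elemMove_eq_self _ hzj])
      rw [elemMove_eq_self _ hzj] at this
      exact this.symm
    rw [redSection_eq_predict hx hρ IH hv hn hkl hlt, predict]
    by_cases hil : i = l
    · subst hil
      obtain ⟨η, hη⟩ := hx.mul' hkl hij hjk.symm δ ε
      rw [eq_inv_smul_iff, smul_smul, smul_smul, hη, ← mul_assoc,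
        mul_inv_cancel_right, mul_smul, key i hij, key k hjk.symm]
    · rw [eq_inv_smul_iff, smul_smul, smul_smul,
        ← hx.comm' hij hkl hil hjk ε δ, mul_inv_cancel_right, key i hij]
  · obtain ⟨k, c, hc, rfl⟩ := exists_eq_single_of_irreducible hv hex
    rw [redSection_single x b k hc]
    have hjk : j ≠ k := by
      rintro rfl
      rw [Pi.single_eq_same] at h
      exact hc h
    exact fix_zpow _ _ _ (hb.fix i j k c hij hjk)

theorem redSection_move {i j : ι} (hij : i ≠ j) {ε : ℤˣ}
    (h : l1norm (elemMove i j ε v) ≤ l1norm v) :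
    redSection x b (elemMove i j ε v) = x i j ^ (ε : ℤ) • redSection x b v := by
  rcases h.lt_or_eq with h | h
  · rw [redSection_eq_predict hx hρ IH hv hn hij h, predict, smul_inv_smul]
  have N := l1norm_elemMove i j ε v
  by_cases hj : v j = 0
  · rw [elemMove_eq_self _ hj, smul_redSection_of_eq_zero hx hρ IH hv hn hb hij ε hj]
  -- Equal norms with `v j ≠ 0` force `v i + ε v j = -v i`.
  have hj2 : v j = -2 * ε * v i := by
    rcases Int.units_eq_one_or ε with rfl | rfl <;>
    · simp only [Units.val_one, Units.val_neg] at *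
      omega
  have h1 : l1norm (elemMove j i ε v) < l1norm v := by
    rw [red_iff]
    rcases Int.units_eq_one_or ε with rfl | rfl <;>
    · simp only [Units.val_one, Units.val_neg] at *
      omega
  have h2 : l1norm (elemMove j i (-ε) (elemMove i j ε v)) < l1norm (elemMove i j ε v) := by
    rw [red_iff, elemMove_same, elemMove_ne hij.symm]
    rcases Int.units_eq_one_or ε with rfl | rfl <;>
    · simp only [Units.val_one, Units.val_neg] at *
      omega
  -- At `i` and `j` the vector `u` has entries `0` and `-ε v i`. Both `v` and its image under the
  -- move reduce in row `j` to vectors one move away from `u`, and the braid relation identifies the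
  -- two routes.
  set u := elemMove i j ε (elemMove j i ε v) with hu
  have hui : u i = 0 := by
    rw [hu, elemMove_same, elemMove_same, elemMove_ne hij]
    rcases Int.units_eq_one_or ε with rfl | rfl <;>
    · simp only [Units.val_one, Units.val_neg] at *
      omega
  have hu0 : u ≠ 0 := elemMove_ne_zero hij _ (elemMove_ne_zero hij.symm _ hv)
  have N1 := l1norm_elemMove j i ε v
  have N2 := l1norm_elemMove i j ε (elemMove j i ε v)
  rw [elemMove_ne hij, elemMove_same, ← hu] at N2
  have hbr := hx.braid' hij ε
  have e : elemMove j i (-ε) (elemMove i j ε v) = elemMove i j ε u := by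
    have : elemMove i j ε u = elemMove i j ε (elemMove j i (-ε) u) := by
      rw [elemMove_eq_self _ hui]
    rw [this, hu]
    simp only [← perm_zpow hρ hij, ← perm_zpow hρ hij.symm,
        ← Equiv.Perm.mul_apply, ← map_mul]
    congr 2
    rw [Units.val_neg, zpow_neg, ← mul_assoc, ← mul_assoc, hbr, inv_mul_cancel_right]
  have hunorm : l1norm u < l1norm v := by
    rcases Int.units_eq_one_or ε with rfl | rfl <;>
    · simp only [Units.val_one, Units.val_neg] at *
      omega
  have e1 : redSection x b u = _ :=
    IH.move hρ hij ε (elemMove_ne_zero hij.symm ε hv) (by omega) (by rw [← hu]; omega)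
  have e2 := IH.move hρ hij ε hu0 (by omega) (by rw [← e]; omega)
  have e3 := (IH u hu0 (by omega)).1 j i (-ε) hij.symm (by rw [elemMove_eq_self _ hui])
  rw [elemMove_eq_self _ hui] at e3
  rw [redSection_eq_predict hx hρ IH (elemMove_ne_zero hij ε hv) (by omega) hij.symm h2, predict,
    e, e2, e3, e1, redSection_eq_predict hx hρ IH hv hn hij.symm h1, predict]
  simp only [smul_smul]
  congr 1
  rw [Units.val_neg, zpow_neg, inv_inv]
  simp only [mul_assoc] at hbr ⊢
  rw [hbr]
  group

omit IH hv hn in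
theorem sectionEquivariant (n : ℕ) : SectionEquivariant x ρ b n := by
  induction n with
  | zero => exact fun v _ h => absurd h (Nat.not_lt_zero _)
  | succ n IH =>
    exact fun v hv hn => ⟨fun i j ε hij h =>
      redSection_move hx hρ IH hv (Nat.le_of_lt_succ hn) hb hij h,
      fun i j hij => redSection_weyl hx hρ IH hv (Nat.le_of_lt_succ hn) hb hij⟩

omit IH hv hn in
/-- An element of the group generated by the `x_{ij}` that fixes `e_k` fixes the base point of the
`H`-set assigned to `e_k`. -/
theorem smul_base_eq {h : H} (hh : h ∈ Subgroup.closure {g | ∃ i j, i ≠ j ∧ g = x i j}) {k : ι}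
    {c : ℤ} (hc : c ≠ 0) (hfix : ρ h (Pi.single k c) = Pi.single k c) : h • b k c = b k c := by
  -- Equivariance is closed under products and inverses. The first clause is carried along because
  -- the section is controlled only at nonzero vectors, which must stay nonzero.
  have key : ρ h 0 = 0 ∧ ∀ v : ι → ℤ, v ≠ 0 → redSection x b (ρ h v) = h • redSection x b v := by
    clear hfix
    induction hh using Subgroup.closure_induction with
    | mem g hg =>
      obtain ⟨i, j, hij, rfl⟩ := hg
      refine ⟨by rw [hρ i j hij, elemMove_eq_self (v := (0 : ι → ℤ)) _ rfl], fun v hv => ?_⟩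
      have := SectionEquivariant.move
        (sectionEquivariant hx hρ hb (max (l1norm v) (l1norm (elemMove i j 1 v)) + 1)) hρ hij 1 hv
        (by omega) (by omega)
      rw [hρ i j hij, this, Units.val_one, zpow_one]
    | one => simp
    | mul g g' _ _ h1 h2 =>
      refine ⟨by rw [map_mul, Equiv.Perm.mul_apply, h2.1, h1.1], fun v hv => ?_⟩
      have hv' : ρ g' v ≠ 0 := fun h0 => hv ((ρ g').injective (h0.trans h2.1.symm))
      rw [map_mul, Equiv.Perm.mul_apply, h1.2 _ hv', h2.2 v hv, mul_smul]
    | inv g _ h1 =>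
      have h0 : ρ g⁻¹ 0 = 0 := by rw [map_inv, Equiv.Perm.inv_eq_iff_eq, h1.1]
      refine ⟨h0, fun v hv => ?_⟩
      have hv' : ρ g⁻¹ v ≠ 0 := fun h' => hv ((ρ g⁻¹).injective (h'.trans h0.symm))
      rw [eq_inv_smul_iff, ← h1.2 _ hv', ← Equiv.Perm.mul_apply, ← map_mul, mul_inv_cancel,
        map_one, Equiv.Perm.one_apply]
  have hk : (Pi.single k c : ι → ℤ) ≠ 0 := by simpa using hc
  have := key.2 _ hk
  rw [hfix, redSection_single x b k hc] at this
  exact this.symm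

end Confluence
end EllGamma
end

noncomputable section

namespace EllGamma

/-! ### Base systems generated from one index. -/

section Presentation

variable {ι : Type} [DecidableEq ι] {H : Type} [Group H] {x : ι → ι → H}

variable {Y : Type} [MulAction H Y]

/-- The `H`-set elements assigned to multiples of the basis vectors. -/
def baseMap (x : ι → ι → H) (o : ι) (y : ℤ → Y) (k : ι) (c : ℤ) : Y :=
  if k = o then y c else weyl x k o • y c

theorem inv_smul_eq_self {h : H} {y : Y} (hy : h • y = y) : h⁻¹ • y = y := by
  rw [inv_smul_eq_iff, hy]

/-- Data at the single index `o` are transported to index `k` by `weyl x k o`. Conjugation by Weyl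
elements reduces every axiom to two facts at `o`: the generators fixing `e_o` fix `y c`, and the
square of a Weyl element changes the sign of `c`. -/
theorem IsElementarySystem.isBaseSystem (hx : IsElementarySystem x) (o : ι) (y : ℤ → Y)
    (hy : ∀ i j c, i ≠ j → j ≠ o → x i j • y c = y c)
    (hw : ∀ j c, j ≠ o → c ≠ 0 → weyl x o j • weyl x o j • y c = y (-c)) :
    IsBaseSystem x (baseMap x o y) where
  fix := by
    intro i j k c hij hjk
    by_cases hk : k = o
    · subst hk
      rw [baseMap, if_pos rfl, hy i j c hij hjk]
    rw [baseMap, if_neg hk]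
    have hok := hx.weyl_symm (Ne.symm hk)
    have key : ∀ g, SemiconjBy (weyl x o k) (x i j) g → g • y c = y c →
        x i j • weyl x k o • y c = weyl x k o • y c := by
      intro g hg hgy
      rw [hok, eq_inv_smul_iff, smul_smul, smul_smul, hg.eq, mul_inv_cancel_right, hgy]
    by_cases hik : i = k
    · subst hik
      by_cases hjo : j = o
      · subst hjo
        exact key _ (hx.weyl_ji hij.symm) (inv_smul_eq_self (hy _ _ c hij.symm hij))
      · exact key _ (hx.weyl_jk (Ne.symm hk) (Ne.symm hjo) hij) (hy _ _ c (Ne.symm hjo) hjo)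
    by_cases hjo : j = o
    · subst hjo
      exact key _ (hx.weyl_ki hjk hij.symm (Ne.symm hik)) (inv_smul_eq_self (hy _ _ c hik hk))
    by_cases hio : i = o
    · subst hio
      exact key _ (hx.weyl_ik (Ne.symm hk) hij hjk.symm)
        (inv_smul_eq_self (hy _ _ c hjk.symm hjo))
    have h1 : SemiconjBy (x o k) (x i j) (x i j) :=
      hx.comm o k i j (Ne.symm hk) hij (Ne.symm hjo) (Ne.symm hik)
    have h2 : SemiconjBy (x k o) (x i j) (x i j) :=
      hx.comm k o i j hk hij hjk.symm (Ne.symm hio)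
    exact key _ ((h1.mul_left h2.inv_symm_left).mul_left h1) (hy _ _ c hij hjo)
  weyl_right := by
    intro i j c hij _
    by_cases hj : j = o
    · subst hj
      rw [baseMap, baseMap, if_pos rfl, if_neg hij]
    rw [baseMap, if_neg hj]
    by_cases hi : i = o
    · subst hi
      rw [baseMap, if_pos rfl, hx.weyl_symm hij, smul_inv_smul]
    rw [baseMap, if_neg hi]
    have h1 := hx.weyl_jk hij hi hj
    have h2 := hx.weyl_kj hij hi hj
    have h3 : SemiconjBy (weyl x i j) (weyl x j o) (weyl x i o) :=
      (h1.mul_right h2.inv_right).mul_right h1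
    have h4 : weyl x i j • y c = y c := by
      rw [weyl, mul_smul, mul_smul, hy _ _ c hij hj,
        inv_smul_eq_self (hy _ _ c hij.symm hi), hy _ _ c hij hj]
    rw [smul_smul, h3.eq, mul_smul, h4]
  weyl_left := by
    intro i j c hij hc
    by_cases hj : j = o
    · subst hj
      rw [baseMap, baseMap, if_pos rfl, if_neg hij, smul_smul, hx.weyl_symm hij.symm,
        ← mul_inv_rev, inv_smul_eq_iff, mul_smul, hw i (-c) hij (neg_ne_zero.2 hc), neg_neg]
    rw [baseMap, baseMap, if_neg hj]
    by_cases hi : i = o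
    · subst hi
      rw [if_pos rfl, hx.weyl_symm hij, eq_inv_smul_iff, hw j c hj hc]
    rw [if_neg hi]
    have h1 := hx.weyl_ik hij hi hj
    have h2 := hx.weyl_ki hij hi hj
    have h3 : SemiconjBy (weyl x i j) (weyl x i o) (weyl x j o)⁻¹ := by
      have := (h1.mul_right h2.inv_right).mul_right h1
      simpa [weyl, mul_assoc] using this
    have h4 : weyl x i j • y c = y c := by
      rw [weyl, mul_smul, mul_smul, hy _ _ c hij hj,
        inv_smul_eq_self (hy _ _ c hij.symm hi), hy _ _ c hij hj]
    rw [smul_smul, h3.eq, mul_smul, h4, hx.weyl_symm (Ne.symm hj), inv_inv, inv_smul_eq_iff.symm,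
      ← hw j c hj hc, inv_inv]

end Presentation
end EllGamma
end

noncomputable section

namespace EllGamma

/-! ### Integral matrices acting on column vectors. -/

section MatrixAction

variable {ι : Type} [Fintype ι] [DecidableEq ι]

/-- The action of `SL(n, ℤ)` on column vectors. -/
def vecPerm : Matrix.SpecialLinearGroup ι ℤ →* Equiv.Perm (ι → ℤ) where
  toFun A :=
    { toFun := fun v => A.1.mulVec v
      invFun := fun v => (A⁻¹).1.mulVec v
      left_inv := fun v => by
        change (A⁻¹).1.mulVec (A.1.mulVec v) = v
        rw [Matrix.mulVec_mulVec, ← Matrix.SpecialLinearGroup.coe_mul, inv_mul_cancel,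
          Matrix.SpecialLinearGroup.coe_one, Matrix.one_mulVec]
      right_inv := fun v => by
        change A.1.mulVec ((A⁻¹).1.mulVec v) = v
        rw [Matrix.mulVec_mulVec, ← Matrix.SpecialLinearGroup.coe_mul, mul_inv_cancel,
          Matrix.SpecialLinearGroup.coe_one, Matrix.one_mulVec] }
  map_one' := Equiv.ext fun v => Matrix.one_mulVec v
  map_mul' A B := Equiv.ext fun v => by
    simp

theorem vecPerm_apply (A : Matrix.SpecialLinearGroup ι ℤ) (v : ι → ℤ) : vecPerm A v = A.1.mulVec v := rfl

/-- The elementary matrix with entry `a` at the place `(i, j)`. -/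
def slTransvection {i j : ι} (h : i ≠ j) (a : ℤ) : Matrix.SpecialLinearGroup ι ℤ :=
  ⟨Matrix.transvection i j a, Matrix.det_transvection_of_ne i j h a⟩

theorem vecPerm_slTransvection {i j : ι} (h : i ≠ j) (v : ι → ℤ) :
    vecPerm (slTransvection h 1) v = elemMove i j 1 v := by
  rw [vecPerm_apply]
  change (Matrix.transvection i j (1 : ℤ)).mulVec v = _
  rw [Matrix.transvection, Matrix.add_mulVec, Matrix.one_mulVec]
  funext k
  by_cases hk : k = i
  · subst hk
    simp [elemMove_same, Matrix.single_mulVec]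
  · rw [elemMove_ne hk]
    simp [Matrix.single_mulVec, hk]

theorem slTransvection_zpow {i j : ι} (h : i ≠ j) (a : ℤ) :
    slTransvection h 1 ^ a = slTransvection h a := by
  let f : Multiplicative ℤ →* Matrix.SpecialLinearGroup ι ℤ :=
    MonoidHom.mk' (fun a => slTransvection h a.toAdd) fun a b =>
      Subtype.ext (Matrix.transvection_mul_transvection_same i j h a.toAdd b.toAdd).symm
  have := map_zpow f (Multiplicative.ofAdd 1) a
  rw [← ofAdd_zsmul, smul_eq_mul, mul_one] at this
  exact this.symm

end MatrixAction

/-! ### The presentation of `SL(2, ℤ)`. -/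

section RankTwo

variable {H : Type} [Group H]

/-- The presentation `⟨a, b | a b⁻¹ a = b⁻¹ a b⁻¹, (a b⁻¹ a)⁴ = 1⟩` of `SL(2, ℤ)`. -/
theorem eq_one_of_rank_two {a b : H} (hb : a * b⁻¹ * a = b⁻¹ * a * b⁻¹)
    (h4 : (a * b⁻¹ * a) ^ 4 = 1) (π : H →* Matrix.SpecialLinearGroup (Fin 2) ℤ)
    (ha : π a = slTransvection (Fin.zero_ne_one) 1)
    (hb' : π b = slTransvection (Fin.zero_ne_one.symm) 1) {g : H}
    (hg : g ∈ Subgroup.closure {a, b}) (h1 : π g = 1) : g = 1 := by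
  -- Only off-diagonal entries matter. With two indices the commutator relations are trivial or
  -- empty, and `hb` provides the braid relations.
  let x : Fin 2 → Fin 2 → H := fun i _ => if i = 0 then a else b
  have hx : IsElementarySystem x :=
    { comm := by
        intro i j k l hij hkl hil hjk
        have : i = k := by omega
        subst this
        rfl
      mul := by
        intro i j k hij hjk hik
        omega
      braid := by
        intro i j hij
        fin_cases i <;> fin_cases j <;> simp at hij <;> simp [x]
        · exact hb
        · have := congrArg (·⁻¹) hb
          simp only [mul_inv_rev, inv_inv, ← mul_assoc] at this
          exact this.symm }
  have hw : weyl x 0 1 = a * b⁻¹ * a := rfl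
  set P := Subgroup.zpowers a with hP
  have haP : a ∈ P := Subgroup.mem_zpowers a
  have hcomm : weyl x 0 1 * weyl x 0 1 * a = a * (weyl x 0 1 * weyl x 0 1) := by
    have e1 : SemiconjBy (weyl x 0 1) a b⁻¹ := hx.weyl_ij (i := 0) (j := 1) (by decide)
    have e2 : SemiconjBy (weyl x 0 1) b⁻¹ a := by
      have := (hx.weyl_ji (i := 0) (j := 1) (by decide)).inv_right
      rwa [inv_inv] at this
    exact (e2.mul_left e1).eq
  have hw4 : weyl x 0 1 * weyl x 0 1 * (weyl x 0 1 * weyl x 0 1) = 1 := by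
    rw [← h4, ← hw, pow_succ, pow_succ, pow_two]
    simp only [mul_assoc]
  -- The trivial coset stands for positive multiples of `e₀`. The coset of the square of the Weyl
  -- element, which lies over `-1`, stands for negative ones; it also serves at `c = 0`, where only
  -- invariance under `a` is required.
  let y : ℤ → H ⧸ P := fun c => if 0 < c then ((1 : H) : H ⧸ P) else
    ((weyl x 0 1 * weyl x 0 1 : H) : H ⧸ P)
  have hbase := hx.isBaseSystem 0 y (by
      intro i j c hij hj
      have hi : i = 0 := by omega
      subst hi
      change a • (ite _ _ _ : H ⧸ P) = ite _ _ _
      split_ifs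
      · exact QuotientGroup.eq.2 (by simpa using haP)
      · refine QuotientGroup.eq.2 ?_
        change (a * _)⁻¹ * _ ∈ P
        rw [ ← hcomm, mul_inv_rev, inv_mul_cancel_right]
        exact inv_mem haP) (by
      intro j c hj hc
      have hj : j = 1 := by omega
      subst hj
      change weyl x 0 1 • weyl x 0 1 • (ite _ _ _ : H ⧸ P) = ite _ _ _
      split_ifs
      · omega
      · rw [smul_smul]
        exact congrArg _ (mul_one _)
      · rw [smul_smul]
        exact congrArg _ hw4
      · omega)
  have hcl : g ∈ Subgroup.closure {g | ∃ i j, i ≠ j ∧ g = x i j} := by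
    refine Subgroup.closure_mono ?_ hg
    rintro _ (rfl | rfl)
    · exact ⟨0, 1, by decide, rfl⟩
    · exact ⟨1, 0, by decide, rfl⟩
  have key := smul_base_eq hx (ρ := vecPerm.comp π) (by
    intro i j hij v
    have : π (x i j) = slTransvection hij 1 := by
      fin_cases i <;> fin_cases j <;> simp at hij
      · exact ha
      · exact hb'
    rw [MonoidHom.comp_apply, this, vecPerm_slTransvection]) hbase hcl (k := 0) (c := 1)
    one_ne_zero (by rw [MonoidHom.comp_apply, h1, map_one]; rfl)
  -- Lying over the identity matrix, `g` fixes `e₀`, so it fixes the trivial coset and is a power of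
  -- `a`. The exponent is then read off from the upper right entry of the image.
  have hgP : g ∈ P := by
    have : g • ((1 : H) : H ⧸ P) = ((1 : H) : H ⧸ P) := key
    simpa using QuotientGroup.eq.1 this
  obtain ⟨n, rfl⟩ := hgP
  dsimp only at h1 ⊢
  rw [map_zpow, ha, slTransvection_zpow] at h1
  have := congrFun (congrFun (congrArg Subtype.val h1) 0) 1
  have hn : n = 0 := by simpa [slTransvection, Matrix.transvection] using this
  rw [hn, zpow_zero]

end RankTwo

/-! ### The presentation of `SL(3, ℤ)`. -/

section RankThree

/-- The block matrix `diag(1, A)`. -/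
def slEmbedMat (A : Matrix (Fin 2) (Fin 2) ℤ) : Matrix (Fin 3) (Fin 3) ℤ :=
  !![1, 0, 0; 0, A 0 0, A 0 1; 0, A 1 0, A 1 1]

theorem slEmbedMat_mul (A B : Matrix (Fin 2) (Fin 2) ℤ) :
    slEmbedMat (A * B) = slEmbedMat A * slEmbedMat B := by
  ext i j
  fin_cases i <;> fin_cases j <;>
    simp [slEmbedMat, Matrix.mul_apply, Fin.sum_univ_three, Fin.sum_univ_two]

/-- The embedding of `SL(2, ℤ)` into `SL(3, ℤ)` as the lower right block. -/
def slEmbed : Matrix.SpecialLinearGroup (Fin 2) ℤ →* Matrix.SpecialLinearGroup (Fin 3) ℤ where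
  toFun A := ⟨slEmbedMat A.1, by
    rw [slEmbedMat, Matrix.det_fin_three]
    have := A.2
    rw [Matrix.det_fin_two] at this
    simp [this]⟩
  map_one' := by
    ext i j
    fin_cases i <;> fin_cases j <;> simp [slEmbedMat]
  map_mul' A B := Subtype.ext (slEmbedMat_mul A.1 B.1)

theorem slEmbed_coe (A : Matrix.SpecialLinearGroup (Fin 2) ℤ) :
    (slEmbed A).1 = slEmbedMat A.1 := rfl

variable {H : Type} [Group H]

/-- The Nielsen–Magnus presentation of `SL(3, ℤ)`. -/
theorem eq_one_of_rank_three {x : Fin 3 → Fin 3 → H} (hx : IsCommutatorSystem x)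
    (h4 : weyl x 0 2 ^ 4 = 1) (π : H →* Matrix.SpecialLinearGroup (Fin 3) ℤ)
    (hπ : ∀ i j (h : i ≠ j), π (x i j) = slTransvection h 1) {g : H}
    (hg : g ∈ Subgroup.closure {g | ∃ i j, i ≠ j ∧ g = x i j}) (h1 : π g = 1) : g = 1 := by
  have hE : IsElementarySystem x := hx.isElementarySystem (by decide)
  -- The generators with column index `≠ 0` are those whose matrices fix `e₀`; `P` is the expected
  -- stabiliser.
  set P := Subgroup.closure {g | ∃ i j, i ≠ j ∧ j ≠ 0 ∧ g = x i j} with hP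
  have hxP : ∀ i j, i ≠ j → j ≠ 0 → x i j ∈ P := fun i j h h' =>
    Subgroup.subset_closure ⟨i, j, h, h', rfl⟩
  have hgP : g ∈ P := by
    have w01 : SemiconjBy (weyl x 1 2) (weyl x 0 2) (weyl x 0 1) :=
      have h1 := hx.weyl_kj (i := 1) (j := 2) (k := 0) (by decide) (by decide) (by decide)
      have h2 := hx.weyl_jk (i := 1) (j := 2) (k := 0) (by decide) (by decide) (by decide)
      (h1.mul_right h2.inv_right).mul_right h1
    have w12 : SemiconjBy (weyl x 0 2 * weyl x 0 2) (weyl x 1 2) (weyl x 1 2)⁻¹ := by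
      have h1 := hx.weyl_kj (i := 0) (j := 2) (k := 1) (by decide) (by decide) (by decide)
      have h2 := hx.weyl_jk (i := 0) (j := 2) (k := 1) (by decide) (by decide) (by decide)
      have h3 := hx.weyl_ki (i := 0) (j := 2) (k := 1) (by decide) (by decide) (by decide)
      have h4 := hx.weyl_ik (i := 0) (j := 2) (k := 1) (by decide) (by decide) (by decide)
      have e1 := h3.mul_left h1
      have e2 := h4.mul_left h2
      have := (e1.mul_right e2.inv_right).mul_right e1
      rw [weyl, weyl] at *
      simpa [mul_assoc] using this
    have hwP : weyl x 1 2 ∈ P :=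
      mul_mem (mul_mem (hxP 1 2 (by decide) (by decide))
        (inv_mem (hxP 2 1 (by decide) (by decide)))) (hxP 1 2 (by decide) (by decide))
    -- The squares for the indices `1` and `2` both lie over matrices taking `e₀` to `-e₀`. They
    -- differ by an element of `P`, so both define the same coset.
    have hp : weyl x 0 1 * weyl x 0 1 =
        weyl x 0 2 * weyl x 0 2 * ((weyl x 1 2)⁻¹ * (weyl x 1 2)⁻¹) := by
      rw [← mul_assoc, eq_mul_inv_iff_mul_eq, ← (w01.mul_right w01).eq]
      have := w12.inv_right.eq
      rw [inv_inv] at this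
      exact this.symm
    have h02 : weyl x 0 2 * weyl x 0 2 * (weyl x 0 2 * weyl x 0 2) = 1 := by
      rw [← h4, pow_succ, pow_succ, pow_two]
      simp only [mul_assoc]
    have h01 : weyl x 0 1 * weyl x 0 1 * (weyl x 0 1 * weyl x 0 1) = 1 := by
      have := (w01.mul_right w01).mul_right (w01.mul_right w01)
      rw [h02] at this
      simpa [SemiconjBy] using this.eq.symm
    -- The square conjugates the generators of `P` into `P`; therefore they fix the coset attached
    -- to `-e₀`.
    have ht : ∀ i j, i ≠ j → j ≠ 0 → ∃ p ∈ P,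
        x i j * (weyl x 0 1 * weyl x 0 1) = weyl x 0 1 * weyl x 0 1 * p := by
      have h1 := hx.weyl_kj (i := 0) (j := 1) (k := 2) (by decide) (by decide) (by decide)
      have h2 := hx.weyl_jk (i := 0) (j := 1) (k := 2) (by decide) (by decide) (by decide)
      have h3 := hx.weyl_ki (i := 0) (j := 1) (k := 2) (by decide) (by decide) (by decide)
      have h4 := hx.weyl_ik (i := 0) (j := 1) (k := 2) (by decide) (by decide) (by decide)
      have h5 := hE.weyl_ij (i := 0) (j := 1) (by decide)
      have h6 := hE.weyl_ji (i := 0) (j := 1) (by decide)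
      have h6' := h6.inv_right
      have h2' := h2.inv_right
      rw [inv_inv] at h6'
      intro i j hij hj
      have : (i = 0 ∧ j = 1) ∨ (i = 0 ∧ j = 2) ∨ (i = 1 ∧ j = 2) ∨ (i = 2 ∧ j = 1) := by omega
      rcases this with ⟨rfl, rfl⟩ | ⟨rfl, rfl⟩ | ⟨rfl, rfl⟩ | ⟨rfl, rfl⟩
      · exact ⟨_, hxP 0 1 hij hj, ((h6'.mul_left h5).eq).symm⟩
      · have := (h2'.mul_left h4).inv_right
        simp only [inv_inv] at this
        exact ⟨_, inv_mem (hxP 0 2 hij hj), this.eq.symm⟩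
      · have := (h4.mul_left h2).inv_right
        simp only [inv_inv] at this
        exact ⟨_, inv_mem (hxP 1 2 hij hj), this.eq.symm⟩
      · have := (h3.mul_left h1).inv_right
        simp only [inv_inv] at this
        exact ⟨_, inv_mem (hxP 2 1 hij hj), this.eq.symm⟩
    let y : ℤ → H ⧸ P := fun c => if 0 < c then ((1 : H) : H ⧸ P) else
      ((weyl x 0 1 * weyl x 0 1 : H) : H ⧸ P)
    have hbase := hE.isBaseSystem 0 y (by
        intro i j c hij hj
        change x i j • (ite _ _ _ : H ⧸ P) = ite _ _ _
        split_ifs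
        · exact QuotientGroup.eq.2 (by simpa using hxP i j hij hj)
        · refine (QuotientGroup.eq.2 ?_).symm
          obtain ⟨p, hp, e⟩ := ht i j hij hj
          change _⁻¹ * (x i j * _) ∈ P
          rwa [e, inv_mul_cancel_left]) (by
        intro j c hj hc
        change weyl x 0 j • weyl x 0 j • (ite _ _ _ : H ⧸ P) = ite _ _ _
        have : j = 1 ∨ j = 2 := by omega
        split_ifs
        · omega
        · rw [smul_smul]
          refine QuotientGroup.eq.2 ?_
          change (_ * 1)⁻¹ * _ ∈ P
          rcases this with rfl | rfl
          · simp
          · rw [hp, mul_one, inv_mul_cancel_left]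
            exact mul_mem (inv_mem hwP) (inv_mem hwP)
        · rw [smul_smul]
          refine (QuotientGroup.eq.2 ?_).symm
          change 1⁻¹ * (_ * _) ∈ P
          rcases this with rfl | rfl
          · rw [h01]
            simp
          · rw [hp, ← mul_assoc (weyl x 0 2 * weyl x 0 2), h02, inv_one, one_mul, one_mul]
            exact mul_mem (inv_mem hwP) (inv_mem hwP)
        · omega)
    have key := smul_base_eq hE (ρ := vecPerm.comp π) (by
      intro i j hij v
      rw [MonoidHom.comp_apply, hπ i j hij, vecPerm_slTransvection]) hbase hg (k := 0) (c := 1)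
      one_ne_zero (by rw [MonoidHom.comp_apply, h1, map_one]; rfl)
    have : g • ((1 : H) : H ⧸ P) = ((1 : H) : H ⧸ P) := key
    simpa using QuotientGroup.eq.1 this
  -- In `P`, the commuting elements `x 0 1` and `x 0 2` generate a subgroup normalised by `x 1 2`
  -- and `x 2 1`, so words can be sorted with this subgroup on the left.
  have normal_form : ∃ a b : ℤ, ∃ k ∈ Subgroup.closure {x 1 2, x 2 1},
      g = x 0 1 ^ a * x 0 2 ^ b * k := by
    clear h1 hg
    have c0 : Commute (x 0 1) (x 0 2) :=
      hx.comm 0 1 0 2 (by decide) (by decide) (by decide) (by decide)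
    have c1 : Commute (x 1 2) (x 0 2) :=
      hx.comm 1 2 0 2 (by decide) (by decide) (by decide) (by decide)
    have c2 : Commute (x 2 1) (x 0 1) :=
      hx.comm 2 1 0 1 (by decide) (by decide) (by decide) (by decide)
    have m1 : SemiconjBy (x 1 2)⁻¹ (x 0 1) (x 0 1 * x 0 2) := by
      have h := hx.mul 0 1 2 (by decide) (by decide) (by decide)
      have : SemiconjBy (x 1 2) (x 0 1 * x 0 2) (x 0 1) := by
        rw [SemiconjBy, h, c0.eq, ← mul_assoc, c1.eq]
      exact this.inv_symm_left
    have m1' : SemiconjBy (x 1 2) (x 0 1) (x 0 1 * (x 0 2)⁻¹) := by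
      have := m1.inv_symm_left
      rw [inv_inv] at this
      have := this.mul_right c1.inv_right
      rwa [mul_inv_cancel_right] at this
    have m2' : SemiconjBy (x 2 1) (x 0 2) ((x 0 1)⁻¹ * x 0 2) := by
      have h := hx.mul 0 2 1 (by decide) (by decide) (by decide)
      rw [SemiconjBy, mul_assoc, h]
      group
    have m2 : SemiconjBy (x 2 1)⁻¹ (x 0 2) (x 0 1 * x 0 2) := by
      have h := hx.mul 0 2 1 (by decide) (by decide) (by decide)
      have : SemiconjBy (x 2 1) (x 0 1 * x 0 2) (x 0 2) := by
        rw [SemiconjBy, h, ← mul_assoc, c2.eq]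
      exact this.inv_symm_left
    -- The integers `p, q` and `r, s` are the exponents of the conjugates of `x 0 1` and `x 0 2` by
    -- `y`; the new exponents are linear in `a` and `b`.
    have push : ∀ (y : H) (p q r s a b : ℤ) (k : H), SemiconjBy y (x 0 1) (x 0 1 ^ p * x 0 2 ^ q) →
        SemiconjBy y (x 0 2) (x 0 1 ^ r * x 0 2 ^ s) →
        y ∈ Subgroup.closure {x 1 2, x 2 1} → k ∈ Subgroup.closure {x 1 2, x 2 1} →
        ∃ a' b' : ℤ, ∃ k' ∈ Subgroup.closure {x 1 2, x 2 1},
          y * (x 0 1 ^ a * x 0 2 ^ b * k) = x 0 1 ^ a' * x 0 2 ^ b' * k' := by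
      intro y p q r s a b k h1 h2 hy hk
      have h := (h1.zpow_right a).mul_right (h2.zpow_right b)
      rw [((c0.zpow_left p).zpow_right q).mul_zpow, ((c0.zpow_left r).zpow_right s).mul_zpow,
        ← zpow_mul, ← zpow_mul, ← zpow_mul, ← zpow_mul] at h
      refine ⟨p * a + r * b, q * a + s * b, y * k, mul_mem hy hk, ?_⟩
      have e : x 0 2 ^ (q * a) * x 0 1 ^ (r * b) = x 0 1 ^ (r * b) * x 0 2 ^ (q * a) :=
        ((c0.zpow_left _).zpow_right _).eq.symm
      rw [← mul_assoc, h.eq, zpow_add, zpow_add]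
      simp only [mul_assoc]
      congr 1
      rw [← mul_assoc, e, mul_assoc]
    have k12 : x 1 2 ∈ Subgroup.closure {x 1 2, x 2 1} := Subgroup.subset_closure (by simp)
    have k21 : x 2 1 ∈ Subgroup.closure {x 1 2, x 2 1} := Subgroup.subset_closure (by simp)
    refine Subgroup.closure_induction_left (p := fun g _ => ∃ a b : ℤ,
      ∃ k ∈ Subgroup.closure {x 1 2, x 2 1}, g = x 0 1 ^ a * x 0 2 ^ b * k)
      ⟨0, 0, 1, one_mem _, by simp⟩ ?_ ?_ hgP
    · rintro _ ⟨i, j, hij, hj, rfl⟩ y - ⟨a, b, k, hk, rfl⟩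
      have : (i = 0 ∧ j = 1) ∨ (i = 0 ∧ j = 2) ∨ (i = 1 ∧ j = 2) ∨ (i = 2 ∧ j = 1) := by omega
      rcases this with ⟨rfl, rfl⟩ | ⟨rfl, rfl⟩ | ⟨rfl, rfl⟩ | ⟨rfl, rfl⟩
      · exact ⟨1 + a, b, k, hk, by rw [zpow_one_add]; simp only [mul_assoc]⟩
      · refine ⟨a, 1 + b, k, hk, ?_⟩
        rw [zpow_one_add, ← mul_assoc, ← mul_assoc, ← mul_assoc, (c0.zpow_left a).eq]
      · exact push _ 1 (-1) 0 1 a b k (by simpa using m1') (by simpa [SemiconjBy] using c1.eq) k12 hk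
      · exact push _ 1 0 (-1) 1 a b k (by simpa [SemiconjBy] using c2.eq) (by simpa using m2') k21 hk
    · rintro _ ⟨i, j, hij, hj, rfl⟩ y - ⟨a, b, k, hk, rfl⟩
      have : (i = 0 ∧ j = 1) ∨ (i = 0 ∧ j = 2) ∨ (i = 1 ∧ j = 2) ∨ (i = 2 ∧ j = 1) := by omega
      rcases this with ⟨rfl, rfl⟩ | ⟨rfl, rfl⟩ | ⟨rfl, rfl⟩ | ⟨rfl, rfl⟩
      · exact ⟨-1 + a, b, k, hk, by rw [zpow_add, zpow_neg_one]; simp only [mul_assoc]⟩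
      · refine ⟨a, -1 + b, k, hk, ?_⟩
        rw [zpow_add, zpow_neg_one, ← mul_assoc, ← mul_assoc, ← mul_assoc,
          (c0.inv_right.zpow_left a).eq]
      · exact push _ 1 1 0 1 a b k (by simpa using m1)
          (by simpa [SemiconjBy] using c1.inv_left.eq)
          (inv_mem k12) hk
      · exact push _ 1 0 1 1 a b k (by simpa [SemiconjBy] using c2.inv_left.eq)
          (by simpa using m2)
          (inv_mem k21) hk
  obtain ⟨a, b, k, hk, rfl⟩ := normal_form
  -- The rank-two result needs a homomorphism to `SL(2, ℤ)` on the whole group. The product with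
  -- `SL(2, ℤ)` has one, the second projection, and `k` is paired there with a matrix `γ` obtained
  -- from the same word.
  set Q := Subgroup.closure {((x 1 2, slTransvection (Fin.zero_ne_one) 1) :
    H × Matrix.SpecialLinearGroup (Fin 2) ℤ), (x 2 1, slTransvection (Fin.zero_ne_one.symm) 1)}
  have hlift : ∃ γ : Matrix.SpecialLinearGroup (Fin 2) ℤ, (k, γ) ∈ Q := by
    have : k ∈ Q.map (MonoidHom.fst _ _) := by
      rw [MonoidHom.map_closure, Set.image_pair]
      exact hk
    obtain ⟨⟨k', γ⟩, h, rfl⟩ := this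
    exact ⟨γ, h⟩
  obtain ⟨γ, hγ⟩ := hlift
  have hkγ : π k = slEmbed γ := by
    have : Q ≤ (π.comp (MonoidHom.fst _ _)).eqLocus (slEmbed.comp (MonoidHom.snd _ _)) := by
      rw [Subgroup.closure_le]
      rintro _ (rfl | rfl)
      · change π (x 1 2) = _
        rw [hπ 1 2 (by decide)]
        refine Subtype.ext (Eq.trans ?_ (slEmbed_coe _).symm)
        ext i j
        fin_cases i <;> fin_cases j <;> simp [slEmbedMat, slTransvection, Matrix.transvection]
      · change π (x 2 1) = _
        rw [hπ 2 1 (by decide)]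
        refine Subtype.ext (Eq.trans ?_ (slEmbed_coe _).symm)
        ext i j
        fin_cases i <;> fin_cases j <;> simp [slEmbedMat, slTransvection, Matrix.transvection]
    exact this hγ
  rw [map_mul, map_mul, map_zpow, map_zpow, hπ 0 1 (by decide), hπ 0 2 (by decide), hkγ,
    slTransvection_zpow, slTransvection_zpow] at h1
  have hent : ∀ i j, (slTransvection (show (0 : Fin 3) ≠ 1 by decide) a *
      slTransvection (show (0 : Fin 3) ≠ 2 by decide) b * slEmbed γ).1 i j =
      (1 : Matrix.SpecialLinearGroup (Fin 3) ℤ).1 i j := fun i j =>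
    congrFun (congrFun (congrArg Subtype.val h1) i) j
  simp only [Matrix.SpecialLinearGroup.coe_mul, slEmbed_coe, Matrix.SpecialLinearGroup.coe_one]
    at hent
  have hγ1 : γ = 1 := by
    ext i j
    have := hent i.succ j.succ
    fin_cases i <;> fin_cases j <;>
    simpa [slEmbedMat, slTransvection, Matrix.transvection, Matrix.mul_apply,
      Fin.sum_univ_three] using this
  subst hγ1
  -- The fourth-power relation is assumed only for the indices `0, 2`. Conjugation by `weyl x 0 1`
  -- takes `weyl x 0 2` to the inverse of `weyl x 1 2`.
  have h12 : (weyl x 1 2) ^ 4 = 1 := by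
    have h1 := hx.weyl_ki (i := 0) (j := 1) (k := 2) (by decide) (by decide) (by decide)
    have h2 := hx.weyl_ik (i := 0) (j := 1) (k := 2) (by decide) (by decide) (by decide)
    have h3 := ((h2.mul_right h1.inv_right).mul_right h2).pow_right 4
    have h4' : (x 0 2 * (x 2 0)⁻¹ * x 0 2) ^ 4 = 1 := h4
    rw [h4'] at h3
    have h5 : ((x 1 2)⁻¹ * (x 2 1)⁻¹⁻¹ * (x 1 2)⁻¹) ^ 4 = 1 := by
      simpa [SemiconjBy] using h3.eq.symm
    rw [← inv_eq_one, ← inv_pow]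
    simpa [weyl, mul_assoc] using h5
  have hk1 := eq_one_of_rank_two (H := H × Matrix.SpecialLinearGroup (Fin 2) ℤ)
    (a := (x 1 2, slTransvection (Fin.zero_ne_one) 1))
    (b := (x 2 1, slTransvection (Fin.zero_ne_one.symm) 1))
    (Prod.ext (hE.braid 1 2 (by decide)) (show (slTransvection (Fin.zero_ne_one) 1 *
        (slTransvection (Fin.zero_ne_one.symm) 1)⁻¹ * slTransvection (Fin.zero_ne_one) 1 :
        Matrix.SpecialLinearGroup (Fin 2) ℤ) = (slTransvection (Fin.zero_ne_one.symm) 1)⁻¹ *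
        slTransvection (Fin.zero_ne_one) 1 * (slTransvection (Fin.zero_ne_one.symm) 1)⁻¹
        from by decide))
    (Prod.ext h12 (show (slTransvection (Fin.zero_ne_one) 1 *
        (slTransvection (Fin.zero_ne_one.symm) 1)⁻¹ * slTransvection (Fin.zero_ne_one) 1 :
        Matrix.SpecialLinearGroup (Fin 2) ℤ) ^ 4 = 1 from by decide))
    (MonoidHom.snd _ _) rfl rfl hγ rfl
  have hk1 : k = 1 := congrArg Prod.fst hk1
  have ha := hent 0 1
  have hb := hent 0 2
  simp [slEmbedMat, slTransvection, Matrix.transvection, Matrix.mul_apply, Fin.sum_univ_three]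
    at ha hb
  rw [hk1, ha, hb]
  simp

end RankThree

end EllGamma
end

noncomputable section

namespace EllGamma

/-! ### Generation of `SL(3, ℤ)` and of `G` by elementary matrices and translations. -/

section Generation

/-- The subgroup of `SL(3, ℤ)` generated by the elementary matrices. -/
def elemSubgroup : Subgroup (Matrix.SpecialLinearGroup (Fin 3) ℤ) :=
  Subgroup.closure {g | ∃ i j, ∃ h : i ≠ j, g = slTransvection h 1}

theorem slTransvection_mem_elemSubgroup {i j : Fin 3} (h : i ≠ j) (a : ℤ) :
    slTransvection h a ∈ elemSubgroup := by
  rw [← slTransvection_zpow]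
  have : slTransvection h 1 ∈ elemSubgroup := Subgroup.subset_closure ⟨i, j, h, rfl⟩
  exact zpow_mem this a

theorem vecPerm_slTransvection_unit {i j : Fin 3} (h : i ≠ j) (ε : ℤˣ) (v : Fin 3 → ℤ) :
    vecPerm (slTransvection h ε) v = elemMove i j ε v := by
  rw [vecPerm_apply]
  change (Matrix.transvection i j (ε : ℤ)).mulVec v = _
  rw [Matrix.transvection, Matrix.add_mulVec, Matrix.one_mulVec]
  funext k
  by_cases hk : k = i
  · subst hk
    simp [elemMove_same, Matrix.single_mulVec]
  · rw [elemMove_ne hk]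
    simp [Matrix.single_mulVec, hk]

theorem exists_vecPerm_eq_single (n : ℕ) : ∀ v : Fin 3 → ℤ, v ≠ 0 → l1norm v ≤ n →
    ∃ h ∈ elemSubgroup, ∃ k c, vecPerm h v = Pi.single k c := by
  induction n with
  | zero =>
    intro v hv hn
    refine absurd (funext fun i => ?_) hv
    have := Finset.single_le_sum (f := fun i => (v i).natAbs) (fun _ _ => Nat.zero_le _)
      (Finset.mem_univ i)
    have h0 : (v i).natAbs ≤ 0 := this.trans hn
    simpa using h0
  | succ n ih =>
    intro v hv hn
    by_cases h : ∃ m : Fin 3 × Fin 3 × ℤˣ, m.1 ≠ m.2.1 ∧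
        l1norm (elemMove m.1 m.2.1 m.2.2 v) < l1norm v
    · obtain ⟨⟨i, j, ε⟩, hij, hlt⟩ := h
      obtain ⟨h, hh, k, c, e⟩ := ih (elemMove i j ε v) (elemMove_ne_zero hij ε hv) (by
        dsimp only at hlt; omega)
      refine ⟨h * slTransvection hij ε, mul_mem hh (slTransvection_mem_elemSubgroup hij _), k, c, ?_⟩
      rw [map_mul, Equiv.Perm.mul_apply, vecPerm_slTransvection_unit, e]
    · obtain ⟨k, c, -, e⟩ := exists_eq_single_of_irreducible hv h
      exact ⟨1, one_mem _, k, c, by rw [map_one, e]; rfl⟩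

theorem exists_vecPerm_single_zero (k : Fin 3) (c : ℤ) :
    ∃ h ∈ elemSubgroup, vecPerm h (Pi.single k c) = Pi.single 0 c := by
  by_cases hk : k = 0
  · exact ⟨1, one_mem _, by rw [hk, map_one]; rfl⟩
  · have hk' : (0 : Fin 3) ≠ k := Ne.symm hk
    refine ⟨slTransvection hk (-1) * slTransvection hk' 1, mul_mem
      (slTransvection_mem_elemSubgroup _ _) (slTransvection_mem_elemSubgroup _ _), ?_⟩
    rw [map_mul, Equiv.Perm.mul_apply]
    have h1 := vecPerm_slTransvection_unit hk (-1)
    have h2 := vecPerm_slTransvection_unit hk' 1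
    simp only [Units.val_neg, Units.val_one] at h1 h2
    rw [h2, h1]
    funext l
    by_cases hl : l = k
    · subst hl
      rw [elemMove_same, elemMove_ne hk, elemMove_same]
      simp [hk]
    · rw [elemMove_ne hl]
      by_cases h0 : l = 0
      · subst h0
        rw [elemMove_same]
        simp [hl]
      · rw [elemMove_ne h0]
        simp [hl, h0]

/-- `SL(2, ℤ)` is generated by `S` and `T`, and the block images of these are explicit products of
elementary matrices. -/
theorem slEmbed_mem_elemSubgroup (B : Matrix.SpecialLinearGroup (Fin 2) ℤ) :
    slEmbed B ∈ elemSubgroup := by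
  have : (⊤ : Subgroup (Matrix.SpecialLinearGroup (Fin 2) ℤ)) ≤ elemSubgroup.comap slEmbed := by
    rw [← SpecialLinearGroup.SL2Z_generators, Subgroup.closure_le]
    rintro _ (rfl | rfl)
    · have : slEmbed ModularGroup.S = slTransvection (show (1 : Fin 3) ≠ 2 by decide) (-1) *
        slTransvection (show (2 : Fin 3) ≠ 1 by decide) 1 *
        slTransvection (show (1 : Fin 3) ≠ 2 by decide) (-1) := by decide
      change slEmbed ModularGroup.S ∈ elemSubgroup
      rw [this]
      exact mul_mem (mul_mem (slTransvection_mem_elemSubgroup _ _)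
        (slTransvection_mem_elemSubgroup _ _)) (slTransvection_mem_elemSubgroup _ _)
    · have : slEmbed ModularGroup.T = slTransvection (show (1 : Fin 3) ≠ 2 by decide) 1 := by
        decide
      change slEmbed ModularGroup.T ∈ elemSubgroup
      rw [this]
      exact slTransvection_mem_elemSubgroup _ _
  exact this (Subgroup.mem_top B)

theorem mem_elemSubgroup_of_col {A : Matrix.SpecialLinearGroup (Fin 3) ℤ} (h0 : A.1 0 0 = 1)
    (h1 : A.1 1 0 = 0) (h2 : A.1 2 0 = 0) : A ∈ elemSubgroup := by
  have hd := A.2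
  rw [Matrix.det_fin_three] at hd
  simp only [h0, h1, h2] at hd
  set B : Matrix.SpecialLinearGroup (Fin 2) ℤ :=
    ⟨!![A.1 1 1, A.1 1 2; A.1 2 1, A.1 2 2], by rw [Matrix.det_fin_two_of]; linarith⟩ with hB
  have hdet : A.1 1 1 * A.1 2 2 - A.1 1 2 * A.1 2 1 = 1 := by linarith
  -- The two coefficients are the entries of the row vector `(A 0 1, A 0 2)` times the inverse of
  -- `B`.
  have : A = slTransvection (show (0 : Fin 3) ≠ 1 by decide)
      (A.1 0 1 * A.1 2 2 - A.1 0 2 * A.1 2 1) *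
      slTransvection (show (0 : Fin 3) ≠ 2 by decide)
      (A.1 0 2 * A.1 1 1 - A.1 0 1 * A.1 1 2) * slEmbed B := by
    refine Subtype.ext ?_
    rw [Matrix.SpecialLinearGroup.coe_mul, Matrix.SpecialLinearGroup.coe_mul, slEmbed_coe]
    ext i j
    fin_cases i <;> fin_cases j <;>
      simp [slEmbedMat, slTransvection, Matrix.transvection, Matrix.mul_apply,
        Fin.sum_univ_three, hB, h0, h1, h2]
    · linear_combination (-A.1 0 1) * hdet
    · linear_combination (-A.1 0 2) * hdet
  rw [this]
  exact mul_mem (mul_mem (slTransvection_mem_elemSubgroup _ _)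
    (slTransvection_mem_elemSubgroup _ _)) (slEmbed_mem_elemSubgroup B)

theorem elemSubgroup_eq_top : elemSubgroup = ⊤ := by
  refine (Subgroup.eq_top_iff' _).2 fun A => ?_
  have hcol : ∀ B : Matrix.SpecialLinearGroup (Fin 3) ℤ, ∀ i,
      vecPerm B (Pi.single 0 1) i = B.1 i 0 := fun B i => by
    rw [vecPerm_apply, Matrix.mulVec_single_one]; rfl
  have hA : vecPerm A (Pi.single 0 1) ≠ 0 := by
    intro h
    have h' : vecPerm A (Pi.single 0 1) = vecPerm A 0 := by
      rw [h, vecPerm_apply, Matrix.mulVec_zero]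
    have := congrFun ((vecPerm A).injective h') 0
    simp at this
  obtain ⟨g, hg, k, c, e⟩ := exists_vecPerm_eq_single _ _ hA le_rfl
  obtain ⟨g', hg', e'⟩ := exists_vecPerm_single_zero k c
  have e1 : vecPerm (g' * g * A) (Pi.single 0 1) = Pi.single 0 c := by
    rw [map_mul, map_mul, Equiv.Perm.mul_apply, Equiv.Perm.mul_apply, e, e']
  have h0 : (g' * g * A).1 0 0 = c := by rw [← hcol, e1]; simp
  have h1 : (g' * g * A).1 1 0 = 0 := by rw [← hcol, e1]; simp
  have h2 : (g' * g * A).1 2 0 = 0 := by rw [← hcol, e1]; simp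
  have hd := (g' * g * A).2
  rw [Matrix.det_fin_three] at hd
  simp only [h0, h1, h2] at hd
  have hc : c = 1 ∨ c = -1 := Int.isUnit_iff.1 (IsUnit.of_mul_eq_one
    ((g' * g * A).1 1 1 * (g' * g * A).1 2 2 - (g' * g * A).1 1 2 * (g' * g * A).1 2 1)
    (by linarith))
  have key : g' * g * A ∈ elemSubgroup := by
    rcases hc with rfl | rfl
    · exact mem_elemSubgroup_of_col h0 h1 h2
    -- The square of this Weyl matrix is `diag(-1, -1, 1)`; it turns the first column `-e₀` into
    -- `e₀`.
    · set w : Matrix.SpecialLinearGroup (Fin 3) ℤ :=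
        slTransvection (show (0 : Fin 3) ≠ 1 by decide) 1 *
        slTransvection (show (1 : Fin 3) ≠ 0 by decide) (-1) *
        slTransvection (show (0 : Fin 3) ≠ 1 by decide) 1 with hw
      have hwm : w ∈ elemSubgroup := mul_mem (mul_mem (slTransvection_mem_elemSubgroup _ _)
        (slTransvection_mem_elemSubgroup _ _)) (slTransvection_mem_elemSubgroup _ _)
      have hww : (w * w).1 = !![-1, 0, 0; 0, -1, 0; 0, 0, 1] := by rw [hw]; decide
      have : w * w * (g' * g * A) ∈ elemSubgroup := by
        refine mem_elemSubgroup_of_col ?_ ?_ ?_ <;>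
          rw [Matrix.SpecialLinearGroup.coe_mul, hww, Matrix.mul_apply] <;>
          simp only [Fin.sum_univ_three, h0, h1, h2] <;> simp
      exact (Subgroup.mul_mem_cancel_left _ (mul_mem hwm hwm)).1 this
  exact (Subgroup.mul_mem_cancel_left _ (mul_mem hg' hg)).1 key

theorem G.closure_eq_top {C : Subgroup G} (he : ∀ i j (h : i ≠ j), G.elem i j h ∈ C)
    (ht : ∀ i, G.trans i ∈ C) : C = ⊤ := by
  refine (Subgroup.eq_top_iff' _).2 fun g => ?_
  let f : Matrix.SpecialLinearGroup (Fin 3) ℤ →* G :=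
    MonoidHom.mk' (fun A => ⟨A, 0⟩) fun A B => by
      ext1
      · rfl
      · simp [G.mul_n]
  let s : Multiplicative (Fin 3 → ℤ) →* G :=
    MonoidHom.mk' (fun n => ⟨1, n.toAdd⟩) fun n m => by
      ext1
      · simp [G.mul_A]
      · simp [G.mul_n, add_comm]
  have hf : (⊤ : Subgroup _) ≤ C.comap f := by
    rw [← elemSubgroup_eq_top, elemSubgroup, Subgroup.closure_le]
    rintro _ ⟨i, j, h, rfl⟩
    exact he i j h
  have hs : ∀ n : Fin 3 → ℤ, s (Multiplicative.ofAdd n) ∈ C := by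
    intro n
    have : Multiplicative.ofAdd n = Multiplicative.ofAdd (Pi.single 0 1 : Fin 3 → ℤ) ^ n 0 *
        Multiplicative.ofAdd (Pi.single 1 1 : Fin 3 → ℤ) ^ n 1 *
        Multiplicative.ofAdd (Pi.single 2 1 : Fin 3 → ℤ) ^ n 2 := by
      rw [← ofAdd_zsmul, ← ofAdd_zsmul, ← ofAdd_zsmul, ← ofAdd_add, ← ofAdd_add]
      congr 1
      funext i
      fin_cases i <;> simp
    rw [this, map_mul, map_mul, map_zpow, map_zpow, map_zpow]
    exact mul_mem (mul_mem (zpow_mem (ht 0) _) (zpow_mem (ht 1) _)) (zpow_mem (ht 2) _)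
  have : g = f g.A * s (Multiplicative.ofAdd g.n) := by
    ext1
    · simp [G.mul_A, f, s]
    · simp [G.mul_n, f, s]
  rw [this]
  exact mul_mem (hf (Subgroup.mem_top g.A)) (hs g.n)

end Generation

end EllGamma
end

noncomputable section

namespace EllGamma

/-! ### The projection `E → G`. -/

section Projection

theorem G.elem_mul_ext {a b : G} (hA : a.A.1 = b.A.1) (hn : a.n = b.n) : a = b :=
  G.ext (Subtype.ext hA) hn

theorem transvection_comm {i j k l : Fin 3} (hil : i ≠ l) (hjk : j ≠ k) :
    Matrix.transvection i j (1 : ℤ) * Matrix.transvection k l 1 =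
      Matrix.transvection k l 1 * Matrix.transvection i j 1 := by
  simp only [Matrix.transvection, mul_add, add_mul, mul_one, one_mul]
  rw [Matrix.single_mul_single_of_ne _ _ _ _ hjk, Matrix.single_mul_single_of_ne _ _ _ _ hil.symm]
  abel

theorem transvection_mul {i j k : Fin 3} (hjk : j ≠ k) (hik : i ≠ k) :
    Matrix.transvection i j (1 : ℤ) * Matrix.transvection j k 1 =
      Matrix.transvection i k 1 * Matrix.transvection j k 1 * Matrix.transvection i j 1 := by
  simp only [Matrix.transvection, mul_add, add_mul, mul_one, one_mul]
  rw [Matrix.single_mul_single_same, Matrix.single_mul_single_of_ne _ _ _ _ hik.symm,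
    Matrix.single_mul_single_of_ne _ _ _ _ hjk.symm, Matrix.single_mul_single_of_ne _ _ _ _ hik.symm]
  simp
  abel

/-- The images in `G` of the generators of `E`. -/
def genImage : Gen → G
  | .e i j h => G.elem i j h
  | .t i => G.trans i
  | .m _ => 1

/-- With `M` sent to `1`, the defining relations become matrix relations among transvections and the
rule for moving a translation across a transvection. -/
theorem genImage_rel {a b : FreeGroup Gen} (h : DefRel a b) :
    FreeGroup.lift genImage a = FreeGroup.lift genImage b := by
  have he : ∀ i j h, FreeGroup.lift genImage (fe i j h) = G.elem i j h := fun _ _ _ =>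
    FreeGroup.lift_apply_of
  have ht : ∀ i, FreeGroup.lift genImage (ft i) = G.trans i := fun _ => FreeGroup.lift_apply_of
  have hm : ∀ u, FreeGroup.lift genImage (fm u) = 1 := fun _ => FreeGroup.lift_apply_of
  induction h with
  | m_mul u v => simp [hm]
  | e_m i j h u => simp [hm]
  | t_m i u => simp [hm]
  | e_e_comm i j k l hij hkl hil hjk =>
    simp only [map_mul, hm, he, one_mul]
    refine G.elem_mul_ext (transvection_comm hil hjk) ?_
    simp [G.mul_n, G.elem]
  | e_e i j k hij hjk hik =>
    simp only [map_mul, hm, he, one_mul]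
    refine G.elem_mul_ext (transvection_mul hjk hik) ?_
    simp [G.mul_n, G.elem]
  | e_pow =>
    simp only [map_mul, map_pow, map_inv, he, map_one]
    refine G.elem_mul_ext ?_ ?_
    · decide
    · decide
  | t_t i j =>
    simp only [map_mul, hm, ht, one_mul]
    refine G.elem_mul_ext rfl ?_
    simp [G.mul_n, G.trans, add_comm]
  | e_t i j k hij hik =>
    simp only [map_mul, hm, ht, he, one_mul]
    refine G.elem_mul_ext ?_ ?_
    · simp [G.mul_A, G.trans]
    · simp only [G.mul_n, G.trans, G.elem, Matrix.transvection, Matrix.vecMul_add,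
        Matrix.zero_vecMul, Matrix.vecMul_one]
      revert i j k
      decide
  | t_e_t i j hij =>
    simp only [map_mul, hm, ht, he, one_mul]
    refine G.elem_mul_ext ?_ ?_
    · simp [G.mul_A, G.trans]
    · revert i j
      decide

/-- The projection `E → G`. -/
def projE : E →* G := PresentedGroup.toGroup (f := genImage) (by
  rintro _ ⟨a, b, h, rfl⟩
  rw [map_mul, map_inv, genImage_rel h, mul_inv_cancel])

theorem projE_e (i j : Fin 3) (h : i ≠ j) : projE (E.e i j h) = G.elem i j h :=
  PresentedGroup.toGroup.of _

theorem projE_t (i : Fin 3) : projE (E.t i) = G.trans i := PresentedGroup.toGroup.of _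

theorem projE_ofM (u : M) : projE (E.ofM u) = 1 := PresentedGroup.toGroup.of _

theorem projE_surjective : Function.Surjective projE := by
  rw [← MonoidHom.range_eq_top]
  exact G.closure_eq_top (fun i j h => ⟨_, projE_e i j h⟩) fun i => ⟨_, projE_t i⟩

/-- The group `E` is generated by `ê_{i,j}`, `t̂_i` and `M`. -/
theorem E.eq_top {C : Subgroup E} (he : ∀ i j h, E.e i j h ∈ C) (ht : ∀ i, E.t i ∈ C)
    (hm : ∀ u, E.ofM u ∈ C) : C = ⊤ := by
  rw [eq_top_iff, ← PresentedGroup.closure_range_of, Subgroup.closure_le]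
  rintro _ ⟨g, rfl⟩
  cases g with
  | e i j h => exact he i j h
  | t i => exact ht i
  | m u => exact hm u

/-- The elements obeying this rule form a subgroup, and the relations b) put the generators in it;
for those from `M` it is commutativity. Normality of the image of `M` and the prescribed action both
follow. -/
theorem E.mul_ofM (x : E) (u : M) : x * E.ofM u = E.ofM (projE x • u) * x := by
  let C : Subgroup E :=
    { carrier := {x | ∀ u, x * E.ofM u = E.ofM (projE x • u) * x}
      one_mem' := fun u => by simp
      mul_mem' := fun {x y} hx hy u => by
        rw [mul_assoc, hy, ← mul_assoc, hx, map_mul, mul_smul, mul_assoc]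
      inv_mem' := fun {x} hx u => by
        have := hx ((projE x)⁻¹ • u)
        rw [smul_inv_smul] at this
        rw [map_inv, inv_mul_eq_iff_eq_mul, ← mul_assoc, this, mul_inv_cancel_right] }
  have hC : C = ⊤ := E.eq_top
    (fun i j h u => by
      rw [projE_e]
      exact E.mk_eq (DefRel.e_m i j h u))
    (fun i u => by
      rw [projE_t]
      exact E.mk_eq (DefRel.t_m i u))
    (fun v u => by
      rw [projE_ofM, one_smul, ← map_mul, ← map_mul, mul_comm])
  exact (hC ▸ Subgroup.mem_top x : x ∈ C) u

end Projection

end EllGamma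
end

noncomputable section

namespace EllGamma

/-! ### The kernel of `E → G` is the image of `M`. -/

section Kernel

instance : (E.ofM.range).Normal where
  conj_mem := by
    rintro _ ⟨u, rfl⟩ x
    exact ⟨projE x • u, by rw [E.mul_ofM, mul_inv_cancel_right]⟩

/-- The images of the `ê_{i,j}` in `E / M`. -/
def quotE (i j : Fin 3) : E ⧸ E.ofM.range :=
  if h : i ≠ j then QuotientGroup.mk (E.e i j h) else 1

/-- The images of the `t̂_i` in `E / M`. -/
def quotT (i : Fin 3) : E ⧸ E.ofM.range := QuotientGroup.mk (E.t i)

theorem quotE_of_ne {i j : Fin 3} (h : i ≠ j) :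
    quotE i j = (QuotientGroup.mk (E.e i j h) : E ⧸ E.ofM.range) := dif_pos h

theorem mk_ofM (u : M) : (QuotientGroup.mk (E.ofM u) : E ⧸ E.ofM.range) = 1 :=
  (QuotientGroup.eq_one_iff _).2 ⟨u, rfl⟩

/-- The projection `E / M → G`. -/
def projQuot : E ⧸ E.ofM.range →* G := QuotientGroup.lift _ projE (by
  rintro _ ⟨u, rfl⟩
  exact projE_ofM u)

/-- The homomorphism from the free group onto `E / M`. -/
def toQuot : FreeGroup Gen →* E ⧸ E.ofM.range :=
  (QuotientGroup.mk' _).comp (PresentedGroup.mk relators)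

theorem toQuot_rel {a b : FreeGroup Gen} (h : DefRel a b) : toQuot a = toQuot b :=
  congrArg (QuotientGroup.mk' E.ofM.range) (E.mk_eq h)

theorem toQuot_fm (u : M) : toQuot (fm u) = 1 := mk_ofM u

theorem toQuot_fe (i j : Fin 3) (h : i ≠ j) : toQuot (fe i j h) = quotE i j :=
  (quotE_of_ne h).symm

theorem toQuot_ft (i : Fin 3) : toQuot (ft i) = quotT i := rfl

theorem quotE_isCommutatorSystem : IsCommutatorSystem quotE where
  comm i j k l hij hkl hil hjk := by
    have := toQuot_rel (DefRel.e_e_comm i j k l hij hkl hil hjk)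
    simpa only [map_mul, toQuot_fm, toQuot_fe, one_mul] using this
  mul i j k hij hjk hik := by
    have := toQuot_rel (DefRel.e_e i j k hij hjk hik)
    simpa only [map_mul, toQuot_fm, toQuot_fe, one_mul] using this

theorem weyl_quotE_pow : weyl quotE 0 2 ^ 4 = 1 := by
  have := toQuot_rel DefRel.e_pow
  simp only [map_mul, map_pow, map_inv, map_one, toQuot_fe] at this
  exact this

theorem quotT_commute (i j : Fin 3) : Commute (quotT i) (quotT j) := by
  have := toQuot_rel (DefRel.t_t i j)
  simp only [map_mul, toQuot_fm, toQuot_ft, one_mul] at this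
  exact this

theorem quotE_quotT_of_ne {i j k : Fin 3} (hij : i ≠ j) (hik : i ≠ k) :
    SemiconjBy (quotE i j) (quotT k) (quotT k) := by
  have := toQuot_rel (DefRel.e_t i j k hij hik)
  simp only [map_mul, toQuot_fm, toQuot_ft, toQuot_fe, one_mul] at this
  exact this

theorem quotE_quotT {i j : Fin 3} (hij : i ≠ j) :
    SemiconjBy (quotE i j) (quotT i) (quotT i * (quotT j)⁻¹) := by
  have := toQuot_rel (DefRel.t_e_t i j hij)
  simp only [map_mul, toQuot_fm, toQuot_ft, toQuot_fe, one_mul] at this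
  rw [SemiconjBy, (quotT_commute i j).inv_right.eq, mul_assoc, ← this]
  simp only [mul_assoc, inv_mul_cancel_left]

theorem mul_mul_mul_comm' {H : Type} [Group H] {a b c a' b' c' : H} (h1 : b * a' = a' * b)
    (h2 : c * a' = a' * c) (h3 : c * b' = b' * c) :
    a * b * c * (a' * b' * c') = a * a' * (b * b') * (c * c') := by
  calc a * b * c * (a' * b' * c') = a * b * (c * a') * b' * c' := by simp only [mul_assoc]
    _ = a * (b * a') * (c * b') * c' := by rw [h2]; simp only [mul_assoc]
    _ = _ := by rw [h1, h3]; simp only [mul_assoc]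

/-- The homomorphism `n ↦ t₁^{n₁} t₂^{n₂} t₃^{n₃}` to `E / M`. -/
def quotTrans : Multiplicative (Fin 3 → ℤ) →* E ⧸ E.ofM.range :=
  MonoidHom.mk' (fun n => quotT 0 ^ n.toAdd 0 * quotT 1 ^ n.toAdd 1 * quotT 2 ^ n.toAdd 2)
    fun n m => by
      have h1 := ((quotT_commute 1 0).zpow_left (n.toAdd 1)).zpow_right (m.toAdd 0)
      have h2 := ((quotT_commute 2 0).zpow_left (n.toAdd 2)).zpow_right (m.toAdd 0)
      have h3 := ((quotT_commute 2 1).zpow_left (n.toAdd 2)).zpow_right (m.toAdd 1)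
      simp only [toAdd_mul, Pi.add_apply, zpow_add]
      exact (mul_mul_mul_comm' h1.eq h2.eq h3.eq).symm

theorem quotTrans_single (i : Fin 3) (a : ℤ) :
    quotTrans (Multiplicative.ofAdd (Pi.single i a)) = quotT i ^ a := by
  fin_cases i <;> simp [quotTrans]

/-- By the relations e), conjugation by `ê_{i,j}` modulo `M` fixes `t_k` for `k ≠ i` and sends `t_i`
to `t_i t_j⁻¹`, an action on exponents that extends linearly. -/
theorem quotE_quotTrans {i j : Fin 3} (hij : i ≠ j) (n : Fin 3 → ℤ) :
    SemiconjBy (quotE i j) (quotTrans (Multiplicative.ofAdd n))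
      (quotTrans (Multiplicative.ofAdd (n - Pi.single j (n i)))) := by
  have h1 : ∀ k a, SemiconjBy (quotE i j) (quotT k ^ (a : ℤ))
      (quotTrans (Multiplicative.ofAdd (Pi.single k a - Pi.single j ((Pi.single k a : Fin 3 → ℤ) i)))) := by
    intro k a
    by_cases hk : i = k
    · subst hk
      have := (quotE_quotT hij).zpow_right a
      rw [((quotT_commute i j).inv_right).mul_zpow, inv_zpow, ← quotTrans_single j,
        ← quotTrans_single i, ← map_inv, ← map_mul] at this
      rw [← quotTrans_single, Pi.single_eq_same]
      exact this
    · rw [Pi.single_eq_of_ne hk, Pi.single_zero, sub_zero, quotTrans_single]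
      exact (quotE_quotT_of_ne hij hk).zpow_right a
  have h2 : quotTrans (Multiplicative.ofAdd (n - Pi.single j (n i))) = 
    quotTrans (Multiplicative.ofAdd (Pi.single 0 (n 0) - Pi.single j ((Pi.single 0 (n 0) : Fin 3 → ℤ) i))) *
    quotTrans (Multiplicative.ofAdd (Pi.single 1 (n 1) - Pi.single j ((Pi.single 1 (n 1) : Fin 3 → ℤ) i))) *
    quotTrans (Multiplicative.ofAdd (Pi.single 2 (n 2) - Pi.single j ((Pi.single 2 (n 2) : Fin 3 → ℤ) i))) := by
    rw [← map_mul, ← map_mul, ← ofAdd_add, ← ofAdd_add]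
    congr 2
    funext l
    fin_cases i <;> fin_cases l <;> simp [Pi.single_apply] <;> ring
  rw [h2]
  exact ((h1 0 (n 0)).mul_right (h1 1 (n 1))).mul_right (h1 2 (n 2))

/-- Translations are normalised by the elementary generators, so in any word they can be collected
on the left. -/
theorem exists_quot_eq (q : E ⧸ E.ofM.range) : ∃ n, 
    ∃ g ∈ Subgroup.closure {g | ∃ i j, i ≠ j ∧ g = quotE i j}, q = quotTrans n * g := by
  have htop : q ∈ Subgroup.closure ({g | ∃ i, g = quotT i} ∪ {g | ∃ i j, i ≠ j ∧ g = quotE i j}) := by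
    obtain ⟨x, rfl⟩ := QuotientGroup.mk_surjective q
    have : x ∈ (Subgroup.closure ({g | ∃ i, g = quotT i} ∪ {g | ∃ i j, i ≠ j ∧ g = quotE i j})).comap
        (QuotientGroup.mk' E.ofM.range) := by
      rw [E.eq_top (C := Subgroup.comap _ _)]
      · exact Subgroup.mem_top x
      · exact fun i j h => Subgroup.subset_closure (Or.inr ⟨i, j, h, (quotE_of_ne h).symm⟩)
      · exact fun i => Subgroup.subset_closure (Or.inl ⟨i, rfl⟩)
      · intro u
        rw [Subgroup.mem_comap, QuotientGroup.mk'_apply, mk_ofM]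
        exact one_mem _
    exact this
  refine Subgroup.closure_induction_left (p := fun q _ => ∃ n, 
    ∃ g ∈ Subgroup.closure {g | ∃ i j, i ≠ j ∧ g = quotE i j}, q = quotTrans n * g)
    ⟨1, 1, one_mem _, by simp⟩ ?_ ?_ htop
  · rintro _ (⟨i, rfl⟩ | ⟨i, j, hij, rfl⟩) y - ⟨n, g, hg, rfl⟩
    · refine ⟨Multiplicative.ofAdd (Pi.single i 1) * n, g, hg, ?_⟩
      rw [map_mul, quotTrans_single, zpow_one, mul_assoc]
    · refine ⟨Multiplicative.ofAdd (n.toAdd - Pi.single j (n.toAdd i)), quotE i j * g, mul_mem (Subgroup.subset_closure ⟨i, j, hij, rfl⟩) hg, ?_⟩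
      rw [← mul_assoc, ← mul_assoc]
      exact congrArg (· * g) (quotE_quotTrans hij n.toAdd).eq
  · rintro _ (⟨i, rfl⟩ | ⟨i, j, hij, rfl⟩) y - ⟨n, g, hg, rfl⟩
    · refine ⟨Multiplicative.ofAdd (Pi.single i (-1)) * n, g, hg, ?_⟩
      rw [map_mul, quotTrans_single, zpow_neg_one, mul_assoc]
    · refine ⟨Multiplicative.ofAdd (n.toAdd + Pi.single j (n.toAdd i)), (quotE i j)⁻¹ * g,
        mul_mem (inv_mem (Subgroup.subset_closure ⟨i, j, hij, rfl⟩)) hg, ?_⟩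
      rw [← mul_assoc, ← mul_assoc]
      have := (quotE_quotTrans hij (n.toAdd + Pi.single j (n.toAdd i))).inv_symm_left
      rw [Pi.add_apply, Pi.single_eq_of_ne hij, add_zero, add_sub_cancel_right] at this
      exact congrArg (· * g) this.eq

/-- The matrix part, as a homomorphism. -/
def G.matrixPart : G →* Matrix.SpecialLinearGroup (Fin 3) ℤ := MonoidHom.mk' G.A G.mul_A

theorem projQuot_quotE {i j : Fin 3} (h : i ≠ j) : projQuot (quotE i j) = G.elem i j h := by
  rw [quotE_of_ne h]
  exact projE_e i j h

theorem projQuot_quotTrans (n : Fin 3 → ℤ) : projQuot (quotTrans (Multiplicative.ofAdd n)) = ⟨1, n⟩ := by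
  let s : Multiplicative (Fin 3 → ℤ) →* G :=
    MonoidHom.mk' (fun n => ⟨1, n.toAdd⟩) fun n m => by
      ext1
      · simp [G.mul_A]
      · simp [G.mul_n, add_comm]
  have hT : ∀ i a, projQuot (quotT i) ^ (a : ℤ) = s (Multiplicative.ofAdd (Pi.single i a)) := by
    intro i a
    have : projQuot (quotT i) = s (Multiplicative.ofAdd (Pi.single i 1)) := projE_t i
    rw [this, ← map_zpow, ← ofAdd_zsmul, ← Pi.single_smul, smul_eq_mul, mul_one]
  have : (⟨1, n⟩ : G) = s (Multiplicative.ofAdd (Pi.single 0 (n 0)) *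
    Multiplicative.ofAdd (Pi.single 1 (n 1)) * Multiplicative.ofAdd (Pi.single 2 (n 2))) := by
    ext1
    · rfl
    · funext i
      fin_cases i <;> simp [s]
  rw [this, map_mul, map_mul, ← hT, ← hT, ← hT]
  change projQuot (_ * _ * _) = _
  rw [map_mul, map_mul, map_zpow, map_zpow, map_zpow]
  rfl

/-- The matrix part of the projection comes from the elementary factor `g` alone, and the
presentation of `SL(3, ℤ)` makes `g` trivial. What remains is a translation, which is determined by
its image. -/
theorem eq_one_of_projQuot {q : E ⧸ E.ofM.range} (h : projQuot q = 1) : q = 1 := by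
  obtain ⟨n, g, hg, rfl⟩ := exists_quot_eq q
  have hn : (projQuot g).n = 0 := by
    let C : Subgroup G :=
      { carrier := {g | g.n = 0}
        one_mem' := rfl
        mul_mem' := fun {a b} ha hb => by
          change b.n + Matrix.vecMul a.n _ = 0
          rw [show a.n = 0 from ha, show b.n = 0 from hb, Matrix.zero_vecMul, add_zero]
        inv_mem' := fun {a} ha => by
          change -Matrix.vecMul a.n _ = 0
          rw [show a.n = 0 from ha, Matrix.zero_vecMul, neg_zero] }
    have : Subgroup.closure {g | ∃ i j, i ≠ j ∧ g = quotE i j} ≤ C.comap projQuot := by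
      rw [Subgroup.closure_le]
      rintro _ ⟨i, j, hij, rfl⟩
      change (projQuot (quotE i j)).n = 0
      rw [projQuot_quotE hij]
      rfl
    exact this hg
  have hA : (projQuot g).A = 1 := by
    have := congrArg G.A h
    rw [map_mul, ← ofAdd_toAdd n, projQuot_quotTrans, G.mul_A, one_mul] at this
    exact this
  have hg1 := eq_one_of_rank_three quotE_isCommutatorSystem weyl_quotE_pow
    (G.matrixPart.comp projQuot) (fun i j hij => congrArg G.A (projQuot_quotE hij)) hg hA
  subst hg1
  rw [mul_one] at h ⊢
  rw [← ofAdd_toAdd n, projQuot_quotTrans] at h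
  have : n.toAdd = 0 := congrArg G.n h
  rw [← ofAdd_toAdd n, this, ofAdd_zero, map_one]

theorem mem_range_of_projE {x : E} (h : projE x = 1) : x ∈ E.ofM.range :=
  (QuotientGroup.eq_one_iff x).1 (eq_one_of_projQuot h)

end Kernel

end EllGamma
end

noncomputable section

namespace EllGamma

/-! ### The homomorphism `E → N ⋊ G`, the cocycle and the characteristic class. -/

section Extension

/-- The semidirect product `N ⋊ G`. -/
abbrev SD : Type := N ⋊[MulDistribMulAction.toMulAut G N] G

theorem SD.mul_left (a b : SD) : (a * b).left = a.left * a.right • b.left := rfl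

/-- The elements of `N ⋊ G` over the images of the generators of `E`. -/
def sdImage (w : Gen → N) (x : Gen) : SD := ⟨w x, genImage x⟩

/-- The elements `w x` of `N` define a lift of `E → G` to `N ⋊ G`. -/
structure IsLift (w : Gen → N) : Prop where
  m : ∀ u, w (.m u) = (u : N)
  rel : ∀ a b, DefRel a b → FreeGroup.lift (sdImage w) a = FreeGroup.lift (sdImage w) b

variable {w : Gen → N} (hw : IsLift w)

/-- The homomorphism `E → N ⋊ G`. -/
def liftE : E →* SD := PresentedGroup.toGroup (f := sdImage w) (by
  rintro _ ⟨a, b, h, rfl⟩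
  rw [map_mul, map_inv, hw.rel a b h, mul_inv_cancel])

theorem liftE_of (x : Gen) : liftE hw (PresentedGroup.of x) = sdImage w x :=
  PresentedGroup.toGroup.of _

theorem liftE_right (x : E) : (liftE hw x).right = projE x := by
  have : SemidirectProduct.rightHom.comp (liftE hw) = projE := by
    refine PresentedGroup.ext fun y => ?_
    change (liftE hw (PresentedGroup.of y)).right = projE (PresentedGroup.of y)
    rw [liftE_of, projE, PresentedGroup.toGroup.of]
    rfl
  exact DFunLike.congr_fun this x

theorem liftE_ofM (u : M) : liftE hw (E.ofM u) = ⟨(u : N), 1⟩ := by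
  refine (liftE_of hw (.m u)).trans ?_
  rw [sdImage, hw.m]
  rfl

theorem liftE_ofM_mul_left (u : M) (x : E) :
    (liftE hw (E.ofM u * x)).left = (u : N) * (liftE hw x).left := by
  rw [map_mul, liftE_ofM, SD.mul_left, one_smul]

theorem liftE_mul_left (x y : E) :
    (liftE hw (x * y)).left = (liftE hw x).left * projE x • (liftE hw y).left := by
  rw [map_mul, SD.mul_left, liftE_right]

/-- The extension `1 → M → E → G → 1`. -/
def extE : GroupExtension M E G where
  inl := E.ofM
  rightHom := projE
  inl_injective u v h := by
    -- The composite of `M → E` with `E → N ⋊ G` followed by the first component is the inclusion `M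
    -- ⊆ N`, so the relations of `E` cannot identify distinct elements of `M`.
    have := congrArg (fun x => (liftE hw x).left) h
    simp only [liftE_ofM] at this
    exact Subtype.ext this
  range_inl_eq_ker_rightHom := le_antisymm
    (by rintro _ ⟨u, rfl⟩; exact projE_ofM u) fun _ h => mem_range_of_projE h
  rightHom_surjective := projE_surjective

theorem extE_isExtensionOfModule : IsExtensionOfModule (extE hw) := fun x u => by
  change x * E.ofM u * x⁻¹ = E.ofM (projE x • u)
  rw [E.mul_ofM, mul_inv_cancel_right]

/-- The class in `N / M` of the first component of the lift. -/
def liftClass (x : E) : N ⧸ M := QuotientGroup.mk (liftE hw x).left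

/-- Elements of `E` over the same point of `G` differ by a left factor from `M`, which multiplies
the first component by that element of `M`. -/
theorem liftClass_congr {x y : E} (h : projE x = projE y) : liftClass hw x = liftClass hw y := by
  obtain ⟨u, hu⟩ := mem_range_of_projE (x := y * x⁻¹) (by
    rw [map_mul, map_inv, h, mul_inv_cancel])
  have : y = E.ofM u * x := by rw [hu, inv_mul_cancel_right]
  rw [this, liftClass, liftClass, liftE_ofM_mul_left, QuotientGroup.mk_mul,
    (QuotientGroup.eq_one_iff (N := M) _).2 u.2, one_mul]

/-- The cocycle `G → N / M` defined by a lift. -/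
def cocycleE (g : G) : N ⧸ M := liftClass hw (projE_surjective g).choose

theorem cocycleE_projE (x : E) : cocycleE hw (projE x) = liftClass hw x :=
  liftClass_congr hw (projE_surjective (projE x)).choose_spec

theorem cocycleE_isMulCocycle₁ : groupCohomology.IsMulCocycle₁ (cocycleE hw) := by
  intro g h
  obtain ⟨x, rfl⟩ := projE_surjective g
  obtain ⟨y, rfl⟩ := projE_surjective h
  rw [← map_mul, cocycleE_projE, cocycleE_projE, cocycleE_projE, liftClass, liftE_mul_left,
    QuotientGroup.mk_mul, mul_comm]
  rfl

theorem cocycleE_elem (i j : Fin 3) (h : i ≠ j) :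
    cocycleE hw (G.elem i j h) = QuotientGroup.mk (w (.e i j h)) := by
  rw [← projE_e, cocycleE_projE]
  exact congrArg (fun x : SD => (QuotientGroup.mk x.left : N ⧸ M)) (liftE_of hw _)

theorem cocycleE_trans (i : Fin 3) :
    cocycleE hw (G.trans i) = QuotientGroup.mk (w (.t i)) := by
  rw [← projE_t, cocycleE_projE]
  exact congrArg (fun x : SD => (QuotientGroup.mk x.left : N ⧸ M)) (liftE_of hw _)

/-- A cocycle on `G` is determined by its values on the generators. -/
theorem cocycle_ext {u v : G → N ⧸ M} (hu : groupCohomology.IsMulCocycle₁ u)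
    (hv : groupCohomology.IsMulCocycle₁ v) (he : ∀ i j h, u (G.elem i j h) = v (G.elem i j h))
    (ht : ∀ i, u (G.trans i) = v (G.trans i)) : u = v := by
  let C : Subgroup G :=
    { carrier := {g | u g = v g}
      one_mem' := by
        change u 1 = v 1
        rw [groupCohomology.map_one_of_isMulCocycle₁ hu, groupCohomology.map_one_of_isMulCocycle₁ hv]
      mul_mem' := fun {a b} ha hb => by
        change u _ = v _
        rw [hu, hv, show u a = v a from ha, show u b = v b from hb]
      inv_mem' := fun {a} ha => by
        change u _ = v _
        have h1 := groupCohomology.map_inv_of_isMulCocycle₁ hu a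
        have h2 := groupCohomology.map_inv_of_isMulCocycle₁ hv a
        rw [show u a = v a from ha, ← h2] at h1
        exact smul_left_cancel a h1 }
  have hC : C = ⊤ := G.closure_eq_top he ht
  exact funext fun g => (hC ▸ Subgroup.mem_top g : g ∈ C)

/-- The first components `y g` of the lifts of `σ g` represent the cocycle by a cochain with values
in `N`. Because `E → N ⋊ G` is multiplicative, the coboundary of `y` is the factor set `φ` of the
section, and the connecting homomorphism is defined by this coboundary. -/
theorem extE_isCharacteristicClass :
    IsCharacteristicClass (extE hw) (connecting (groupCohomology.H1π
      (Rep.ofMulDistribMulAction G (N ⧸ M))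
      (groupCohomology.cocyclesOfIsMulCocycle₁ (cocycleE_isMulCocycle₁ hw)))) := by
  intro σ
  have hσ : ∀ g, projE (σ g) = g := σ.rightInverse_rightHom
  have hex : ∀ q : G × G, ∃ u, E.ofM u = σ q.1 * σ q.2 * (σ (q.1 * q.2))⁻¹ := fun q =>
    mem_range_of_projE (by
      rw [map_mul, map_mul, map_inv, hσ, hσ, hσ, mul_inv_cancel])
  choose φ hφ using hex
  have hφ' : ∀ g h, σ g * σ h = E.ofM (φ (g, h)) * σ (g * h) := fun g h => by
    rw [hφ, inv_mul_cancel_right]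
  set y : G → N := fun g => (liftE hw (σ g)).left with hy
  have hφN : ∀ g h, (φ (g, h) : N) = y g * g • y h * (y (g * h))⁻¹ := fun g h => by
    have := congrArg (fun x => (liftE hw x).left) (hφ' g h)
    simp only [liftE_ofM_mul_left] at this
    rw [liftE_mul_left, hσ] at this
    rw [eq_mul_inv_iff_mul_eq]
    exact this.symm
  have hcoc : groupCohomology.IsMulCocycle₂ φ := by
    intro g h j
    refine Subtype.ext ?_
    change (φ (g * h, j) : N) * φ (g, h) = g • (φ (h, j) : N) * φ (g, h * j)
    rw [hφN, hφN, hφN, hφN, smul_mul', smul_mul', smul_inv', mul_smul, mul_assoc g h j]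
    apply Additive.ofMul.injective
    simp only [ofMul_mul, ofMul_inv]
    abel
  refine ⟨φ, hcoc, hφ', ?_⟩
  refine (groupCohomology.δ₁_apply coeffSeq_shortExact _ (fun g => Additive.ofMul (y g)) ?_
    (fun q => Additive.ofMul (φ q)) ?_).symm
  · funext g
    change Additive.ofMul (QuotientGroup.mk (y g) : N ⧸ M) = Additive.ofMul (cocycleE hw g)
    have := cocycleE_projE hw (σ g)
    rw [hσ] at this
    rw [this]
    rfl
  · funext q
    change Additive.ofMul (φ q : N) = Additive.ofMul (q.1 • y q.2) - Additive.ofMul (y (q.1 * q.2)) +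
      Additive.ofMul (y q.1)
    rw [show q = (q.1, q.2) from rfl, hφN]
    simp only [ofMul_mul, ofMul_inv]
    abel

end Extension

/-! ### Reduction of the theorem to the relations satisfied by three elements of `N`. -/

section Reduction

/-- The elements of `N` attached to the generators of `E`, given those attached to `ê₁₂`, `ê₃₂`
and `t̂₂`. -/
def genValue (U V T : N) : Gen → N
  | .e 0 1 _ => U
  | .e 2 1 _ => V
  | .e _ _ _ => 1
  | .t 1 => T
  | .t _ => 1
  | .m u => u

theorem genValue_e {U V T : N} {i j : Fin 3} (h : i ≠ j) (hj : j ≠ 1) :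
    genValue U V T (.e i j h) = 1 := by
  fin_cases i <;> fin_cases j <;> first | rfl | exact absurd rfl hj

theorem genValue_t {U V T : N} {i : Fin 3} (h : i ≠ 1) : genValue U V T (.t i) = 1 := by
  fin_cases i <;> first | rfl | exact absurd rfl h

theorem IsClassModM.unique {a b : N ⧸ M} {F : X → ℂ} (ha : IsClassModM a F)
    (hb : IsClassModM b F) : a = b := by
  obtain ⟨a, h, rfl⟩ := ha
  obtain ⟨b, h', rfl⟩ := hb
  exact congrArg _ (Subtype.ext (h.unique h'))

/-- The main theorem, given elements of `N` that satisfy the relations of `E`. -/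
theorem main_of_isLift {U V T : N} (hw : IsLift (genValue U V T))
    (hU : (U : InvFun).IsClassOf fun p =>
      (ellGamma ((p.1 - p.2 1) / p.2 2) ((p.2 0 - p.2 1) / p.2 2) (-(p.2 0 / p.2 2)))⁻¹)
    (hV : (V : InvFun).IsClassOf fun p =>
      ellGamma (p.1 / p.2 0) ((p.2 1 - p.2 2) / p.2 0) (p.2 2 / p.2 0))
    (hT : (T : InvFun).IsClassOf fun p => theta₀ ((p.1 - p.2 1) / p.2 0) (p.2 2 / p.2 0)) :
    (∃ u : G → N ⧸ M, groupCohomology.IsMulCocycle₁ u ∧ HasGammaValues u) ∧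
    ∃ S : GroupExtension M E G, S.inl = E.ofM ∧
      (∀ (i j : Fin 3) (h : i ≠ j), S.rightHom (E.e i j h) = G.elem i j h) ∧
      (∀ i : Fin 3, S.rightHom (E.t i) = G.trans i) ∧ IsExtensionOfModule S ∧
      ∀ (u : G → N ⧸ M) (hu : groupCohomology.IsMulCocycle₁ u), HasGammaValues u →
        IsCharacteristicClass S (connecting (groupCohomology.H1π
          (Rep.ofMulDistribMulAction G (N ⧸ M)) (groupCohomology.cocyclesOfIsMulCocycle₁ hu))) := by
  have hval : HasGammaValues (cocycleE hw) :=
    { e₁₂ := ⟨U, hU, (cocycleE_elem hw 0 1 (by decide)).symm⟩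
      e₃₂ := ⟨V, hV, (cocycleE_elem hw 2 1 (by decide)).symm⟩
      e_other := fun i j h hj => by
        rw [cocycleE_elem, genValue_e h hj]
        rfl
      t₂ := ⟨T, hT, (cocycleE_trans hw 1).symm⟩
      t_other := fun i hi => by
        rw [cocycleE_trans, genValue_t hi]
        rfl }
  refine ⟨⟨cocycleE hw, cocycleE_isMulCocycle₁ hw, hval⟩, extE hw, rfl, projE_e, projE_t,
    extE_isExtensionOfModule hw, fun u hu hu' => ?_⟩
  have : u = cocycleE hw := by
    refine cocycle_ext hu (cocycleE_isMulCocycle₁ hw) (fun i j h => ?_) fun i => ?_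
    · by_cases hj : j = 1
      · have : (i = 0 ∧ j = 1) ∨ (i = 2 ∧ j = 1) := by omega
        rcases this with ⟨rfl, rfl⟩ | ⟨rfl, rfl⟩
        · exact hu'.e₁₂.unique hval.e₁₂
        · exact hu'.e₃₂.unique hval.e₃₂
      · rw [hu'.e_other i j h hj, hval.e_other i j h hj]
    · by_cases hi : i = 1
      · subst hi
        exact hu'.t₂.unique hval.t₂
      · rw [hu'.t_other i hi, hval.t_other i hi]
  subst this
  exact extE_isCharacteristicClass hw

end Reduction

end EllGamma
end

noncomputable section

namespace EllGamma

open Filter Topology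

/-! ### Holomorphy of uniform limits in several variables. -/

section LocallyUniform

variable {V : Type*} [NormedAddCommGroup V] [NormedSpace ℂ V]

/-- A uniform limit of holomorphic functions on a ball in a complex normed space is holomorphic
at the centre. -/
theorem differentiableAt_of_tendstoUniformlyOn {ι : Type*} {l : Filter ι} [l.NeBot]
    {F : ι → V → ℂ} {f : V → ℂ} {p : V} {δ : ℝ} (hδ : 0 < δ)
    (h : TendstoUniformlyOn F f l (Metric.ball p (2 * δ)))
    (hF : ∀ n, DifferentiableOn ℂ (F n) (Metric.ball p (2 * δ))) : DifferentiableAt ℂ f p := by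
  have hsub : ∀ y ∈ Metric.ball p δ, Metric.ball y δ ⊆ Metric.ball p (2 * δ) := fun y hy =>
    Metric.ball_subset_ball' (by rw [Metric.mem_ball] at hy; linarith)
  have hdiff : ∀ n, ∀ y ∈ Metric.ball p δ, DifferentiableAt ℂ (F n) y := fun n y hy =>
    (hF n).differentiableAt (Filter.mem_of_superset (Metric.ball_mem_nhds y hδ) (hsub y hy))
  -- Cauchy's estimate on balls of radius `δ` bounds the derivative of a difference by its supremum
  -- on the larger ball, so the derivatives are uniformly Cauchy on the smaller one.
  have hC : UniformCauchySeqOn (fun n y => fderiv ℂ (F n) y) l (Metric.ball p δ) := by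
    have hc := h.uniformCauchySeqOn
    intro u hu
    obtain ⟨ε, hε, hu⟩ := Metric.mem_uniformity_dist.1 hu
    filter_upwards [hc _ (Metric.dist_mem_uniformity (show 0 < ε * δ / 4 by positivity))]
      with m hm y hy
    refine hu ?_
    have hm' : ∀ x ∈ Metric.ball y δ, ‖(F m.1 - F m.2) x‖ ≤ ε * δ / 4 := fun x hx => by
      have := hm x (hsub y hy hx)
      rw [dist_eq_norm] at this
      exact this.le
    have := Complex.norm_fderiv_le_div_of_mapsTo_ball (f := F m.1 - F m.2) (c := y) (R₁ := δ)
      (R₂ := ε * δ / 2) (((hF m.1).mono (hsub y hy)).sub ((hF m.2).mono (hsub y hy)))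
      (fun x hx => by
        rw [Metric.mem_closedBall, dist_eq_norm]
        refine (norm_sub_le _ _).trans ?_
        linarith [hm' x hx, hm' y (Metric.mem_ball_self hδ)]) hδ
    rw [fderiv_sub (hdiff _ y hy) (hdiff _ y hy)] at this
    rw [dist_eq_norm]
    refine this.trans_lt ?_
    rw [div_lt_iff₀ hδ]
    nlinarith [mul_pos hε hδ]
  have hlim : ∀ y ∈ Metric.ball p δ, ∃ L, Tendsto (fun n => fderiv ℂ (F n) y) l (𝓝 L) :=
    fun y hy => CompleteSpace.complete (hC.cauchy_map hy)
  choose! g' hg' using hlim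
  exact (hasFDerivAt_of_tendstoUniformlyOn Metric.isOpen_ball (hC.tendstoUniformlyOn_of_tendsto hg')
    (fun n y hy => (hdiff n y hy).hasFDerivAt)
    (fun y hy => (h.mono (hsub p (Metric.mem_ball_self hδ))).tendsto_at hy)
    (Metric.mem_ball_self hδ)).differentiableAt

theorem differentiable_finsetProd {ι : Type*} (s : Finset ι) {f : ι → V → ℂ}
    (hf : ∀ i, Differentiable ℂ (f i)) : Differentiable ℂ fun x => ∏ i ∈ s, f i x := by
  classical
  induction s using Finset.induction_on with
  | empty => simp
  | insert i s hi ih =>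
    simp only [Finset.prod_insert hi]
    exact (hf i).mul ih

end LocallyUniform

/-! ### Simple and double infinite products for parameters in the unit disc. -/

section DoubleProduct

theorem summable_geom_prod {a b : ℝ} (ha : 0 ≤ a) (hb : 0 ≤ b) (ha1 : a < 1) (hb1 : b < 1) :
    Summable fun p : ℕ × ℕ => a ^ p.1 * b ^ p.2 :=
  (summable_geometric_of_lt_one ha ha1).mul_of_nonneg (summable_geometric_of_lt_one hb hb1)
    (fun _ => pow_nonneg ha _) fun _ => pow_nonneg hb _

theorem summable_dprod (x : ℂ) {q r : ℂ} (hq : ‖q‖ < 1) (hr : ‖r‖ < 1) :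
    Summable fun p : ℕ × ℕ => ‖-(x * q ^ p.1 * r ^ p.2)‖ := by
  refine ((summable_geom_prod (norm_nonneg q) (norm_nonneg r) hq hr).mul_left ‖x‖).congr fun p => ?_
  rw [norm_neg, norm_mul, norm_mul, norm_pow, norm_pow, mul_assoc]

theorem multipliable_dprod (x : ℂ) {q r : ℂ} (hq : ‖q‖ < 1) (hr : ‖r‖ < 1) :
    Multipliable fun p : ℕ × ℕ => 1 - x * q ^ p.1 * r ^ p.2 := by
  simp only [sub_eq_add_neg]
  exact multipliable_one_add_of_summable (summable_dprod x hq hr)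

theorem dprod_ne_zero {x q r : ℂ} (hq : ‖q‖ < 1) (hr : ‖r‖ < 1)
    (h : ∀ i j : ℕ, x * q ^ i * r ^ j ≠ 1) : dprod x q r ≠ 0 := by
  simp only [dprod, sub_eq_add_neg]
  refine tprod_one_add_ne_zero_of_summable (fun p => ?_) (summable_dprod x hq hr)
  rw [← sub_eq_add_neg]
  exact sub_ne_zero.2 (h p.1 p.2).symm

theorem dprod_zero (q r : ℂ) : dprod 0 q r = 1 := by simp [dprod]

theorem dprod_comm (x q r : ℂ) : dprod x q r = dprod x r q := by
  rw [dprod, dprod, ← (Equiv.prodComm ℕ ℕ).tprod_eq]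
  exact tprod_congr fun p => by
    simp only [Equiv.prodComm_apply, Prod.fst_swap, Prod.snd_swap]
    ring

/-- Near `t` the `(j, k)` term is dominated by a constant times `ρ ^ j * ρ ^ k` with `ρ < 1`. The
product therefore converges uniformly in all three variables, and its finite subproducts are
polynomials. -/
theorem dprod_differentiableAt {t : ℂ × ℂ × ℂ} (hq : ‖t.2.1‖ < 1) (hr : ‖t.2.2‖ < 1) :
    DifferentiableAt ℂ (fun t : ℂ × ℂ × ℂ => dprod t.1 t.2.1 t.2.2) t := by
  obtain ⟨ρ, hρ, hρ1⟩ := exists_between (max_lt hq hr)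
  have h1 := (le_max_left _ _).trans_lt hρ
  have h2 := (le_max_right _ _).trans_lt hρ
  have hρ0 : 0 ≤ ρ := (norm_nonneg _).trans h1.le
  let U : Set (ℂ × ℂ × ℂ) := {s | ‖s.1‖ < ‖t.1‖ + 1 ∧ ‖s.2.1‖ < ρ ∧ ‖s.2.2‖ < ρ}
  have hU : IsOpen U := by
    have e1 : IsOpen {s : ℂ × ℂ × ℂ | ‖s.1‖ < ‖t.1‖ + 1} := isOpen_lt (by fun_prop) (by fun_prop)
    have e2 : IsOpen {s : ℂ × ℂ × ℂ | ‖s.2.1‖ < ρ} := isOpen_lt (by fun_prop) (by fun_prop)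
    have e3 : IsOpen {s : ℂ × ℂ × ℂ | ‖s.2.2‖ < ρ} := isOpen_lt (by fun_prop) (by fun_prop)
    exact e1.inter (e2.inter e3)
  have htU : t ∈ U := ⟨by linarith, h1, h2⟩
  obtain ⟨δ, hδ, hball⟩ := Metric.nhds_basis_closedBall.mem_iff.1 (hU.mem_nhds htU)
  have hprod := Summable.hasProdUniformlyOn_one_add (R := ℂ)
    (f := fun (p : ℕ × ℕ) (s : ℂ × ℂ × ℂ) => -(s.1 * s.2.1 ^ p.1 * s.2.2 ^ p.2))
    (isCompact_closedBall t δ) ((summable_geom_prod hρ0 hρ0 hρ1 hρ1).mul_left (‖t.1‖ + 1))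
    (Eventually.of_forall fun p s hs => by
      rw [norm_neg, norm_mul, norm_mul, norm_pow, norm_pow, mul_assoc]
      obtain ⟨e1, e2, e3⟩ := hball hs
      have := e1.le
      have := e2.le
      have := e3.le
      gcongr)
    (fun p => by fun_prop)
  have e : (fun t : ℂ × ℂ × ℂ => dprod t.1 t.2.1 t.2.2) = fun t : ℂ × ℂ × ℂ =>
      ∏' p : ℕ × ℕ, (1 + -(t.1 * t.2.1 ^ p.1 * t.2.2 ^ p.2)) := by
    simp only [dprod, sub_eq_add_neg]
  rw [e]
  refine differentiableAt_of_tendstoUniformlyOn (δ := δ / 2) (half_pos hδ)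
    (hprod.tendstoUniformlyOn.mono ?_) fun s => ?_
  · rw [mul_div_cancel₀ δ two_ne_zero]
    exact Metric.ball_subset_closedBall
  · refine (differentiable_finsetProd s fun i => ?_).differentiableOn
    fun_prop

/-- The simple product `(x; q)`, `|q| < 1`. -/
def sprod (x q : ℂ) : ℂ := ∏' j : ℕ, (1 - x * q ^ j)

theorem multipliable_sprod (x : ℂ) {q : ℂ} (hq : ‖q‖ < 1) :
    Multipliable fun j : ℕ => 1 - x * q ^ j := by
  simp only [sub_eq_add_neg]
  refine multipliable_one_add_of_summable
    (((summable_geometric_of_lt_one (norm_nonneg q) hq).mul_left ‖x‖).congr fun p => ?_)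
  rw [norm_neg, norm_mul, norm_pow]

theorem dprod_hasProd (x : ℂ) {q r : ℂ} (hq : ‖q‖ < 1) (hr : ‖r‖ < 1) :
    HasProd (fun i : ℕ => sprod (x * q ^ i) r) (dprod x q r) :=
  (multipliable_dprod x hq hr).hasProd.prod_fiberwise fun i =>
    (multipliable_sprod (x * q ^ i) hr).hasProd

theorem dprod_shift (x : ℂ) {q r : ℂ} (hq : ‖q‖ < 1) (hr : ‖r‖ < 1) :
    dprod x q r = sprod x r * dprod (q * x) q r := by
  have h1 := dprod_hasProd x hq hr
  have h2 := dprod_hasProd (q * x) hq hr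
  have e : ∀ i : ℕ, sprod (q * x * q ^ i) r = sprod (x * q ^ (i + 1)) r := fun i => by
    congr 1
    ring
  simp only [e] at h2
  rw [← h1.tprod_eq, ← h2.tprod_eq, tprod_eq_zero_mul' (f := fun i : ℕ => sprod (x * q ^ i) r) h2.multipliable, pow_zero, mul_one]

theorem sprod_shift (x : ℂ) {q : ℂ} (hq : ‖q‖ < 1) : sprod x q = (1 - x) * sprod (q * x) q := by
  have h2 := multipliable_sprod (q * x) hq
  have e : ∀ i : ℕ, 1 - q * x * q ^ i = 1 - x * q ^ (i + 1) := fun i => by ring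
  simp only [e] at h2
  rw [sprod, tprod_eq_zero_mul' (f := fun i : ℕ => 1 - x * q ^ i) h2, pow_zero, mul_one, sprod]
  simp only [e]

theorem sprod_zero (q : ℂ) : sprod 0 q = 1 := by simp [sprod]

/-- At `r = 0` only the factors with `k = 0` survive. Nonvanishing and holomorphy of the simple
product become special cases of the double one. -/
theorem sprod_eq_dprod (x : ℂ) {q : ℂ} (hq : ‖q‖ < 1) : sprod x q = dprod x q 0 := by
  rw [← (dprod_hasProd x hq (r := 0) (by simp)).tprod_eq]
  refine tprod_congr fun i => ?_
  rw [sprod, tprod_eq_mulSingle 0 fun j hj => by simp [hj]]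
  simp

theorem sprod_ne_zero {x q : ℂ} (hq : ‖q‖ < 1) (h : ∀ i : ℕ, x * q ^ i ≠ 1) : sprod x q ≠ 0 := by
  rw [sprod_eq_dprod x hq]
  refine dprod_ne_zero hq (by simp) fun i j => ?_
  rcases j with - | j
  · simpa using h i
  · simp

theorem sprod_differentiableAt {t : ℂ × ℂ} (hq : ‖t.2‖ < 1) :
    DifferentiableAt ℂ (fun t : ℂ × ℂ => sprod t.1 t.2) t := by
  have h : DifferentiableAt ℂ (fun t : ℂ × ℂ => dprod t.1 t.2 0) t :=
    (dprod_differentiableAt (t := (t.1, t.2, 0)) hq (by simp)).comp t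
      (f := fun t : ℂ × ℂ => ((t.1, t.2, 0) : ℂ × ℂ × ℂ)) (by fun_prop)
  refine h.congr_of_eventuallyEq ?_
  filter_upwards [(isOpen_lt (f := fun s : ℂ × ℂ => ‖s.2‖) (g := fun _ => (1 : ℝ)) (by fun_prop)
    (by fun_prop)).mem_nhds hq] with s hs
  exact sprod_eq_dprod s.1 hs

theorem dprod_differentiable {q r : ℂ} (hq : ‖q‖ < 1) (hr : ‖r‖ < 1) :
    Differentiable ℂ fun x => dprod x q r := fun x =>
  (dprod_differentiableAt (t := (x, q, r)) hq hr).comp x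
    (f := fun x : ℂ => ((x, q, r) : ℂ × ℂ × ℂ)) (by fun_prop)

theorem sprod_differentiable {q : ℂ} (hq : ‖q‖ < 1) : Differentiable ℂ fun x => sprod x q :=
  fun x => (sprod_differentiableAt (t := (x, q)) hq).comp x
    (f := fun x : ℂ => ((x, q) : ℂ × ℂ)) (by fun_prop)

/-- A function continuous at `0` with `f 0 = 1` is determined by `f x = a x * f (q x)`. -/
theorem eq_of_shift {q : ℂ} (hq : ‖q‖ < 1) {a f g : ℂ → ℂ} (hf : ∀ x, f x = a x * f (q * x))
    (hg : ∀ x, g x = a x * g (q * x)) (hf0 : f 0 = 1) (hg0 : g 0 = 1) (hfc : ContinuousAt f 0)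
    (hgc : ContinuousAt g 0) (x : ℂ) : f x = g x := by
  have key : ∀ n : ℕ, f x * g (q ^ n * x) = g x * f (q ^ n * x) := by
    intro n
    induction n with
    | zero => simp [mul_comm]
    | succ n ih =>
      by_cases ha : a (q ^ n * x) = 0
      · have h1 : ∀ n : ℕ, a (q ^ n * x) = 0 → f x = 0 ∧ g x = 0 := by
          intro n hn
          have : ∀ k ≤ n, f (q ^ (n - k) * x) = 0 ∧ g (q ^ (n - k) * x) = 0 := by
            intro k
            induction k with
            | zero => intro _; rw [hf, hg, Nat.sub_zero, hn]; simp
            | succ k ihk =>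
              intro hk
              have := ihk (by omega)
              rw [hf, hg, ← mul_assoc, ← pow_succ', show n - (k + 1) + 1 = n - k by omega, this.1,
                this.2]
              simp
          simpa using this n le_rfl
        rw [(h1 n ha).1, (h1 n ha).2]
        simp
      · rw [hf (q ^ n * x), hg (q ^ n * x), ← mul_assoc q, ← pow_succ'] at ih
        refine mul_left_cancel₀ ha ?_
        linear_combination ih
  have ht : Tendsto (fun n : ℕ => q ^ n * x) atTop (𝓝 0) := by
    simpa using (tendsto_pow_atTop_nhds_zero_of_norm_lt_one hq).mul_const x
  have h1 : Tendsto (fun n : ℕ => f x * g (q ^ n * x)) atTop (𝓝 (f x * 1)) :=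
    (hg0 ▸ (hgc.tendsto.comp ht)).const_mul (f x)
  have h2 : Tendsto (fun n : ℕ => f x * g (q ^ n * x)) atTop (𝓝 (g x * 1)) := by
    simp only [key]
    exact (hf0 ▸ (hfc.tendsto.comp ht)).const_mul (g x)
  simpa using tendsto_nhds_unique h1 h2

theorem norm_sq_lt_one {q : ℂ} (hq : ‖q‖ < 1) : ‖q ^ 2‖ < 1 := by
  rw [norm_pow]
  exact pow_lt_one₀ (norm_nonneg q) hq two_ne_zero

theorem sprod_split (x : ℂ) {q : ℂ} (hq : ‖q‖ < 1) :
    sprod x q = sprod x (q ^ 2) * sprod (q * x) (q ^ 2) := by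
  have hq2 := norm_sq_lt_one hq
  have hd := sprod_differentiable hq2
  refine eq_of_shift hq (a := fun x => 1 - x) (f := fun x => sprod x q)
    (g := fun x => sprod x (q ^ 2) * sprod (q * x) (q ^ 2)) (fun x => sprod_shift x hq) (fun x => ?_)
    (sprod_zero q) (by simp [sprod_zero]) (sprod_differentiable hq).continuous.continuousAt
    (hd.continuous.mul (hd.continuous.comp (continuous_const_mul q))).continuousAt x
  rw [sprod_shift x hq2, pow_two, mul_assoc q q x]
  ring

/-- This separates even and odd powers of `r`. Both sides have the same multiplier under `x ↦ q x`,
by the splitting of the simple product, so `eq_of_shift` applies. -/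
theorem dprod_split (x : ℂ) {q r : ℂ} (hq : ‖q‖ < 1) (hr : ‖r‖ < 1) :
    dprod x q r = dprod x q (r ^ 2) * dprod (r * x) q (r ^ 2) := by
  have hr2 := norm_sq_lt_one hr
  have hd := dprod_differentiable hq hr2
  refine eq_of_shift hq (a := fun x => sprod x r) (f := fun x => dprod x q r)
    (g := fun x => dprod x q (r ^ 2) * dprod (r * x) q (r ^ 2)) (fun x => dprod_shift x hq hr)
    (fun x => ?_) (dprod_zero q r) (by simp [dprod_zero])
    (dprod_differentiable hq hr).continuous.continuousAt
    (hd.continuous.mul (hd.continuous.comp (continuous_const_mul r))).continuousAt x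
  rw [dprod_shift x hq hr2, dprod_shift (r * x) hq hr2, sprod_split x hr, mul_left_comm q r x]
  ring

theorem sprod_sq (x : ℂ) {q : ℂ} (hq : ‖q‖ < 1) :
    sprod (x ^ 2) (q ^ 2) = sprod x q * sprod (-x) q := by
  have hq2 := norm_sq_lt_one hq
  have hd := sprod_differentiable hq
  refine eq_of_shift hq (a := fun x => 1 - x ^ 2) (f := fun x => sprod (x ^ 2) (q ^ 2))
    (g := fun x => sprod x q * sprod (-x) q) (fun x => ?_) (fun x => ?_)
    (by simp [sprod_zero]) (by simp [sprod_zero])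
    ((sprod_differentiable hq2).continuous.comp (continuous_pow 2)).continuousAt
    (hd.continuous.mul (hd.continuous.comp continuous_neg)).continuousAt x
  · rw [sprod_shift _ hq2, mul_pow]
  · rw [sprod_shift x hq, sprod_shift (-x) hq, mul_neg]
    ring

/-- Each factor is a difference of squares; formally the argument is again uniqueness for the shift
equation. -/
theorem dprod_sq (x : ℂ) {q r : ℂ} (hq : ‖q‖ < 1) (hr : ‖r‖ < 1) :
    dprod (x ^ 2) (q ^ 2) (r ^ 2) = dprod x q r * dprod (-x) q r := by
  have hq2 := norm_sq_lt_one hq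
  have hr2 := norm_sq_lt_one hr
  have hd := dprod_differentiable hq hr
  refine eq_of_shift hq (a := fun x => sprod (x ^ 2) (r ^ 2))
    (f := fun x => dprod (x ^ 2) (q ^ 2) (r ^ 2))
    (g := fun x => dprod x q r * dprod (-x) q r) (fun x => ?_) (fun x => ?_)
    (by simp [dprod_zero]) (by simp [dprod_zero])
    ((dprod_differentiable hq2 hr2).continuous.comp (continuous_pow 2)).continuousAt
    (hd.continuous.mul (hd.continuous.comp continuous_neg)).continuousAt x
  · rw [dprod_shift _ hq2 hr2, mul_pow]
  · rw [dprod_shift x hq hr, dprod_shift (-x) hq hr, mul_neg, sprod_sq x hr]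
    ring

end DoubleProduct

end EllGamma
end

noncomputable section

namespace EllGamma

open Filter Topology

/-! ### Extension of the product formulas to parameters off the unit circle. -/

section SignExtended

variable {x q r : ℂ}

theorem poch_of_lt (hq : ‖q‖ < 1) : poch x q = sprod x q := if_pos hq

theorem poch_of_gt (hq : 1 < ‖q‖) : poch x q = (sprod (q⁻¹ * x) q⁻¹)⁻¹ := if_neg hq.not_gt

theorem poch₂_of_lt (hq : ‖q‖ < 1) (hr : ‖r‖ < 1) : poch₂ x q r = dprod x q r := by
  rw [poch₂, if_pos hq, if_pos hr]

theorem norm_inv_lt_one (hq : 1 < ‖q‖) : ‖q⁻¹‖ < 1 := by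
  rw [norm_inv]
  exact inv_lt_one_of_one_lt₀ hq

theorem one_lt_norm_inv (hq0 : q ≠ 0) (hq : ‖q‖ < 1) : 1 < ‖q⁻¹‖ := by
  rw [norm_inv]
  exact (one_lt_inv₀ (norm_pos_iff.2 hq0)).2 hq

theorem norm_inv_ne_one (hq : ‖q‖ ≠ 1) : ‖q⁻¹‖ ≠ 1 := by
  rwa [norm_inv, ne_eq, inv_eq_one]

theorem poch₂_comm (x q r : ℂ) : poch₂ x q r = poch₂ x r q := by
  unfold poch₂
  split_ifs <;> rw [dprod_comm]
  rw [mul_comm q⁻¹]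

theorem poch_inv (hq0 : q ≠ 0) (hq : ‖q‖ ≠ 1) : poch x q⁻¹ = (poch (q * x) q)⁻¹ := by
  rcases hq.lt_or_gt with h | h
  · rw [poch_of_gt (one_lt_norm_inv hq0 h), poch_of_lt h, inv_inv]
  · rw [poch_of_lt (norm_inv_lt_one h), poch_of_gt h, inv_inv, inv_mul_cancel_left₀ hq0]

theorem poch₂_inv_left (hq0 : q ≠ 0) (hq : ‖q‖ ≠ 1) :
    poch₂ x q⁻¹ r = (poch₂ (q * x) q r)⁻¹ := by
  unfold poch₂
  rcases hq.lt_or_gt with h | h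
  · rw [if_neg (one_lt_norm_inv hq0 h).not_gt, if_pos h, inv_inv]
    split_ifs
    · rfl
    · rw [inv_inv, mul_assoc, mul_left_comm]
  · rw [if_pos (norm_inv_lt_one h), if_neg h.not_gt]
    split_ifs
    · rw [inv_inv, inv_mul_cancel_left₀ hq0]
    · rw [mul_assoc, mul_left_comm, inv_mul_cancel_left₀ hq0]

theorem poch₂_inv_right (hr0 : r ≠ 0) (hr : ‖r‖ ≠ 1) :
    poch₂ x q r⁻¹ = (poch₂ (r * x) q r)⁻¹ := by
  rw [poch₂_comm, poch₂_inv_left hr0 hr, poch₂_comm]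

/-- Reduction of statements on `q` with `‖q‖ ≠ 1` to `‖q‖ < 1`. -/
theorem norm_cases {P : ℂ → Prop} (h : ∀ q, q ≠ 0 → ‖q‖ < 1 → P q)
    (h' : ∀ q, q ≠ 0 → ‖q‖ < 1 → P q → P q⁻¹) (hq0 : q ≠ 0) (hq : ‖q‖ ≠ 1) : P q := by
  rcases hq.lt_or_gt with hlt | hgt
  · exact h q hq0 hlt
  · have hlt := norm_inv_lt_one hgt
    have := h' q⁻¹ (inv_ne_zero hq0) hlt (h _ (inv_ne_zero hq0) hlt)
    rwa [inv_inv] at this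

theorem poch_ne_zero (hq0 : q ≠ 0) (hq : ‖q‖ ≠ 1) (h : ∀ n : ℤ, x * q ^ n ≠ 1) :
    poch x q ≠ 0 := by
  revert h x
  refine norm_cases (P := fun q => ∀ {x}, (∀ n : ℤ, x * q ^ n ≠ 1) → poch x q ≠ 0) ?_ ?_ hq0 hq
  · intro q hq0 hq x h
    rw [poch_of_lt hq]
    exact sprod_ne_zero hq fun i => by simpa using h i
  · intro q hq0 hq ih x h
    rw [poch_inv hq0 hq.ne]
    refine inv_ne_zero (ih fun n => ?_)
    have := h (-(n + 1))
    rwa [inv_zpow', neg_neg, zpow_add_one₀ hq0, mul_comm _ q, ← mul_assoc, mul_comm x] at this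

theorem poch₂_ne_zero (hq0 : q ≠ 0) (hq : ‖q‖ ≠ 1) (hr0 : r ≠ 0) (hr : ‖r‖ ≠ 1)
    (h : ∀ m n : ℤ, x * q ^ m * r ^ n ≠ 1) : poch₂ x q r ≠ 0 := by
  revert h x
  refine norm_cases (P := fun q => ∀ {x}, (∀ m n : ℤ, x * q ^ m * r ^ n ≠ 1) → poch₂ x q r ≠ 0)
    ?_ ?_ hq0 hq
  · intro q hq0 hq x h
    revert h x
    refine norm_cases (P := fun r => ∀ {x}, (∀ m n : ℤ, x * q ^ m * r ^ n ≠ 1) → poch₂ x q r ≠ 0)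
      ?_ ?_ hr0 hr
    · intro r hr0 hr x h
      rw [poch₂_of_lt hq hr]
      exact dprod_ne_zero hq hr fun i j => by simpa using h i j
    · intro r hr0 hr ih x h
      rw [poch₂_inv_right hr0 hr.ne]
      refine inv_ne_zero (ih fun m n => ?_)
      have := h m (-(n + 1))
      rw [inv_zpow', neg_neg, zpow_add_one₀ hr0] at this
      convert this using 1
      ring
  · intro q hq0 hq ih x h
    rw [poch₂_inv_left hq0 hq.ne]
    refine inv_ne_zero (ih fun m n => ?_)
    have := h (-(m + 1)) n
    rw [inv_zpow', neg_neg, zpow_add_one₀ hq0] at this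
    convert this using 1
    ring

/-- For `‖q‖ > 1` the factor `1 - x` enters through an inverse, whose value at `x = 1` is `0` by
convention; the exclusion of `x = 1` is needed there. -/
theorem poch_shift (hq0 : q ≠ 0) (hq : ‖q‖ ≠ 1) (hx : x ≠ 1) :
    poch x q = (1 - x) * poch (q * x) q := by
  rcases hq.lt_or_gt with h | h
  · rw [poch_of_lt h, poch_of_lt h, sprod_shift x h]
  · rw [poch_of_gt h, poch_of_gt h, inv_mul_cancel_left₀ hq0, sprod_shift x (norm_inv_lt_one h),
      mul_inv, mul_inv_cancel_left₀ (sub_ne_zero.2 hx.symm)]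

theorem poch₂_shift (hq0 : q ≠ 0) (hq : ‖q‖ ≠ 1) (hr0 : r ≠ 0) (hr : ‖r‖ ≠ 1)
    (h : ∀ n : ℤ, x * r ^ n ≠ 1) : poch₂ x q r = poch x r * poch₂ (q * x) q r := by
  have key : ∀ q, q ≠ 0 → ‖q‖ < 1 → poch₂ x q r = poch x r * poch₂ (q * x) q r := by
    intro q hq0 hq
    rcases hr.lt_or_gt with h | h
    · rw [poch₂_of_lt hq h, poch₂_of_lt hq h, poch_of_lt h, dprod_shift x hq h]
    · unfold poch₂
      rw [if_pos hq, if_neg h.not_gt, if_neg h.not_gt, if_pos hq,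
        dprod_shift _ hq (norm_inv_lt_one h), poch_of_gt h, mul_inv, mul_left_comm]
  rcases hq.lt_or_gt with hlt | hgt
  · exact key q hq0 hlt
  · have hlt := norm_inv_lt_one hgt
    have h0 := inv_ne_zero hq0
    have := key q⁻¹ h0 hlt
    rw [← inv_inv q, poch₂_inv_left h0 hlt.ne, poch₂_inv_left h0 hlt.ne, inv_inv,
      inv_mul_cancel_left₀ hq0, this, mul_inv, mul_inv_cancel_left₀ (poch_ne_zero hr0 hr h)]

theorem poch₂_split (hq0 : q ≠ 0) (hq : ‖q‖ ≠ 1) (hr0 : r ≠ 0) (hr : ‖r‖ ≠ 1) :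
    poch₂ x q r = poch₂ x q (r ^ 2) * poch₂ (r * x) q (r ^ 2) := by
  revert x
  refine norm_cases (P := fun q => ∀ {x}, poch₂ x q r = poch₂ x q (r ^ 2) * poch₂ (r * x) q (r ^ 2))
    ?_ ?_ hq0 hq
  · intro q hq0 hq
    refine norm_cases (P := fun r => ∀ {x}, poch₂ x q r = poch₂ x q (r ^ 2) *
      poch₂ (r * x) q (r ^ 2)) ?_ ?_ hr0 hr
    · intro r hr0 hr x
      have := norm_sq_lt_one hr
      rw [poch₂_of_lt hq hr, poch₂_of_lt hq this, poch₂_of_lt hq this, dprod_split x hq hr]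
    · intro r hr0 hr ih x
      have h2 := norm_sq_lt_one hr
      have h0 := pow_ne_zero 2 hr0
      rw [inv_pow, poch₂_inv_right hr0 hr.ne, poch₂_inv_right h0 h2.ne, poch₂_inv_right h0 h2.ne,
        ih, mul_inv, mul_comm]
      congr 3
      · rw [pow_two]; ring
      · rw [pow_two, mul_assoc, mul_inv_cancel_left₀ hr0]
  · intro q hq0 hq ih x
    rw [poch₂_inv_left hq0 hq.ne, poch₂_inv_left hq0 hq.ne, poch₂_inv_left hq0 hq.ne, ih, mul_inv,
      mul_left_comm]

theorem poch₂_sq (hq0 : q ≠ 0) (hq : ‖q‖ ≠ 1) (hr0 : r ≠ 0) (hr : ‖r‖ ≠ 1) :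
    poch₂ (x ^ 2) (q ^ 2) (r ^ 2) = poch₂ x q r * poch₂ (-x) q r := by
  revert x
  refine norm_cases (P := fun q => ∀ {x}, poch₂ (x ^ 2) (q ^ 2) (r ^ 2) =
    poch₂ x q r * poch₂ (-x) q r) ?_ ?_ hq0 hq
  · intro q hq0 hq
    refine norm_cases (P := fun r => ∀ {x}, poch₂ (x ^ 2) (q ^ 2) (r ^ 2) =
      poch₂ x q r * poch₂ (-x) q r) ?_ ?_ hr0 hr
    · intro r hr0 hr x
      rw [poch₂_of_lt hq hr, poch₂_of_lt hq hr, poch₂_of_lt (norm_sq_lt_one hq) (norm_sq_lt_one hr),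
        dprod_sq x hq hr]
    · intro r hr0 hr ih x
      rw [inv_pow, poch₂_inv_right hr0 hr.ne, poch₂_inv_right hr0 hr.ne,
        poch₂_inv_right (pow_ne_zero 2 hr0) (norm_sq_lt_one hr).ne, ← mul_pow, ih, mul_inv, mul_neg]
  · intro q hq0 hq ih x
    rw [inv_pow, poch₂_inv_left hq0 hq.ne, poch₂_inv_left hq0 hq.ne,
        poch₂_inv_left (pow_ne_zero 2 hq0) (norm_sq_lt_one hq).ne, ← mul_pow, ih, mul_inv, mul_neg]

end SignExtended

/-! ### Functional equations of `θ₀` and `Γ` in additive variables. -/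

section Additive

theorem ee_ne_zero (z : ℂ) : ee z ≠ 0 := Complex.exp_ne_zero _

theorem ee_zero : ee 0 = 1 := by simp [ee]

theorem ee_sub (a b : ℂ) : ee (a - b) = ee a / ee b := by
  rw [sub_eq_add_neg, ee_add, ee_neg, div_eq_mul_inv]

theorem ee_eq_one_iff {z : ℂ} : ee z = 1 ↔ ∃ n : ℤ, z = n := by
  rw [ee, Complex.exp_eq_one_iff]
  refine exists_congr fun n => ?_
  rw [mul_comm (n : ℂ), mul_right_inj' Complex.two_pi_I_ne_zero]

theorem ee_int (n : ℤ) : ee n = 1 := ee_eq_one_iff.2 ⟨n, rfl⟩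

theorem ee_one : ee 1 = 1 := by simpa using ee_int 1

theorem ee_half : ee (1 / 2) = -1 := by
  rw [ee, ← Complex.exp_pi_mul_I]
  congr 1
  ring

theorem ee_int_mul (n : ℤ) (z : ℂ) : ee (n * z) = ee z ^ n := by
  rw [ee, ee, ← Complex.exp_int_mul]
  congr 1
  ring

theorem ee_two_mul (z : ℂ) : ee (2 * z) = ee z ^ 2 := by
  simpa using ee_int_mul 2 z

theorem norm_ee (z : ℂ) : ‖ee z‖ = Real.exp (-(2 * Real.pi * z.im)) := by
  rw [ee, Complex.norm_exp]
  congr 1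
  simp [Complex.mul_re]

theorem norm_ee_lt_one {τ : ℂ} (h : 0 < τ.im) : ‖ee τ‖ < 1 := by
  rw [norm_ee, Real.exp_lt_one_iff]
  have := Real.pi_pos
  have : 0 < 2 * Real.pi * τ.im := by positivity
  linarith

theorem norm_ee_ne_one {τ : ℂ} (h : τ.im ≠ 0) : ‖ee τ‖ ≠ 1 := by
  rw [norm_ee, ne_eq, Real.exp_eq_one_iff, neg_eq_zero]
  have := Real.pi_pos.ne'
  simp [this, h]

theorem differentiable_ee : Differentiable ℂ ee := by
  unfold ee
  fun_prop

/-- The argument `z` avoids the zeros and poles of `θ₀(·, τ)`. -/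
structure ThetaGood (z τ : ℂ) : Prop where
  im : τ.im ≠ 0
  ne : ∀ a b : ℤ, z ≠ a + b * τ

/-- The argument `z` avoids the zeros and poles of `Γ(·, τ, σ)`. -/
structure GammaGood (z τ σ : ℂ) : Prop where
  im_left : τ.im ≠ 0
  im_right : σ.im ≠ 0
  ne : ∀ a b c : ℤ, z ≠ a + b * τ + c * σ

variable {z τ σ : ℂ}

theorem ThetaGood.mul_ne_one (h : ThetaGood z τ) (n : ℤ) : ee z * ee τ ^ n ≠ 1 := by
  rw [← ee_int_mul, ← ee_add, ne_eq, ee_eq_one_iff]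
  rintro ⟨m, hm⟩
  exact h.ne m (-n) (by push_cast; linear_combination hm)

theorem GammaGood.mul_ne_one (h : GammaGood z τ σ) (m n : ℤ) :
    ee z * ee τ ^ m * ee σ ^ n ≠ 1 := by
  rw [← ee_int_mul, ← ee_int_mul, ← ee_add, ← ee_add, ne_eq, ee_eq_one_iff]
  rintro ⟨k, hk⟩
  exact h.ne k (-m) (-n) (by push_cast; linear_combination hk)

theorem ThetaGood.reflect (h : ThetaGood z τ) : ThetaGood (τ - z) τ :=
  ⟨h.im, fun a b e => h.ne (-a) (1 - b) (by push_cast; linear_combination -e)⟩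

theorem GammaGood.reflect (h : GammaGood z τ σ) : GammaGood (τ + σ - z) τ σ :=
  ⟨h.im_left, h.im_right, fun a b c e => h.ne (-a) (1 - b) (1 - c) (by
    push_cast; linear_combination -e)⟩

theorem GammaGood.theta_right (h : GammaGood z τ σ) : ThetaGood z σ :=
  ⟨h.im_right, fun a b e => h.ne a 0 b (by push_cast; linear_combination e)⟩

theorem GammaGood.symm (h : GammaGood z τ σ) : GammaGood z σ τ :=
  ⟨h.im_right, h.im_left, fun a b c e => h.ne a c b (by linear_combination e)⟩

theorem theta₀_ne_zero (h : ThetaGood z τ) : theta₀ z τ ≠ 0 := by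
  refine mul_ne_zero (poch_ne_zero (ee_ne_zero _) (norm_ee_ne_one h.im) h.mul_ne_one)
    (poch_ne_zero (ee_ne_zero _) (norm_ee_ne_one h.im) ?_)
  rw [← ee_sub]
  exact h.reflect.mul_ne_one

theorem poch₂_ee_ne_zero (h : GammaGood z τ σ) : poch₂ (ee z) (ee τ) (ee σ) ≠ 0 :=
  poch₂_ne_zero (ee_ne_zero _) (norm_ee_ne_one h.im_left) (ee_ne_zero _)
    (norm_ee_ne_one h.im_right) h.mul_ne_one

theorem ellGamma_eq (z τ σ : ℂ) : ellGamma z τ σ =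
    poch₂ (ee (τ + σ - z)) (ee τ) (ee σ) / poch₂ (ee z) (ee τ) (ee σ) := by
  rw [ellGamma, ee_sub, ee_add]

theorem theta₀_eq (z τ : ℂ) : theta₀ z τ = poch (ee z) (ee τ) * poch (ee (τ - z)) (ee τ) := by
  rw [theta₀, ee_sub]

theorem ellGamma_ne_zero (h : GammaGood z τ σ) : ellGamma z τ σ ≠ 0 := by
  rw [ellGamma_eq]
  exact div_ne_zero (poch₂_ee_ne_zero h.reflect) (poch₂_ee_ne_zero h)

theorem theta₀_add_one (z τ : ℂ) : theta₀ (z + 1) τ = theta₀ z τ := by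
  simp only [theta₀, ee_add, ee_one, mul_one]

theorem theta₀_period_add_one (z τ : ℂ) : theta₀ z (τ + 1) = theta₀ z τ := by
  simp only [theta₀, ee_add, ee_one, mul_one]

theorem ellGamma_add_one (z τ σ : ℂ) : ellGamma (z + 1) τ σ = ellGamma z τ σ := by
  simp only [ellGamma, ee_add, ee_one, mul_one]

theorem ellGamma_left_add_one (z τ σ : ℂ) : ellGamma z (τ + 1) σ = ellGamma z τ σ := by
  simp only [ellGamma, ee_add, ee_one, mul_one]

theorem ellGamma_right_add_one (z τ σ : ℂ) : ellGamma z τ (σ + 1) = ellGamma z τ σ := by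
  simp only [ellGamma, ee_add, ee_one, mul_one]

theorem ellGamma_comm (z τ σ : ℂ) : ellGamma z τ σ = ellGamma z σ τ := by
  rw [ellGamma_eq, ellGamma_eq, poch₂_comm, poch₂_comm (ee z), add_comm τ]

theorem ellGamma_reflect (z τ σ : ℂ) : ellGamma (τ + σ - z) τ σ = (ellGamma z τ σ)⁻¹ := by
  rw [ellGamma_eq, ellGamma_eq, inv_div, sub_sub_cancel]

theorem ellGamma_neg_left (h : τ.im ≠ 0) (z σ : ℂ) :
    ellGamma z (-τ) σ = (ellGamma (z + τ) τ σ)⁻¹ := by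
  have h0 := ee_ne_zero τ
  have h1 := norm_ee_ne_one h
  rw [ellGamma_eq, ellGamma_eq, ee_neg, poch₂_inv_left h0 h1, poch₂_inv_left h0 h1, ← ee_add,
    ← ee_add, inv_div, inv_div_inv, add_comm τ z]
  congr 3
  ring

theorem theta₀_neg (h : τ.im ≠ 0) (z : ℂ) : theta₀ z (-τ) = (theta₀ (z + τ) τ)⁻¹ := by
  have h0 := ee_ne_zero τ
  have h1 := norm_ee_ne_one h
  rw [theta₀_eq, theta₀_eq, ee_neg, poch_inv h0 h1, poch_inv h0 h1, ← ee_add, ← ee_add,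
    ← mul_inv, add_comm τ z]
  congr 4
  ring

/-- The shift of the double product is applied in the numerator and in the denominator; the two
simple products that appear are the factors of `θ₀(z, σ)`. -/
theorem ellGamma_add_left (h : GammaGood z τ σ) :
    ellGamma (z + τ) τ σ = theta₀ z σ * ellGamma z τ σ := by
  have hq0 := ee_ne_zero τ
  have hq := norm_ee_ne_one h.im_left
  have hr0 := ee_ne_zero σ
  have hr := norm_ee_ne_one h.im_right
  have e1 := poch₂_shift (x := ee z) hq0 hq hr0 hr h.theta_right.mul_ne_one
  have e2 := poch₂_shift (x := ee (σ - z)) hq0 hq hr0 hr h.theta_right.reflect.mul_ne_one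
  rw [← ee_add] at e1 e2
  have n1 := poch₂_ee_ne_zero h
  have n2 := poch_ne_zero hr0 hr h.theta_right.mul_ne_one
  rw [ellGamma_eq, ellGamma_eq, theta₀_eq, show τ + σ - (z + τ) = σ - z by ring,
    show τ + σ - z = τ + (σ - z) by ring, e2, e1, add_comm z τ]
  rw [e1] at n1
  have n3 := right_ne_zero_of_mul n1
  field_simp

theorem theta₀_add_period (h : ThetaGood z τ) :
    theta₀ (z + τ) τ = -(ee z)⁻¹ * theta₀ z τ := by
  have hq0 := ee_ne_zero τ
  have hq := norm_ee_ne_one h.im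
  have n1 : ee z ≠ 1 := by simpa using h.mul_ne_one 0
  have n2 : ee (-z) ≠ 1 := by rwa [ee_neg, ne_eq, inv_eq_one]
  have e1 := poch_shift hq0 hq n1
  have e2 := poch_shift hq0 hq n2
  rw [← ee_add] at e1 e2
  rw [theta₀_eq, theta₀_eq, show τ - (z + τ) = -z by ring, e1, e2, add_comm z τ,
    ← sub_eq_add_neg, ee_neg]
  have := ee_ne_zero z
  field_simp
  ring

/-- Together with `ellGamma_two_mul`, this relates a triple of periods to the triple with one period
doubled, which is how the constants in the modular identities are determined. -/
theorem ellGamma_split (hτ : τ.im ≠ 0) (hσ : σ.im ≠ 0) (z : ℂ) :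
    ellGamma z τ σ = ellGamma z τ (2 * σ) * ellGamma (z + σ) τ (2 * σ) := by
  have e : ∀ x, poch₂ x (ee τ) (ee σ) =
      poch₂ x (ee τ) (ee (2 * σ)) * poch₂ (ee σ * x) (ee τ) (ee (2 * σ)) := fun x => by
    rw [ee_two_mul]
    exact poch₂_split (ee_ne_zero τ) (norm_ee_ne_one hτ) (ee_ne_zero σ) (norm_ee_ne_one hσ)
  rw [ellGamma_eq, ellGamma_eq, ellGamma_eq, e, e, ← ee_add, ← ee_add, div_mul_div_comm,
    mul_comm (poch₂ (ee (τ + σ - z)) _ _), show τ + 2 * σ - z = σ + (τ + σ - z) by ring,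
    show τ + 2 * σ - (z + σ) = τ + σ - z by ring, add_comm z σ]

theorem ellGamma_two_mul (hτ : τ.im ≠ 0) (hσ : σ.im ≠ 0) (z : ℂ) :
    ellGamma (2 * z) (2 * τ) (2 * σ) = ellGamma z τ σ * ellGamma (z + 1 / 2) τ σ := by
  have e : ∀ x, poch₂ (ee (2 * x)) (ee (2 * τ)) (ee (2 * σ)) =
      poch₂ (ee x) (ee τ) (ee σ) * poch₂ (ee (x + 1 / 2)) (ee τ) (ee σ) := fun x => by
    rw [ee_two_mul, ee_two_mul, ee_two_mul, ee_add, ee_half, mul_neg_one]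
    exact poch₂_sq (ee_ne_zero τ) (norm_ee_ne_one hτ) (ee_ne_zero σ) (norm_ee_ne_one hσ)
  have e' : ee (τ + σ - (z + 1 / 2)) = ee (τ + σ - z + 1 / 2) := by
    rw [ee_add _ (1 / 2), ← sub_sub, ee_sub _ (1 / 2), ee_half]
    ring
  rw [ellGamma_eq, ellGamma_eq, ellGamma_eq, ← mul_add, ← mul_sub, e, e, e', div_mul_div_comm]

end Additive

end EllGamma
end

noncomputable section

namespace EllGamma

open Filter Topology

/-! ### Entire quotients and doubly periodic entire functions. -/

section Entire

theorem entire_eq_zero_of_mul {f g : ℂ → ℂ} (hf : Differentiable ℂ f) (hg : Differentiable ℂ g)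
    (h : ∀ z, f z * g z = 0) {z₀ : ℂ} (h0 : g z₀ ≠ 0) (z : ℂ) : f z = 0 := by
  have ha : AnalyticOnNhd ℂ f Set.univ := fun z _ => hf.analyticAt z
  refine ha.eqOn_zero_of_preconnected_of_eventuallyEq_zero isPreconnected_univ (Set.mem_univ z₀) ?_
    (Set.mem_univ z)
  filter_upwards [hg.continuous.continuousAt.eventually_ne h0] with w hw
  exact (mul_eq_zero.1 (h w)).resolve_right hw

theorem differentiable_dslope {f : ℂ → ℂ} (hf : Differentiable ℂ f) (w : ℂ) :
    Differentiable ℂ (dslope f w) := by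
  rw [← differentiableOn_univ] at hf ⊢
  exact (Complex.differentiableOn_dslope univ_mem).2 hf

/-- The quotient of two entire functions is entire if the denominator has only simple zeros, and
the numerator vanishes there. -/
theorem exists_entire_quotient {A B : ℂ → ℂ} (hA : Differentiable ℂ A) (hB : Differentiable ℂ B)
    (h : ∀ z, B z = 0 → A z = 0 ∧ deriv B z ≠ 0) :
    ∃ k : ℂ → ℂ, Differentiable ℂ k ∧ ∀ z, A z = k z * B z := by
  classical
  refine ⟨fun z => if B z = 0 then deriv A z / deriv B z else A z / B z, fun w => ?_, fun z => ?_⟩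
  · by_cases hw : B w = 0
    · obtain ⟨hAw, hd⟩ := h w hw
      have hdA := differentiable_dslope hA w
      have hdB := differentiable_dslope hB w
      have hne : dslope B w w ≠ 0 := by rwa [dslope_same]
      refine ((hdA w).div (hdB w) hne).congr_of_eventuallyEq ?_
      filter_upwards [hdB.continuous.continuousAt.eventually_ne hne] with z hz
      by_cases hzw : z = w
      · subst hzw
        simp [hw]
      · have e : ∀ f : ℂ → ℂ, f w = 0 → f z = (z - w) * dslope f w z := fun f hf => by
          have := sub_smul_dslope f w z
          rw [hf, sub_zero, smul_eq_mul] at this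
          exact this.symm
        have hzw' := sub_ne_zero.2 hzw
        have hBz : B z ≠ 0 := by
          rw [e B hw]
          exact mul_ne_zero hzw' hz
        simp only [Pi.div_apply]
        rw [if_neg hBz, e A hAw, e B hw, mul_div_mul_left _ _ hzw']
    · refine ((hA w).div (hB w) hw).congr_of_eventuallyEq ?_
      filter_upwards [hB.continuous.continuousAt.eventually_ne hw] with z hz
      simp [hz]
  · by_cases hz : B z = 0
    · rw [(h z hz).1, hz, mul_zero]
    · simp [hz]

/-- An entire function with two periods that are independent over `ℝ` is constant. -/
theorem entire_const_of_periodic {k : ℂ → ℂ} (hk : Differentiable ℂ k) {ω₁ ω₂ : ℂ}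
    (h : (ω₂ / ω₁).im ≠ 0) (h1 : ∀ z, k (z + ω₁) = k z) (h2 : ∀ z, k (z + ω₂) = k z) (z w : ℂ) :
    k z = k w := by
  have hω : ω₁ ≠ 0 := by
    rintro rfl
    simp at h
  refine hk.apply_eq_apply_of_bounded ?_ z w
  have hc : IsCompact ((fun p : ℝ × ℝ => k (p.1 * ω₁ + p.2 * ω₂)) ''
      (Set.Icc 0 1 ×ˢ Set.Icc 0 1)) := by
    refine (isCompact_Icc.prod isCompact_Icc).image (hk.continuous.comp ?_)
    fun_prop
  refine hc.isBounded.subset ?_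
  rintro _ ⟨z, rfl⟩
  -- `s` and `t` are the real coordinates of `z` in the basis `ω₁, ω₂`; their fractional parts give
  -- a point of the compact period parallelogram.
  set t : ℝ := (z / ω₁).im / (ω₂ / ω₁).im with ht
  set s : ℝ := (z / ω₁).re - t * (ω₂ / ω₁).re with hs
  have hz : z = s * ω₁ + t * ω₂ := by
    have : z / ω₁ = s + t * (ω₂ / ω₁) := by
      apply Complex.ext
      · simp [hs]
      · simp [ht, h]
    field_simp at this
    linear_combination this
  refine ⟨(Int.fract s, Int.fract t), ⟨⟨Int.fract_nonneg s, (Int.fract_lt_one s).le⟩,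
    Int.fract_nonneg t, (Int.fract_lt_one t).le⟩, ?_⟩
  have p1 : Function.Periodic k (⌊s⌋ * ω₁) := Function.Periodic.int_mul h1 ⌊s⌋
  have p2 : Function.Periodic k (⌊t⌋ * ω₂) := Function.Periodic.int_mul h2 ⌊t⌋
  dsimp only
  rw [← p1, ← p2]
  congr 1
  have e : ∀ x : ℝ, ((Int.fract x : ℝ) : ℂ) = x - (⌊x⌋ : ℂ) := fun x => by
    rw [← Int.self_sub_floor]
    push_cast
    rfl
  rw [hz, e, e]
  ring

end Entire

/-! ### Modular transformation of `θ₀` up to a constant. -/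

section Theta

variable {τ : ℂ}

theorem theta₀_of_pos (h : 0 < τ.im) (z : ℂ) :
    theta₀ z τ = sprod (ee z) (ee τ) * sprod (ee τ * ee (-z)) (ee τ) := by
  rw [theta₀, poch_of_lt (norm_ee_lt_one h), poch_of_lt (norm_ee_lt_one h), ee_neg, div_eq_mul_inv]

theorem differentiable_theta₀ (h : 0 < τ.im) : Differentiable ℂ fun z => theta₀ z τ := by
  simp only [theta₀_of_pos h]
  have hs := sprod_differentiable (norm_ee_lt_one h)
  exact (hs.comp differentiable_ee).mul
    (hs.comp ((differentiable_ee.comp differentiable_neg).const_mul _))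

/-- In the upper half-plane no inverse products occur, so the law also holds at the zeros, as the
study of those zeros requires. -/
theorem theta₀_add_period' (h : 0 < τ.im) (z : ℂ) :
    theta₀ (z + τ) τ = -(ee z)⁻¹ * theta₀ z τ := by
  have hq := norm_ee_lt_one h
  have hz := ee_ne_zero z
  have e1 := sprod_shift (ee z) hq
  have e2 := sprod_shift (ee (-z)) hq
  have e3 : ee τ * ee (-(z + τ)) = ee (-z) := by
    rw [← ee_add]
    congr 1
    ring
  rw [theta₀_of_pos h, theta₀_of_pos h, e3, ee_add z τ, e1, e2, ee_neg, mul_comm (ee z) (ee τ)]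
  field_simp
  ring

/-- Splitting off the factor `1 - ee z` leaves a function whose value at `0` is a square of the
nonzero product `(q; q)`. -/
theorem hasDerivAt_theta₀_zero (h : 0 < τ.im) :
    theta₀ 0 τ = 0 ∧ deriv (fun z => theta₀ z τ) 0 ≠ 0 := by
  have hq := norm_ee_lt_one h
  set g : ℂ → ℂ := fun z => sprod (ee τ * ee z) (ee τ) * sprod (ee τ * ee (-z)) (ee τ) with hg
  have hs := sprod_differentiable hq
  have hgd : Differentiable ℂ g :=
    (hs.comp (differentiable_ee.const_mul _)).mul
      (hs.comp ((differentiable_ee.comp differentiable_neg).const_mul _))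
  have e : (fun z => theta₀ z τ) = fun z => (1 - ee z) * g z := by
    funext z
    rw [theta₀_of_pos h, sprod_shift _ hq, hg, mul_assoc]
  have hee : HasDerivAt ee (2 * Real.pi * Complex.I) 0 := by
    have := ((hasDerivAt_id (0 : ℂ)).const_mul (2 * Real.pi * Complex.I)).cexp
    have h1 : HasDerivAt (fun z => Complex.exp (2 * Real.pi * Complex.I * z))
        (2 * Real.pi * Complex.I) 0 := by simpa using this
    exact h1
  have hd : HasDerivAt (fun z => theta₀ z τ) (-(2 * Real.pi * Complex.I) * g 0) 0 := by
    have := (hee.const_sub 1).mul (hgd 0).hasDerivAt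
    rw [e]
    exact this.congr_deriv (by simp [ee_zero])
  refine ⟨by rw [congrFun e 0]; simp [ee_zero], ?_⟩
  rw [hd.deriv]
  have hs0 : sprod (ee τ) (ee τ) ≠ 0 := by
    refine sprod_ne_zero hq fun i hi => ?_
    have := congrArg norm hi
    rw [← pow_succ', norm_pow, norm_one] at this
    exact (pow_lt_one₀ (norm_nonneg _) hq (Nat.succ_ne_zero i)).ne this
  refine mul_ne_zero (neg_ne_zero.2 Complex.two_pi_I_ne_zero) ?_
  simp [hg, ee_zero, hs0]

/-- Failure of `ThetaGood` means that `z` lies in `ℤ + ℤ τ`. Quasi-periodicity with an entire,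
nowhere zero multiplier carries a simple zero at `0` to every lattice point. -/
theorem theta₀_simple_zero (h : 0 < τ.im) {z : ℂ} (hz : ¬ ThetaGood z τ) :
    theta₀ z τ = 0 ∧ deriv (fun z => theta₀ z τ) z ≠ 0 := by
  have hθ := differentiable_theta₀ h
  set P : ℂ → Prop := fun z => theta₀ z τ = 0 ∧ deriv (fun z => theta₀ z τ) z ≠ 0 with hP
  have hmul : ∀ (a : ℂ → ℂ) (ω z : ℂ), Differentiable ℂ a → (∀ z, a z ≠ 0) →
      (∀ z, theta₀ (z + ω) τ = a z * theta₀ z τ) → (P (z + ω) ↔ P z) := by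
    intro a ω z had ha he
    have h0 : theta₀ (z + ω) τ = 0 ↔ theta₀ z τ = 0 := by
      rw [he, mul_eq_zero, or_iff_right (ha z)]
    refine and_congr_right_iff.2 ?_ |>.trans (and_congr_left_iff.2 fun _ => h0)
    intro hz0
    rw [h0] at hz0
    have h1 : deriv (fun z => theta₀ z τ) (z + ω) = a z * deriv (fun z => theta₀ z τ) z := by
      rw [← deriv_comp_add_const (f := fun z => theta₀ z τ) (a := ω)]
      have := (had z).hasDerivAt.mul (hθ z).hasDerivAt
      rw [hz0, mul_zero, zero_add] at this
      rw [← this.deriv]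
      congr 1
      exact funext he
    rw [h1, ne_eq, mul_eq_zero, or_iff_right (ha z)]
  have hone : ∀ z, P (z + 1) ↔ P z := fun z => hmul (fun _ => 1) 1 z (differentiable_const 1)
    (fun _ => one_ne_zero) fun z => by rw [theta₀_add_one, one_mul]
  have hτ : ∀ z, P (z + τ) ↔ P z := fun z => hmul (fun z => -(ee z)⁻¹) τ z
    (differentiable_ee.inv ee_ne_zero).neg (fun z => neg_ne_zero.2 (inv_ne_zero (ee_ne_zero z)))
    (theta₀_add_period' h)
  have hlat : ∀ ω, (∀ z, P (z + ω) ↔ P z) → ∀ (n : ℤ) z, P (z + n * ω) ↔ P z := by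
    intro ω hω n
    induction n using Int.induction_on with
    | zero => simp
    | succ n ih =>
      intro z
      have := (hω (z + ((n : ℤ) : ℂ) * ω)).trans (ih z)
      rwa [show z + ((n : ℤ) : ℂ) * ω + ω = z + (((n : ℤ) + 1 : ℤ) : ℂ) * ω by
        push_cast; ring] at this
    | pred n ih =>
      intro z
      have := (hω (z + ((-(n : ℤ) - 1 : ℤ) : ℂ) * ω)).symm
      rw [show z + ((-(n : ℤ) - 1 : ℤ) : ℂ) * ω + ω = z + ((-(n : ℤ) : ℤ) : ℂ) * ω by
        push_cast; ring] at this
      exact this.trans (ih z)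
  have : ∃ a b : ℤ, z = a + b * τ := by
    by_contra! hne
    exact hz ⟨h.ne', hne⟩
  obtain ⟨a, b, rfl⟩ := this
  have h0 : P 0 := hasDerivAt_theta₀_zero h
  have := (hlat 1 hone a 0).2 h0
  rw [zero_add, mul_one] at this
  exact (hlat τ hτ b a).2 this

/-- The polynomial `B_{2,2}(z | ω₁, ω₂)`. -/
def bern₂ (z ω₁ ω₂ : ℂ) : ℂ :=
  (6 * z ^ 2 - 6 * (ω₁ + ω₂) * z + ω₁ ^ 2 + ω₂ ^ 2 + 3 * ω₁ * ω₂) / (6 * ω₁ * ω₂)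

/-- The product of theta functions which is constant by modularity. -/
def thetaQuot (z ω₁ ω₂ : ℂ) : ℂ :=
  theta₀ (z / ω₁) (ω₂ / ω₁) * theta₀ (z / ω₂) (ω₁ / ω₂) *
    Complex.exp (Real.pi * Complex.I * bern₂ z ω₁ ω₂)

theorem bern₂_comm (z ω₁ ω₂ : ℂ) : bern₂ z ω₁ ω₂ = bern₂ z ω₂ ω₁ := by
  unfold bern₂
  congr 1 <;> ring

theorem thetaQuot_comm (z ω₁ ω₂ : ℂ) : thetaQuot z ω₁ ω₂ = thetaQuot z ω₂ ω₁ := by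
  rw [thetaQuot, thetaQuot, bern₂_comm, mul_comm (theta₀ (z / ω₁) _)]

/-- The difference of the quadratic polynomial under this shift is `2 z / ω₂ - 1`; the exponential
thereby compensates the multiplier of the theta function. -/
theorem exp_bern₂_add (z : ℂ) {ω₁ ω₂ : ℂ} (h1 : ω₁ ≠ 0) (h2 : ω₂ ≠ 0) :
    Complex.exp (Real.pi * Complex.I * bern₂ (z + ω₁) ω₁ ω₂) =
      -ee (z / ω₂) * Complex.exp (Real.pi * Complex.I * bern₂ z ω₁ ω₂) := by
  have : bern₂ (z + ω₁) ω₁ ω₂ = 2 * (z / ω₂) - 1 + bern₂ z ω₁ ω₂ := by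
    unfold bern₂
    field_simp
    ring
  rw [this, mul_add, Complex.exp_add, mul_sub, Complex.exp_sub, mul_one, Complex.exp_pi_mul_I, ee]
  congr 1
  rw [div_neg, div_one]
  congr 2
  ring

theorem im_inv_neg {τ : ℂ} (h : 0 < τ.im) : 0 < (-τ⁻¹).im := by
  rw [Complex.neg_im, Complex.inv_im, neg_div, neg_neg]
  refine div_pos h (Complex.normSq_pos.2 ?_)
  rintro rfl
  simp at h

/-- The second theta factor has its period in the lower half-plane, so it is the reciprocal of an
entire function `B`. The remaining factor `A` vanishes at the zeros of `B`, which are simple, and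
has the same multipliers under `ω₁` and `ω₂`. Thus `A / B` extends to an entire doubly periodic
function. -/
theorem thetaQuot_const_of_pos {ω₁ ω₂ : ℂ} (h : 0 < (ω₂ / ω₁).im) :
    ∃ c, ∀ z, (∀ a b : ℤ, z ≠ a * ω₁ + b * ω₂) → thetaQuot z ω₁ ω₂ = c := by
  have hω₁ : ω₁ ≠ 0 := by
    rintro rfl
    simp at h
  have hω₂ : ω₂ ≠ 0 := by
    rintro rfl
    simp at h
  have h' : 0 < (-(ω₁ / ω₂)).im := by
    rw [← inv_div]
    exact im_inv_neg h
  set A : ℂ → ℂ := fun z => theta₀ (z / ω₁) (ω₂ / ω₁) *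
    Complex.exp (Real.pi * Complex.I * bern₂ z ω₁ ω₂) with hA
  set B : ℂ → ℂ := fun z => theta₀ (z / ω₂ + -(ω₁ / ω₂)) (-(ω₁ / ω₂)) with hB
  have hAd : Differentiable ℂ A := by
    refine ((differentiable_theta₀ h).comp (by fun_prop)).mul ?_
    unfold bern₂
    fun_prop
  have hBd : Differentiable ℂ B := (differentiable_theta₀ h').comp
    (f := fun z => z / ω₂ + -(ω₁ / ω₂)) (by fun_prop)
  have hA1 : ∀ z, A (z + ω₁) = -ee (z / ω₂) * A z := fun z => by
    simp only [hA]
    rw [add_div, div_self hω₁, theta₀_add_one, exp_bern₂_add z hω₁ hω₂]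
    ring
  have hB1 : ∀ z, B (z + ω₁) = -ee (z / ω₂) * B z := fun z => by
    simp only [hB]
    rw [show (z + ω₁) / ω₂ + -(ω₁ / ω₂) = z / ω₂ by ring, theta₀_add_period' h']
    have := ee_ne_zero (z / ω₂)
    field_simp
  have hA2 : ∀ z, A (z + ω₂) = A z := fun z => by
    simp only [hA]
    rw [add_div, theta₀_add_period' h, bern₂_comm, exp_bern₂_add z hω₂ hω₁, bern₂_comm]
    have := ee_ne_zero (z / ω₁)
    field_simp
  have hB2 : ∀ z, B (z + ω₂) = B z := fun z => by
    simp only [hB]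
    rw [add_div, div_self hω₂, add_right_comm, theta₀_add_one]
  have hgood : ∀ z, (∀ a b : ℤ, z ≠ a * ω₁ + b * ω₂) →
      ThetaGood (z / ω₂ + -(ω₁ / ω₂)) (-(ω₁ / ω₂)) := fun z hz =>
    ⟨h'.ne', fun a b e => hz (1 - b) a (by
      push_cast
      field_simp at e
      linear_combination e)⟩
  obtain ⟨k, hk, hAB⟩ := exists_entire_quotient hAd hBd (fun z hz => by
    have hng : ¬ ThetaGood (z / ω₂ + -(ω₁ / ω₂)) (-(ω₁ / ω₂)) := fun hg => theta₀_ne_zero hg hz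
    have hd := (theta₀_simple_zero h' hng).2
    refine ⟨?_, ?_⟩
    · have : ¬ ThetaGood (z / ω₁) (ω₂ / ω₁) := by
        intro hg
        refine hng (hgood z fun a b e => hg.ne a b ?_)
        rw [e]
        field_simp
      rw [hA]
      dsimp only
      rw [(theta₀_simple_zero h this).1, zero_mul]
    · have := ((differentiable_theta₀ h' (z / ω₂ + -(ω₁ / ω₂))).hasDerivAt.comp z
        (((hasDerivAt_id z).div_const ω₂).add_const (-(ω₁ / ω₂)))).deriv
      change deriv B z = _ at this
      rw [this]
      exact mul_ne_zero hd (one_div_ne_zero hω₂))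
  obtain ⟨z₀, hz₀⟩ : ∃ z₀, B z₀ ≠ 0 := by
    by_contra! h0
    have h00 := (theta₀_simple_zero h' (z := 0) (fun hg => hg.ne 0 0 (by simp))).2
    refine h00 ?_
    have : (fun z => theta₀ z (-(ω₁ / ω₂))) = fun _ => 0 := by
      funext z
      have := h0 (z * ω₂ + ω₁)
      simp only [hB] at this
      rwa [show (z * ω₂ + ω₁) / ω₂ + -(ω₁ / ω₂) = z by field_simp; ring] at this
    rw [this]
    simp
  have hper : ∀ (e : ℂ → ℂ) (ω : ℂ), (∀ z, e z ≠ 0) → (∀ z, A (z + ω) = e z * A z) →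
      (∀ z, B (z + ω) = e z * B z) → ∀ z, k (z + ω) = k z := by
    intro e ω he hA hB z
    refine sub_eq_zero.1 (entire_eq_zero_of_mul (f := fun z => k (z + ω) - k z)
      ((hk.comp (differentiable_id.add_const ω)).sub hk) hBd (fun z => ?_) hz₀ z)
    have h1 := hAB (z + ω)
    rw [hA, hB, hAB] at h1
    refine (mul_eq_zero.1 (?_ : e z * _ = 0)).resolve_left (he z)
    linear_combination -h1
  have hconst := entire_const_of_periodic hk h.ne'
    (hper _ ω₁ (fun z => neg_ne_zero.2 (ee_ne_zero _)) hA1 hB1)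
    (hper (fun _ => 1) ω₂ (fun _ => one_ne_zero) (by simpa using hA2) (by simpa using hB2))
  refine ⟨k 0, fun z hz => ?_⟩
  have hBz : B z ≠ 0 := theta₀_ne_zero (hgood z hz)
  have e : theta₀ (z / ω₂) (ω₁ / ω₂) = (B z)⁻¹ := by
    have := theta₀_neg h'.ne' (z / ω₂)
    rwa [neg_neg] at this
  have e2 : thetaQuot z ω₁ ω₂ = A z * (B z)⁻¹ := by
    rw [thetaQuot, e]
    simp only [hA]
    ring
  rw [e2, hAB, mul_inv_cancel_right₀ hBz]
  exact hconst z 0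

theorem thetaQuot_const {ω₁ ω₂ : ℂ} (h : (ω₂ / ω₁).im ≠ 0) :
    ∃ c, ∀ z, (∀ a b : ℤ, z ≠ a * ω₁ + b * ω₂) → thetaQuot z ω₁ ω₂ = c := by
  rcases h.lt_or_gt with h | h
  · have h' : 0 < (ω₁ / ω₂).im := by
      have := im_inv_neg (τ := -(ω₂ / ω₁)) (by simpa using h)
      rwa [inv_neg, neg_neg, inv_div] at this
    obtain ⟨c, hc⟩ := thetaQuot_const_of_pos h'
    exact ⟨c, fun z hz => by
      rw [thetaQuot_comm]
      exact hc z fun a b e => hz b a (by rw [e, add_comm])⟩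
  · exact thetaQuot_const_of_pos h

end Theta

end EllGamma
end

noncomputable section

namespace EllGamma

open Filter Topology

/-! ### Gamma functions as quotients of entire functions. -/

section Quotients

/-- On `S`, the function `F` is the quotient of two entire functions without zeros on `S`. -/
def IsQuotOn (F : ℂ → ℂ) (S : Set ℂ) : Prop :=
  ∃ A B : ℂ → ℂ, Differentiable ℂ A ∧ Differentiable ℂ B ∧
    ∀ z ∈ S, A z ≠ 0 ∧ B z ≠ 0 ∧ F z = A z / B z

variable {F H : ℂ → ℂ} {S T : Set ℂ}

theorem IsQuotOn.mul (hF : IsQuotOn F S) (hH : IsQuotOn H S) : IsQuotOn (fun z => F z * H z) S := by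
  obtain ⟨A, B, hA, hB, h⟩ := hF
  obtain ⟨A', B', hA', hB', h'⟩ := hH
  refine ⟨fun z => A z * A' z, fun z => B z * B' z, hA.mul hA', hB.mul hB', fun z hz => ?_⟩
  obtain ⟨h1, h2, h3⟩ := h z hz
  obtain ⟨h1', h2', h3'⟩ := h' z hz
  exact ⟨mul_ne_zero h1 h1', mul_ne_zero h2 h2', by
    change F z * H z = A z * A' z / (B z * B' z)
    rw [h3, h3', div_mul_div_comm]⟩

theorem IsQuotOn.inv (hF : IsQuotOn F S) : IsQuotOn (fun z => (F z)⁻¹) S := by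
  obtain ⟨A, B, hA, hB, h⟩ := hF
  refine ⟨B, A, hB, hA, fun z hz => ?_⟩
  obtain ⟨h1, h2, h3⟩ := h z hz
  exact ⟨h2, h1, by
    change (F z)⁻¹ = B z / A z
    rw [h3, inv_div]⟩

theorem IsQuotOn.comp (hF : IsQuotOn F S) {φ : ℂ → ℂ} (hφ : Differentiable ℂ φ)
    (h : ∀ z ∈ T, φ z ∈ S) : IsQuotOn (fun z => F (φ z)) T := by
  obtain ⟨A, B, hA, hB, h'⟩ := hF
  exact ⟨A ∘ φ, B ∘ φ, hA.comp hφ, hB.comp hφ, fun z hz => h' _ (h z hz)⟩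

theorem IsQuotOn.of_entire (hF : Differentiable ℂ F) (h : ∀ z ∈ S, F z ≠ 0) : IsQuotOn F S :=
  ⟨F, fun _ => 1, hF, differentiable_const 1, fun z hz => ⟨h z hz, one_ne_zero, by rw [div_one]⟩⟩

theorem IsQuotOn.congr (hF : IsQuotOn F S) (h : ∀ z, H z = F z) : IsQuotOn H S := by
  rwa [show H = F from funext h]

theorem poch₂_isQuotOn {q r : ℂ} (hq0 : q ≠ 0) (hq : ‖q‖ ≠ 1) (hr0 : r ≠ 0) (hr : ‖r‖ ≠ 1)
    (hS : ∀ x ∈ S, poch₂ x q r ≠ 0) : IsQuotOn (fun x => poch₂ x q r) S := by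
  revert S
  refine norm_cases (P := fun q => ∀ {S : Set ℂ}, (∀ x ∈ S, poch₂ x q r ≠ 0) →
    IsQuotOn (fun x => poch₂ x q r) S) ?_ ?_ hq0 hq
  · intro q hq0 hq
    refine norm_cases (P := fun r => ∀ {S : Set ℂ}, (∀ x ∈ S, poch₂ x q r ≠ 0) →
      IsQuotOn (fun x => poch₂ x q r) S) ?_ ?_ hr0 hr
    · intro r hr0 hr S hS
      simp only [poch₂_of_lt hq hr] at hS ⊢
      exact IsQuotOn.of_entire (dprod_differentiable hq hr) hS
    · intro r hr0 hr ih S hS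
      simp only [poch₂_inv_right hr0 hr.ne, ne_eq, inv_eq_zero] at hS ⊢
      exact ((ih (S := {x | poch₂ x q r ≠ 0}) fun x hx => hx).comp (φ := fun x => r * x)
        (by fun_prop) hS).inv
  · intro q hq0 hq ih S hS
    simp only [poch₂_inv_left hq0 hq.ne, ne_eq, inv_eq_zero] at hS ⊢
    exact ((ih (S := {x | poch₂ x q r ≠ 0}) fun x hx => hx).comp (φ := fun x => q * x)
      (by fun_prop) hS).inv

theorem ellGamma_isQuotOn {τ σ : ℂ} (hτ : τ.im ≠ 0) (hσ : σ.im ≠ 0) :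
    IsQuotOn (fun z => ellGamma z τ σ) {z | GammaGood z τ σ} := by
  have h := poch₂_isQuotOn (S := {x | poch₂ x (ee τ) (ee σ) ≠ 0}) (ee_ne_zero τ)
    (norm_ee_ne_one hτ) (ee_ne_zero σ) (norm_ee_ne_one hσ) fun x hx => hx
  have h1 := h.comp (T := {z | GammaGood z τ σ}) (φ := fun z => ee (τ + σ - z))
    (differentiable_ee.comp (by fun_prop)) fun z hz => poch₂_ee_ne_zero hz.reflect
  have h2 := h.comp (T := {z | GammaGood z τ σ}) differentiable_ee fun z hz => poch₂_ee_ne_zero hz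
  exact (h1.mul h2.inv).congr fun z => by rw [ellGamma_eq, div_eq_mul_inv]

end Quotients

/-! ### The modular identities for `Γ` and `θ₀`. -/

section Modular

/-- Three periods that are independent over `ℤ` and pairwise independent over `ℝ`. -/
structure TripleGood (ω₁ ω₂ ω₃ : ℂ) : Prop where
  im₁₂ : (ω₂ / ω₁).im ≠ 0
  im₁₃ : (ω₃ / ω₁).im ≠ 0
  im₂₃ : (ω₃ / ω₂).im ≠ 0
  indep : ∀ a b c : ℤ, a * ω₁ + b * ω₂ + c * ω₃ = 0 → a = 0 ∧ b = 0 ∧ c = 0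

/-- The point `z` does not belong to the group generated by `ω₁, ω₂, ω₃`. -/
def Avoid (z ω₁ ω₂ ω₃ : ℂ) : Prop := ∀ a b c : ℤ, z ≠ a * ω₁ + b * ω₂ + c * ω₃

/-- The polynomial `B_{3,3}(z | ω₁, ω₂, ω₃)`. -/
def bern₃ (z ω₁ ω₂ ω₃ : ℂ) : ℂ :=
  (4 * z ^ 3 - 6 * (ω₁ + ω₂ + ω₃) * z ^ 2 +
    2 * (ω₁ ^ 2 + ω₂ ^ 2 + ω₃ ^ 2 + 3 * (ω₁ * ω₂ + ω₁ * ω₃ + ω₂ * ω₃)) * z -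
    (ω₁ + ω₂ + ω₃) * (ω₁ * ω₂ + ω₁ * ω₃ + ω₂ * ω₃)) / (4 * (ω₁ * ω₂ * ω₃))

/-- The product of three elliptic gamma functions in the modular identity. -/
def gammaProd (z ω₁ ω₂ ω₃ : ℂ) : ℂ :=
  ellGamma (z / ω₁) (ω₂ / ω₁) (ω₃ / ω₁) * ellGamma (z / ω₂) (ω₁ / ω₂) (ω₃ / ω₂) *
    ellGamma (z / ω₃) (ω₁ / ω₃) (ω₂ / ω₃)

/-- The product of elliptic gamma functions which equals `1` by modularity. -/
def gammaQuot (z ω₁ ω₂ ω₃ : ℂ) : ℂ :=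
  gammaProd z ω₁ ω₂ ω₃ * Complex.exp (Real.pi * Complex.I / 3 * bern₃ z ω₁ ω₂ ω₃)

variable {z ω₁ ω₂ ω₃ : ℂ}

theorem im_div_swap {a b : ℂ} (h : (a / b).im ≠ 0) : (b / a).im ≠ 0 := by
  rw [← inv_div, Complex.inv_im]
  refine div_ne_zero (neg_ne_zero.2 h) ?_
  rw [ne_eq, Complex.normSq_eq_zero]
  intro h0
  rw [h0] at h
  exact h rfl

theorem right_ne_zero_of_im {a b : ℂ} (h : (a / b).im ≠ 0) : b ≠ 0 := by
  rintro rfl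
  simp at h

namespace TripleGood

theorem ne₁ (h : TripleGood ω₁ ω₂ ω₃) : ω₁ ≠ 0 := right_ne_zero_of_im h.im₁₂
theorem ne₂ (h : TripleGood ω₁ ω₂ ω₃) : ω₂ ≠ 0 := right_ne_zero_of_im h.im₂₃
theorem ne₃ (h : TripleGood ω₁ ω₂ ω₃) : ω₃ ≠ 0 := right_ne_zero_of_im (im_div_swap h.im₂₃)

theorem swap₁₂ (h : TripleGood ω₁ ω₂ ω₃) : TripleGood ω₂ ω₁ ω₃ :=
  ⟨im_div_swap h.im₁₂, h.im₂₃, h.im₁₃, fun a b c e => by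
    obtain ⟨h1, h2, h3⟩ := h.indep b a c (by linear_combination e)
    exact ⟨h2, h1, h3⟩⟩

theorem swap₂₃ (h : TripleGood ω₁ ω₂ ω₃) : TripleGood ω₁ ω₃ ω₂ :=
  ⟨h.im₁₃, h.im₁₂, im_div_swap h.im₂₃, fun a b c e => by
    obtain ⟨h1, h2, h3⟩ := h.indep a c b (by linear_combination e)
    exact ⟨h1, h3, h2⟩⟩

theorem double₃ (h : TripleGood ω₁ ω₂ ω₃) : TripleGood ω₁ ω₂ (2 * ω₃) := by
  have key : ∀ a : ℂ, a.im ≠ 0 → (2 * a).im ≠ 0 := fun a ha => by simpa using ha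
  refine ⟨h.im₁₂, ?_, ?_, fun a b c e => ?_⟩
  · rw [mul_div_assoc]
    exact key _ h.im₁₃
  · rw [mul_div_assoc]
    exact key _ h.im₂₃
  · obtain ⟨h1, h2, h3⟩ := h.indep a b (2 * c) (by push_cast; linear_combination e)
    exact ⟨h1, h2, by omega⟩

end TripleGood

namespace Avoid

theorem swap₁₂ (h : Avoid z ω₁ ω₂ ω₃) : Avoid z ω₂ ω₁ ω₃ := fun a b c e =>
  h b a c (by linear_combination e)

theorem swap₂₃ (h : Avoid z ω₁ ω₂ ω₃) : Avoid z ω₁ ω₃ ω₂ := fun a b c e =>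
  h a c b (by linear_combination e)

theorem double₃ (h : Avoid z ω₁ ω₂ ω₃) : Avoid z ω₁ ω₂ (2 * ω₃) := fun a b c e =>
  h a b (2 * c) (by push_cast; linear_combination e)

theorem add (h : Avoid z ω₁ ω₂ ω₃) (l m n : ℤ) :
    Avoid (z + (l * ω₁ + m * ω₂ + n * ω₃)) ω₁ ω₂ ω₃ := fun a b c e =>
  h (a - l) (b - m) (c - n) (by push_cast; linear_combination e)

theorem add₃ (h : Avoid z ω₁ ω₂ ω₃) : Avoid (z + ω₃) ω₁ ω₂ ω₃ := by simpa using h.add 0 0 1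

theorem reflect (h : Avoid z ω₁ ω₂ ω₃) : Avoid (ω₁ + ω₂ + ω₃ - z) ω₁ ω₂ ω₃ := fun a b c e =>
  h (1 - a) (1 - b) (1 - c) (by push_cast; linear_combination -e)

theorem gamma₁ (h : Avoid z ω₁ ω₂ ω₃) (hω : TripleGood ω₁ ω₂ ω₃) :
    GammaGood (z / ω₁) (ω₂ / ω₁) (ω₃ / ω₁) :=
  ⟨hω.im₁₂, hω.im₁₃, fun a b c e => h a b c (by
    have := hω.ne₁
    field_simp at e
    linear_combination e)⟩

theorem gamma₂ (h : Avoid z ω₁ ω₂ ω₃) (hω : TripleGood ω₁ ω₂ ω₃) :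
    GammaGood (z / ω₂) (ω₁ / ω₂) (ω₃ / ω₂) := h.swap₁₂.gamma₁ hω.swap₁₂

theorem gamma₃ (h : Avoid z ω₁ ω₂ ω₃) (hω : TripleGood ω₁ ω₂ ω₃) :
    GammaGood (z / ω₃) (ω₁ / ω₃) (ω₂ / ω₃) := h.swap₂₃.swap₁₂.gamma₁ hω.swap₂₃.swap₁₂

theorem theta₁₂ (h : Avoid z ω₁ ω₂ ω₃) (a b : ℤ) : z ≠ a * ω₁ + b * ω₂ := fun e =>
  h a b 0 (by push_cast; linear_combination e)

end Avoid

theorem gammaQuot_swap₁₂ (z ω₁ ω₂ ω₃ : ℂ) : gammaQuot z ω₁ ω₂ ω₃ = gammaQuot z ω₂ ω₁ ω₃ := by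
  unfold gammaQuot gammaProd bern₃
  rw [mul_comm (ellGamma (z / ω₁) _ _), ellGamma_comm (z / ω₃)]
  congr 3
  ring

theorem gammaQuot_swap₂₃ (z ω₁ ω₂ ω₃ : ℂ) : gammaQuot z ω₁ ω₂ ω₃ = gammaQuot z ω₁ ω₃ ω₂ := by
  unfold gammaQuot gammaProd bern₃
  rw [mul_right_comm (ellGamma (z / ω₁) (ω₂ / ω₁) (ω₃ / ω₁)), ellGamma_comm (z / ω₁)]
  congr 3
  ring

theorem gammaQuot_ne_zero (hω : TripleGood ω₁ ω₂ ω₃) (h : Avoid z ω₁ ω₂ ω₃) :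
    gammaQuot z ω₁ ω₂ ω₃ ≠ 0 :=
  mul_ne_zero (mul_ne_zero (mul_ne_zero (ellGamma_ne_zero (h.gamma₁ hω))
    (ellGamma_ne_zero (h.gamma₂ hω))) (ellGamma_ne_zero (h.gamma₃ hω))) (Complex.exp_ne_zero _)

theorem ellGamma_add_right {z τ σ : ℂ} (h : GammaGood z τ σ) :
    ellGamma (z + σ) τ σ = theta₀ z τ * ellGamma z τ σ := by
  rw [ellGamma_comm, ellGamma_add_left h.symm, ellGamma_comm]

/-- The gamma factor with denominator `ω₃` is unchanged, the other two produce the two theta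
factors, and the cubic polynomial changes by three times the quadratic one. -/
theorem gammaQuot_add₃ (hω : TripleGood ω₁ ω₂ ω₃) (h : Avoid z ω₁ ω₂ ω₃) :
    gammaQuot (z + ω₃) ω₁ ω₂ ω₃ = thetaQuot z ω₁ ω₂ * gammaQuot z ω₁ ω₂ ω₃ := by
  have h1 := hω.ne₁
  have h2 := hω.ne₂
  have h3 := hω.ne₃
  have e : bern₃ (z + ω₃) ω₁ ω₂ ω₃ = 3 * bern₂ z ω₁ ω₂ + bern₃ z ω₁ ω₂ ω₃ := by
    unfold bern₃ bern₂
    field_simp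
    ring
  rw [gammaQuot, gammaProd, add_div, add_div, add_div, div_self h3, ellGamma_add_one,
    ellGamma_add_right (h.gamma₁ hω), ellGamma_add_right (h.gamma₂ hω), e, mul_add,
    Complex.exp_add, gammaQuot, gammaProd, thetaQuot,
    show Real.pi * Complex.I / 3 * (3 * bern₂ z ω₁ ω₂) = Real.pi * Complex.I * bern₂ z ω₁ ω₂ by ring]
  ring

theorem gammaQuot_reflect (hω : TripleGood ω₁ ω₂ ω₃) :
    gammaQuot (ω₁ + ω₂ + ω₃ - z) ω₁ ω₂ ω₃ = (gammaQuot z ω₁ ω₂ ω₃)⁻¹ := by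
  have h1 := hω.ne₁
  have h2 := hω.ne₂
  have h3 := hω.ne₃
  have e : bern₃ (ω₁ + ω₂ + ω₃ - z) ω₁ ω₂ ω₃ = -bern₃ z ω₁ ω₂ ω₃ := by
    unfold bern₃
    field_simp
    ring
  rw [gammaQuot, gammaProd, e,
    show (ω₁ + ω₂ + ω₃ - z) / ω₁ = ω₂ / ω₁ + ω₃ / ω₁ - z / ω₁ + 1 by field_simp; ring,
    show (ω₁ + ω₂ + ω₃ - z) / ω₂ = ω₁ / ω₂ + ω₃ / ω₂ - z / ω₂ + 1 by field_simp; ring,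
    show (ω₁ + ω₂ + ω₃ - z) / ω₃ = ω₁ / ω₃ + ω₂ / ω₃ - z / ω₃ + 1 by field_simp; ring,
    ellGamma_add_one, ellGamma_add_one, ellGamma_add_one, ellGamma_reflect, ellGamma_reflect,
    ellGamma_reflect, mul_neg, Complex.exp_neg, gammaQuot, gammaProd]
  simp only [mul_inv]

/-- The first two gamma factors split by doubling one period. In the third, `ω₃` is the denominator,
so the duplication of all three arguments is used instead. The cubic polynomial is additive in the
same way. -/
theorem gammaQuot_split (hω : TripleGood ω₁ ω₂ ω₃) (z : ℂ) :
    gammaQuot z ω₁ ω₂ ω₃ =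
      gammaQuot z ω₁ ω₂ (2 * ω₃) * gammaQuot (z + ω₃) ω₁ ω₂ (2 * ω₃) := by
  have h1 := hω.ne₁
  have h2 := hω.ne₂
  have h3 := hω.ne₃
  have e : bern₃ z ω₁ ω₂ ω₃ = bern₃ z ω₁ ω₂ (2 * ω₃) + bern₃ (z + ω₃) ω₁ ω₂ (2 * ω₃) := by
    unfold bern₃
    field_simp
    ring
  have i1 : (ω₁ / (2 * ω₃)).im ≠ 0 := im_div_swap hω.double₃.im₁₃
  have i2 : (ω₂ / (2 * ω₃)).im ≠ 0 := im_div_swap hω.double₃.im₂₃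
  have t := ellGamma_two_mul i1 i2 (z / (2 * ω₃))
  have d : ∀ a : ℂ, 2 * (a / (2 * ω₃)) = a / ω₃ := fun a => by field_simp
  rw [d, d, d] at t
  rw [gammaQuot, gammaProd, gammaQuot, gammaProd, gammaQuot, gammaProd, e, mul_add,
    Complex.exp_add, ellGamma_split hω.im₁₂ hω.im₁₃, ellGamma_split (im_div_swap hω.im₁₂) hω.im₂₃, t,
    ← add_div, ← add_div, ← mul_div_assoc, ← mul_div_assoc,
    show (z + ω₃) / (2 * ω₃) = z / (2 * ω₃) + 1 / 2 by field_simp]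
  ring

theorem thetaQuot_ne_zero (h : (ω₂ / ω₁).im ≠ 0) (hz : ∀ a b : ℤ, z ≠ a * ω₁ + b * ω₂) :
    thetaQuot z ω₁ ω₂ ≠ 0 := by
  have h1 := right_ne_zero_of_im h
  have h2 := right_ne_zero_of_im (im_div_swap h)
  refine mul_ne_zero (mul_ne_zero (theta₀_ne_zero ⟨h, fun a b e => hz a b ?_⟩)
    (theta₀_ne_zero ⟨im_div_swap h, fun a b e => hz b a ?_⟩)) (Complex.exp_ne_zero _)
  · field_simp at e
    linear_combination e
  · field_simp at e
    linear_combination e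

theorem thetaQuot_two_mul (z ω₁ ω₂ : ℂ) :
    thetaQuot (2 * z) (2 * ω₁) (2 * ω₂) = thetaQuot z ω₁ ω₂ := by
  have h : ∀ a b : ℂ, 2 * a / (2 * b) = a / b := fun a b => mul_div_mul_left a b two_ne_zero
  have e : bern₂ (2 * z) (2 * ω₁) (2 * ω₂) = bern₂ z ω₁ ω₂ := by
    unfold bern₂
    rw [show 6 * (2 * ω₁) * (2 * ω₂) = 4 * (6 * ω₁ * ω₂) by ring,
      ← mul_div_mul_left _ (6 * ω₁ * ω₂) (show (4 : ℂ) ≠ 0 by norm_num)]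
    congr 1
    ring
  rw [thetaQuot, h, h, h, h, e, thetaQuot]

/-- Shifting the splitting of `gammaQuot` by `ω₁` multiplies the left side by one theta constant and
the right side by two equal ones for the doubled period. -/
theorem thetaQuot_eq_sq (hω : TripleGood ω₁ ω₂ ω₃) (h : Avoid z ω₁ ω₂ ω₃) :
    thetaQuot z ω₂ ω₃ = thetaQuot z ω₂ (2 * ω₃) ^ 2 := by
  have add₁ : ∀ {z ω₁ ω₂ ω₃}, TripleGood ω₁ ω₂ ω₃ → Avoid z ω₁ ω₂ ω₃ →
      gammaQuot (z + ω₁) ω₁ ω₂ ω₃ = thetaQuot z ω₂ ω₃ * gammaQuot z ω₁ ω₂ ω₃ := by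
    intro z ω₁ ω₂ ω₃ hω h
    have := gammaQuot_add₃ hω.swap₁₂.swap₂₃ h.swap₁₂.swap₂₃
    rwa [gammaQuot_swap₂₃, gammaQuot_swap₁₂, gammaQuot_swap₂₃ z, gammaQuot_swap₁₂ z] at this
  have e1 := gammaQuot_split hω z
  have e2 := gammaQuot_split hω (z + ω₁)
  rw [add_right_comm, add₁ hω h, add₁ hω.double₃ h.double₃, add₁ hω.double₃ h.add₃.double₃, e1] at e2
  obtain ⟨c, hc⟩ := thetaQuot_const hω.double₃.im₂₃
  have n1 := gammaQuot_ne_zero hω.double₃ h.double₃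
  have n2 := gammaQuot_ne_zero hω.double₃ h.add₃.double₃
  rw [hc z h.double₃.swap₁₂.swap₂₃.theta₁₂, hc _ h.add₃.double₃.swap₁₂.swap₂₃.theta₁₂] at e2
  rw [hc z h.double₃.swap₁₂.swap₂₃.theta₁₂]
  refine mul_right_cancel₀ (mul_ne_zero n1 n2) ?_
  linear_combination e2

/-- Doubling the two periods one after the other squares twice, while doubling both leaves the
constant unchanged by homogeneity. Hence `t = t ^ 4` with `t ≠ 0`. -/
theorem thetaQuot_pow_three (hω : TripleGood ω₁ ω₂ ω₃) (h : Avoid z ω₁ ω₂ ω₃) :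
    thetaQuot z ω₂ ω₃ ^ 3 = 1 := by
  have e1 := thetaQuot_eq_sq hω h
  have e2 := thetaQuot_eq_sq hω.double₃.swap₂₃ h.double₃.swap₂₃
  have hd := hω.double₃.swap₂₃.double₃
  have hz := h.double₃.swap₂₃.double₃
  obtain ⟨c, hc⟩ := thetaQuot_const hd.im₂₃
  have hg := h.swap₁₂.swap₂₃.theta₁₂
  have e3 : thetaQuot z (2 * ω₃) (2 * ω₂) = thetaQuot z ω₂ ω₃ := by
    rw [thetaQuot_comm z ω₂, ← thetaQuot_two_mul z ω₃, hc z hz.swap₁₂.swap₂₃.theta₁₂, hc]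
    intro a b e
    exact hg b a (by linear_combination e / 2)
  rw [thetaQuot_comm z ω₂ (2 * ω₃), e2, e3] at e1
  have hne : thetaQuot z ω₂ ω₃ ≠ 0 := thetaQuot_ne_zero hω.im₂₃ hg
  refine mul_left_cancel₀ hne ?_
  linear_combination -e1

theorem gammaQuot_add_three_mul (hω : TripleGood ω₁ ω₂ ω₃) (h : Avoid z ω₁ ω₂ ω₃) :
    gammaQuot (z + 3 * ω₃) ω₁ ω₂ ω₃ = gammaQuot z ω₁ ω₂ ω₃ := by
  have hh := h.add₃
  have hhh := hh.add₃
  obtain ⟨c, hc⟩ := thetaQuot_const hω.im₁₂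
  have e := thetaQuot_pow_three hω.swap₂₃.swap₁₂ h.swap₂₃.swap₁₂
  rw [show z + 3 * ω₃ = z + ω₃ + ω₃ + ω₃ by ring, gammaQuot_add₃ hω hhh, gammaQuot_add₃ hω hh,
    gammaQuot_add₃ hω h, hc _ h.theta₁₂, hc _ hh.theta₁₂, hc _ hhh.theta₁₂]
  rw [hc _ h.theta₁₂] at e
  linear_combination gammaQuot z ω₁ ω₂ ω₃ * e

theorem gammaQuot_add_int_mul (hω : TripleGood ω₁ ω₂ ω₃) (n : ℤ) : ∀ {z}, Avoid z ω₁ ω₂ ω₃ →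
    gammaQuot (z + n * (3 * ω₃)) ω₁ ω₂ ω₃ = gammaQuot z ω₁ ω₂ ω₃ := by
  induction n using Int.induction_on with
  | zero => simp
  | succ n ih =>
    intro z h
    have h' := h.add 0 0 (3 * n)
    have e := gammaQuot_add_three_mul hω h'
    rw [show z + (((n : ℤ) + 1 : ℤ) : ℂ) * (3 * ω₃) =
      z + ((0 : ℤ) * ω₁ + (0 : ℤ) * ω₂ + ((3 * n : ℤ) : ℂ) * ω₃) + 3 * ω₃ by push_cast; ring, e,
      ← ih h]
    congr 1
    push_cast
    ring
  | pred n ih =>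
    intro z h
    have h' := h.add 0 0 (-3 * n - 3)
    have e := gammaQuot_add_three_mul hω h'
    rw [show z + ((-(n : ℤ) - 1 : ℤ) : ℂ) * (3 * ω₃) =
      z + ((0 : ℤ) * ω₁ + (0 : ℤ) * ω₂ + ((-3 * n - 3 : ℤ) : ℂ) * ω₃) by push_cast; ring, ← e,
      ← ih h]
    congr 1
    push_cast
    ring

theorem gammaQuot_add_lattice (hω : TripleGood ω₁ ω₂ ω₃) (h : Avoid z ω₁ ω₂ ω₃) (a b c : ℤ) :
    gammaQuot (z + (a * (3 * ω₁) + b * (3 * ω₂) + c * (3 * ω₃))) ω₁ ω₂ ω₃ =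
      gammaQuot z ω₁ ω₂ ω₃ := by
  have h1 := h.add (3 * a) 0 0
  have h2 := h.add (3 * a) (3 * b) 0
  have e3 := gammaQuot_add_int_mul hω c h2
  have e2 := gammaQuot_add_int_mul hω.swap₂₃ b h1.swap₂₃
  have e1 := gammaQuot_add_int_mul hω.swap₁₂.swap₂₃ a h.swap₁₂.swap₂₃
  simp only [gammaQuot_swap₂₃ _ ω₁ ω₃ ω₂] at e2
  simp only [gammaQuot_swap₂₃ _ ω₂ ω₃ ω₁, gammaQuot_swap₁₂ _ ω₂ ω₁ ω₃] at e1
  push_cast at e1 e2 e3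
  rw [show z + (a * (3 * ω₁) + b * (3 * ω₂) + c * (3 * ω₃)) =
    z + (3 * a * ω₁ + 3 * b * ω₂ + 0 * ω₃) + c * (3 * ω₃) by ring, e3,
    show z + (3 * a * ω₁ + 3 * b * ω₂ + 0 * ω₃) = z + (3 * a * ω₁ + 0 * ω₂ + 0 * ω₃) + b * (3 * ω₂)
      by ring, e2, show z + (3 * a * ω₁ + 0 * ω₂ + 0 * ω₃) = z + a * (3 * ω₁) by ring, e1]

/-- A group generated by three complex numbers independent over `ℤ` is not discrete. -/
theorem frequently_mem_lattice (hω : ∀ a b c : ℤ, a * ω₁ + b * ω₂ + c * ω₃ = 0 →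
    a = 0 ∧ b = 0 ∧ c = 0) : ∃ᶠ w in 𝓝[≠] (0 : ℂ), ∃ a b c : ℤ, w = a * ω₁ + b * ω₂ + c * ω₃ := by
  intro hn
  set L := Submodule.span ℤ (Set.range ![ω₁, ω₂, ω₃]) with hL
  have hmem : ∀ w, w ∈ L ↔ ∃ a b c : ℤ, w = a * ω₁ + b * ω₂ + c * ω₃ := by
    intro w
    rw [hL, Submodule.mem_span_range_iff_exists_fun]
    constructor
    · rintro ⟨c, rfl⟩
      exact ⟨c 0, c 1, c 2, by simp [Fin.sum_univ_three]⟩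
    · rintro ⟨a, b, c, rfl⟩
      exact ⟨![a, b, c], by simp [Fin.sum_univ_three]⟩
  have hd : DiscreteTopology L := by
    refine discreteTopology_of_isOpen_singleton_zero ?_
    obtain ⟨U, hU, ho, h0⟩ := mem_nhds_iff.1 (eventually_nhdsWithin_iff.1 hn)
    convert ho.preimage continuous_subtype_val using 1
    ext w
    refine ⟨?_, fun hw => ?_⟩
    · rintro rfl
      exact h0
    · by_contra hne
      exact hU hw (fun h => hne (Subtype.ext h)) ((hmem w).1 w.2)
  have hli : LinearIndependent ℤ ![ω₁, ω₂, ω₃] := by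
    rw [Fintype.linearIndependent_iff]
    intro g hg
    obtain ⟨h0, h1, h2⟩ := hω (g 0) (g 1) (g 2) (by simpa [Fin.sum_univ_three] using hg)
    intro i
    fin_cases i <;> assumption
  -- If the group were discrete, its rank three would equal the real dimension of its span in `ℂ`,
  -- which is at most two.
  have h1 := Real.finrank_eq_int_finrank_of_discrete hd
  rw [Set.finrank, Set.finrank, finrank_span_eq_card hli, Fintype.card_fin] at h1
  have h2 := Submodule.finrank_le (Submodule.span ℝ (Set.range ![ω₁, ω₂, ω₃]))
  rw [Complex.finrank_real_complex] at h2
  omega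

theorem gammaQuot_isQuotOn (hω : TripleGood ω₁ ω₂ ω₃) :
    IsQuotOn (fun z => gammaQuot z ω₁ ω₂ ω₃) {z | Avoid z ω₁ ω₂ ω₃} := by
  have h1 := (ellGamma_isQuotOn hω.im₁₂ hω.im₁₃).comp (T := {z | Avoid z ω₁ ω₂ ω₃})
    (φ := fun z => z / ω₁) (by fun_prop) fun z hz => Avoid.gamma₁ hz hω
  have h2 := (ellGamma_isQuotOn (im_div_swap hω.im₁₂) hω.im₂₃).comp (T := {z | Avoid z ω₁ ω₂ ω₃})
    (φ := fun z => z / ω₂) (by fun_prop) fun z hz => Avoid.gamma₂ hz hω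
  have h3 := (ellGamma_isQuotOn (im_div_swap hω.im₁₃) (im_div_swap hω.im₂₃)).comp
    (T := {z | Avoid z ω₁ ω₂ ω₃}) (φ := fun z => z / ω₃) (by fun_prop)
    fun z hz => Avoid.gamma₃ hz hω
  refine ((h1.mul h2).mul h3).mul (IsQuotOn.of_entire ?_ fun z _ => Complex.exp_ne_zero _)
  unfold bern₃
  fun_prop

/-- The periods `3 ω₁, 3 ω₂, 3 ω₃` generate a group accumulating at `0`. Written with entire
numerator and denominator, the equation `gammaQuot (z + v) = gammaQuot z` becomes the vanishing of
an entire function of `v`, and the identity theorem applies. -/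
theorem gammaQuot_const (hω : TripleGood ω₁ ω₂ ω₃) {w : ℂ} (h : Avoid z ω₁ ω₂ ω₃)
    (h' : Avoid w ω₁ ω₂ ω₃) : gammaQuot z ω₁ ω₂ ω₃ = gammaQuot w ω₁ ω₂ ω₃ := by
  obtain ⟨A, B, hA, hB, hAB⟩ := gammaQuot_isQuotOn hω
  have ha : AnalyticOnNhd ℂ (fun v => A (z + v) * B z - B (z + v) * A z) Set.univ := by
    have : Differentiable ℂ fun v => A (z + v) * B z - B (z + v) * A z :=
      ((hA.comp (differentiable_id.const_add z)).mul_const _).sub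
        ((hB.comp (differentiable_id.const_add z)).mul_const _)
    exact fun v _ => this.analyticAt v
  have hind : ∀ a b c : ℤ, a * (3 * ω₁) + b * (3 * ω₂) + c * (3 * ω₃) = 0 →
      a = 0 ∧ b = 0 ∧ c = 0 := fun a b c e => by
    obtain ⟨h1, h2, h3⟩ := hω.indep (3 * a) (3 * b) (3 * c) (by push_cast; linear_combination e)
    omega
  obtain ⟨h1, h2, h3⟩ := hAB z h
  have hf : ∃ᶠ v in 𝓝[≠] (0 : ℂ), A (z + v) * B z - B (z + v) * A z = 0 := by
    refine (frequently_mem_lattice hind).mono ?_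
    rintro _ ⟨a, b, c, rfl⟩
    have hv : Avoid (z + (a * (3 * ω₁) + b * (3 * ω₂) + c * (3 * ω₃))) ω₁ ω₂ ω₃ := by
      have := h.add (3 * a) (3 * b) (3 * c)
      push_cast at this
      convert this using 1
      ring
    obtain ⟨h1', h2', h3'⟩ := hAB _ hv
    have e := gammaQuot_add_lattice hω h a b c
    dsimp only at h3 h3'
    rw [h3, h3', div_eq_div_iff h2' h2] at e
    linear_combination e
  have := ha.eqOn_zero_of_preconnected_of_frequently_eq_zero isPreconnected_univ
    (Set.mem_univ 0) hf (Set.mem_univ (w - z))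
  simp only [add_sub_cancel, Pi.zero_apply] at this
  obtain ⟨h1', h2', h3'⟩ := hAB w h'
  dsimp only at h3 h3'
  rw [h3, h3', div_eq_div_iff h2 h2']
  linear_combination -this

/-- The modular property of the elliptic gamma function. -/
theorem gammaQuot_eq_one (hω : TripleGood ω₁ ω₂ ω₃) (h : Avoid z ω₁ ω₂ ω₃) :
    gammaQuot z ω₁ ω₂ ω₃ = 1 := by
  have hd := hω.double₃
  -- Reflection shows that the constant `c` of the triple with doubled `ω₃` satisfies `c = c⁻¹`; the
  -- splitting then gives `c * c = 1` for the original triple.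
  have e1 := gammaQuot_const hd h.double₃ h.double₃.reflect
  rw [gammaQuot_reflect hd] at e1
  have hne := gammaQuot_ne_zero hd h.double₃
  rw [gammaQuot_split hω, ← gammaQuot_const hd h.double₃ h.add₃.double₃]
  nth_rewrite 2 [e1]
  exact mul_inv_cancel₀ hne

/-- The modular property of the theta function. -/
theorem thetaQuot_eq_one (hω : TripleGood ω₁ ω₂ ω₃) (h : Avoid z ω₁ ω₂ ω₃) :
    thetaQuot z ω₁ ω₂ = 1 := by
  have := gammaQuot_add₃ hω h
  rwa [gammaQuot_eq_one hω h, gammaQuot_eq_one hω h.add₃, mul_one, eq_comm] at this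

end Modular

end EllGamma
end

noncomputable section

namespace EllGamma

open Filter Topology

/-! ### Joint holomorphy and nonvanishing of `θ₀` and `Γ`. -/

section Holomorphy

variable {V W : Type*} [NormedAddCommGroup V] [NormedSpace ℂ V] [NormedAddCommGroup W]
  [NormedSpace ℂ W] {F H : V → ℂ} {p : V}

/-- `F` is holomorphic and nowhere zero in a neighbourhood of `p`. -/
def HolNZ (F : V → ℂ) (p : V) : Prop := ∀ᶠ q in 𝓝 p, DifferentiableAt ℂ F q ∧ F q ≠ 0

theorem HolNZ.of_differentiableAt (h : ∀ᶠ q in 𝓝 p, DifferentiableAt ℂ F q) (h0 : F p ≠ 0) :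
    HolNZ F p := h.and (h.self_of_nhds.continuousAt.eventually_ne h0)

theorem HolNZ.mul (hF : HolNZ F p) (hH : HolNZ H p) : HolNZ (fun q => F q * H q) p := by
  filter_upwards [hF, hH] with q h h'
  exact ⟨h.1.mul h'.1, mul_ne_zero h.2 h'.2⟩

theorem HolNZ.inv (hF : HolNZ F p) : HolNZ (fun q => (F q)⁻¹) p := by
  filter_upwards [hF] with q h
  exact ⟨h.1.inv h.2, inv_ne_zero h.2⟩

theorem HolNZ.congr (hF : HolNZ F p) (h : H =ᶠ[𝓝 p] F) : HolNZ H p := by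
  filter_upwards [hF, h.eventuallyEq_nhds] with q hq he
  exact ⟨hq.1.congr_of_eventuallyEq he, he.self_of_nhds ▸ hq.2⟩

theorem HolNZ.comp {φ : W → V} {w : W} (hF : HolNZ F (φ w))
    (hφ : ∀ᶠ v in 𝓝 w, DifferentiableAt ℂ φ v) : HolNZ (fun v => F (φ v)) w := by
  filter_upwards [hφ.self_of_nhds.continuousAt.eventually hF, hφ] with v hv hd
  exact ⟨hv.1.comp v hd, hv.2⟩

theorem sprod_holNZ {t : ℂ × ℂ} (hq : ‖t.2‖ < 1) (h0 : sprod t.1 t.2 ≠ 0) :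
    HolNZ (fun t : ℂ × ℂ => sprod t.1 t.2) t := by
  refine .of_differentiableAt ?_ h0
  filter_upwards [(isOpen_lt (f := fun t : ℂ × ℂ => ‖t.2‖) (by fun_prop)
    continuous_const).mem_nhds hq] with s hs
  exact sprod_differentiableAt hs

theorem dprod_holNZ {t : ℂ × ℂ × ℂ} (hq : ‖t.2.1‖ < 1) (hr : ‖t.2.2‖ < 1)
    (h0 : dprod t.1 t.2.1 t.2.2 ≠ 0) :
    HolNZ (fun t : ℂ × ℂ × ℂ => dprod t.1 t.2.1 t.2.2) t := by
  refine .of_differentiableAt ?_ h0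
  filter_upwards [(isOpen_lt (f := fun t : ℂ × ℂ × ℂ => ‖t.2.1‖) (by fun_prop)
    continuous_const).mem_nhds hq, (isOpen_lt (f := fun t : ℂ × ℂ × ℂ => ‖t.2.2‖) (by fun_prop)
    continuous_const).mem_nhds hr] with s hs hs'
  exact dprod_differentiableAt hs hs'

theorem eventually_norm_ne_one {f : V → ℂ} (hf : ContinuousAt f p) (h0 : f p ≠ 0)
    (h1 : ‖f p‖ ≠ 1) : ∀ᶠ q in 𝓝 p, f q ≠ 0 ∧ ‖f q‖ ≠ 1 :=
  (hf.eventually_ne h0).and (hf.norm.eventually_ne h1)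

theorem poch_holNZ {x q : ℂ} (hq0 : q ≠ 0) (hq : ‖q‖ ≠ 1) (h : poch x q ≠ 0) :
    HolNZ (fun t : ℂ × ℂ => poch t.1 t.2) (x, q) := by
  revert h x
  refine norm_cases (P := fun q => ∀ {x}, poch x q ≠ 0 →
    HolNZ (fun t : ℂ × ℂ => poch t.1 t.2) (x, q)) ?_ ?_ hq0 hq
  · intro q hq0 hq x h
    rw [poch_of_lt hq] at h
    refine (sprod_holNZ (t := (x, q)) hq h).congr ?_
    filter_upwards [(isOpen_lt (f := fun t : ℂ × ℂ => ‖t.2‖) (by fun_prop)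
      continuous_const).mem_nhds hq] with s hs
    exact poch_of_lt hs
  · intro q hq0 hq ih x h
    rw [poch_inv hq0 hq.ne, ne_eq, inv_eq_zero] at h
    have e := eventually_norm_ne_one (p := (x, q⁻¹)) (f := Prod.snd) (by fun_prop)
      (inv_ne_zero hq0) (norm_inv_ne_one hq.ne)
    refine (HolNZ.comp (φ := fun t : ℂ × ℂ => (t.2⁻¹ * t.1, t.2⁻¹)) (w := (x, q⁻¹))
      (F := fun t : ℂ × ℂ => poch t.1 t.2) ?_ ?_).inv.congr ?_
    · simpa only [inv_inv] using ih h
    · filter_upwards [e] with s hs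
      have := hs.1
      fun_prop (disch := assumption)
    · filter_upwards [e] with s hs
      have := poch_inv (x := s.1) (inv_ne_zero hs.1) (norm_inv_ne_one hs.2)
      rwa [inv_inv] at this

theorem poch₂_holNZ {x q r : ℂ} (hq0 : q ≠ 0) (hq : ‖q‖ ≠ 1) (hr0 : r ≠ 0) (hr : ‖r‖ ≠ 1)
    (h : poch₂ x q r ≠ 0) :
    HolNZ (fun t : ℂ × ℂ × ℂ => poch₂ t.1 t.2.1 t.2.2) (x, q, r) := by
  revert h x
  refine norm_cases (P := fun q => ∀ {x}, poch₂ x q r ≠ 0 →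
    HolNZ (fun t : ℂ × ℂ × ℂ => poch₂ t.1 t.2.1 t.2.2) (x, q, r)) ?_ ?_ hq0 hq
  · intro q hq0 hq
    refine norm_cases (P := fun r => ∀ {x}, poch₂ x q r ≠ 0 →
      HolNZ (fun t : ℂ × ℂ × ℂ => poch₂ t.1 t.2.1 t.2.2) (x, q, r)) ?_ ?_ hr0 hr
    · intro r hr0 hr x h
      rw [poch₂_of_lt hq hr] at h
      refine (dprod_holNZ (t := (x, q, r)) hq hr h).congr ?_
      filter_upwards [(isOpen_lt (f := fun t : ℂ × ℂ × ℂ => ‖t.2.1‖) (by fun_prop)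
        continuous_const).mem_nhds hq, (isOpen_lt (f := fun t : ℂ × ℂ × ℂ => ‖t.2.2‖) (by fun_prop)
        continuous_const).mem_nhds hr] with s hs hs'
      exact poch₂_of_lt hs hs'
    · intro r hr0 hr ih x h
      rw [poch₂_inv_right hr0 hr.ne, ne_eq, inv_eq_zero] at h
      have e := eventually_norm_ne_one (p := (x, q, r⁻¹)) (f := fun t => t.2.2) (by fun_prop)
        (inv_ne_zero hr0) (norm_inv_ne_one hr.ne)
      refine (HolNZ.comp (φ := fun t : ℂ × ℂ × ℂ => (t.2.2⁻¹ * t.1, t.2.1, t.2.2⁻¹))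
        (w := (x, q, r⁻¹)) (F := fun t : ℂ × ℂ × ℂ => poch₂ t.1 t.2.1 t.2.2) ?_ ?_).inv.congr ?_
      · simpa only [inv_inv] using ih h
      · filter_upwards [e] with s hs
        have := hs.1
        fun_prop (disch := assumption)
      · filter_upwards [e] with s hs
        have := poch₂_inv_right (x := s.1) (q := s.2.1) (inv_ne_zero hs.1) (norm_inv_ne_one hs.2)
        rwa [inv_inv] at this
  · intro q hq0 hq ih x h
    rw [poch₂_inv_left hq0 hq.ne, ne_eq, inv_eq_zero] at h
    have e := eventually_norm_ne_one (p := (x, q⁻¹, r)) (f := fun t => t.2.1) (by fun_prop)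
      (inv_ne_zero hq0) (norm_inv_ne_one hq.ne)
    refine (HolNZ.comp (φ := fun t : ℂ × ℂ × ℂ => (t.2.1⁻¹ * t.1, t.2.1⁻¹, t.2.2))
      (w := (x, q⁻¹, r)) (F := fun t : ℂ × ℂ × ℂ => poch₂ t.1 t.2.1 t.2.2) ?_ ?_).inv.congr ?_
    · simpa only [inv_inv] using ih h
    · filter_upwards [e] with s hs
      have := hs.1
      fun_prop (disch := assumption)
    · filter_upwards [e] with s hs
      have := poch₂_inv_left (x := s.1) (r := s.2.2) (inv_ne_zero hs.1) (norm_inv_ne_one hs.2)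
      rwa [inv_inv] at this

theorem differentiableAt_ee_comp {f : V → ℂ} (hf : DifferentiableAt ℂ f p) :
    DifferentiableAt ℂ (fun v => ee (f v)) p :=
  (differentiable_ee _).comp p hf

variable {a b c : V → ℂ}

theorem theta₀_holNZ (h : ThetaGood (a p) (b p)) (ha : ∀ᶠ v in 𝓝 p, DifferentiableAt ℂ a v)
    (hb : ∀ᶠ v in 𝓝 p, DifferentiableAt ℂ b v) : HolNZ (fun v => theta₀ (a v) (b v)) p := by
  have hq := ee_ne_zero (b p)
  have hq' := norm_ee_ne_one h.im
  have key : ∀ d : V → ℂ, (∀ᶠ v in 𝓝 p, DifferentiableAt ℂ d v) → ThetaGood (d p) (b p) →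
      HolNZ (fun v => poch (ee (d v)) (ee (b v))) p := fun d hd hg =>
    HolNZ.comp (φ := fun v => (ee (d v), ee (b v))) (F := fun t : ℂ × ℂ => poch t.1 t.2)
      (poch_holNZ hq hq' (poch_ne_zero hq hq' hg.mul_ne_one)) (by
        filter_upwards [hd, hb] with v h1 h2
        exact (differentiableAt_ee_comp h1).prodMk (differentiableAt_ee_comp h2))
  refine ((key a ha h).mul (key (fun v => b v - a v) ?_ h.reflect)).congr
    (Eventually.of_forall fun v => theta₀_eq _ _)
  filter_upwards [ha, hb] with v h1 h2
  exact h2.sub h1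

theorem ellGamma_holNZ (h : GammaGood (a p) (b p) (c p))
    (ha : ∀ᶠ v in 𝓝 p, DifferentiableAt ℂ a v) (hb : ∀ᶠ v in 𝓝 p, DifferentiableAt ℂ b v)
    (hc : ∀ᶠ v in 𝓝 p, DifferentiableAt ℂ c v) :
    HolNZ (fun v => ellGamma (a v) (b v) (c v)) p := by
  have key : ∀ d : V → ℂ, (∀ᶠ v in 𝓝 p, DifferentiableAt ℂ d v) → GammaGood (d p) (b p) (c p) →
      HolNZ (fun v => poch₂ (ee (d v)) (ee (b v)) (ee (c v))) p := fun d hd hg =>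
    HolNZ.comp (φ := fun v => (ee (d v), ee (b v), ee (c v)))
      (F := fun t : ℂ × ℂ × ℂ => poch₂ t.1 t.2.1 t.2.2)
      (poch₂_holNZ (ee_ne_zero _) (norm_ee_ne_one h.im_left) (ee_ne_zero _)
        (norm_ee_ne_one h.im_right) (poch₂_ee_ne_zero hg)) (by
        filter_upwards [hd, hb, hc] with v h1 h2 h3
        exact (differentiableAt_ee_comp h1).prodMk
          ((differentiableAt_ee_comp h2).prodMk (differentiableAt_ee_comp h3)))
  refine ((key (fun v => b v + c v - a v) ?_ h.reflect).mul (key a ha h).inv).congr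
    (Eventually.of_forall fun v => ?_)
  · filter_upwards [ha, hb, hc] with v h1 h2 h3
    exact (h2.add h3).sub h1
  · dsimp only
    rw [ellGamma_eq, div_eq_mul_inv]

/-- The invertible analytic function defined by a function that is holomorphic and nonzero near
the points of a dense set. -/
def InvPair.ofHolNZ (F : X → ℂ) {D : Set X} (hD : Dense D) (h : ∀ p ∈ D, HolNZ F p) : InvPair where
  toFun := F
  dom := {p | HolNZ F p}
  isOpen_dom := isOpen_iff_mem_nhds.2 fun _ hp => eventually_eventually_nhds.2 hp
  dense_dom := hD.mono h
  holo := fun _ hp => (Eventually.self_of_nhds hp).1.differentiableWithinAt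
  ne_zero := fun _ hp => (Eventually.self_of_nhds hp).2

theorem InvFun.IsClassOf.eq_of_dense {a b : InvFun} {F H : X → ℂ} (ha : a.IsClassOf F)
    (hb : b.IsClassOf H) {D : Set X} (hD : Dense D) (h : Set.EqOn F H D) : a = b := by
  obtain ⟨f, rfl, hf⟩ := ha
  obtain ⟨g, rfl, hg⟩ := hb
  exact InvFun.mk_eq.2 (InvPair.agree_of_dense hD fun p hp => by
    rw [hf hp.2.1, hg hp.2.2, h hp.1])

end Holomorphy

/-! ### Generic points of `X`. -/

section Generic

/-- The linear form on `ℂ³` with the given integral coefficients. -/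
def lin (a : Fin 3 → ℤ) (x : Fin 3 → ℂ) : ℂ := a 0 * x 0 + a 1 * x 1 + a 2 * x 2

theorem lin_add_smul (a : Fin 3 → ℤ) (x v : Fin 3 → ℂ) (t : ℂ) :
    lin a (x + t • v) = lin a x + t * lin a v := by
  simp only [lin, Pi.add_apply, Pi.smul_apply, smul_eq_mul]
  ring

theorem continuous_lin (a : Fin 3 → ℤ) : Continuous (lin a) := by
  unfold lin
  fun_prop

/-- A point of `X` without linear relations over `ℤ` between its coordinates, such that the
quotients of independent integral linear forms in `x₁, x₂, x₃` are not real. -/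
structure Generic (p : X) : Prop where
  indep : ∀ (k : ℤ) (a : Fin 3 → ℤ), k * p.1 + lin a p.2 = 0 → k = 0 ∧ a = 0
  im : ∀ a b : Fin 3 → ℤ, ∀ i j, a i * b j - a j * b i ≠ 0 →
    (lin a p.2 * (starRingEnd ℂ) (lin b p.2)).im ≠ 0

/-- A real function whose restrictions to suitable lines are monic quadratic polynomials vanishes
only on a nowhere dense set. -/
theorem dense_ne_zero_of_quadratic {V : Type*} [NormedAddCommGroup V] [NormedSpace ℝ V]
    {φ : V → ℝ} (h : ∀ p, ∃ v c d, ∀ t : ℝ, φ (p + t • v) = t ^ 2 + c * t + d) :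
    Dense {p | φ p ≠ 0} := by
  intro p
  rw [mem_closure_iff_frequently]
  intro hn
  obtain ⟨v, c, d, hq⟩ := h p
  have hc : Tendsto (fun t : ℝ => p + t • v) (𝓝 0) (𝓝 p) := by
    have : Continuous fun t : ℝ => p + t • v := by fun_prop
    simpa using this.tendsto 0
  obtain ⟨ε, hε, he⟩ := Metric.eventually_nhds_iff.1 (hc.eventually hn)
  have key : ∀ t : ℝ, |t| < ε → t ^ 2 + c * t + d = 0 := fun t ht => by
    rw [← hq]
    have := he (y := t) (by simpa using ht)
    simpa using this
  have h0 := key 0 (by simpa using hε)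
  have h1 := key (ε / 2) (by rw [abs_of_pos (by positivity)]; linarith)
  have h2 := key (-(ε / 2)) (by rw [abs_neg, abs_of_pos (by positivity)]; linarith)
  nlinarith

/-- Baire's theorem for countably many open dense conditions. Each condition is the nonvanishing of
a real function that is a monic quadratic polynomial along a suitable line; conjugates replace
quotients in `Generic.im` so that these functions are continuous everywhere. -/
theorem dense_generic : Dense {p : X | Generic p} := by
  have h1 : ∀ s : {s : ℤ × (Fin 3 → ℤ) // ¬(s.1 = 0 ∧ s.2 = 0)},
      Dense {p : X | Complex.normSq (s.1.1 * p.1 + lin s.1.2 p.2) ≠ 0} := by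
    rintro ⟨⟨k, a⟩, hs⟩
    refine dense_ne_zero_of_quadratic fun p => ?_
    obtain ⟨v, hv⟩ : ∃ v : X, k * v.1 + lin a v.2 = 1 := by
      by_cases hk : k = 0
      · obtain ⟨i, hi⟩ : ∃ i, a i ≠ 0 := by
          by_contra! hn
          exact hs ⟨hk, funext hn⟩
        refine ⟨(0, Pi.single i (a i : ℂ)⁻¹), ?_⟩
        have : (a i : ℂ) ≠ 0 := by exact_mod_cast hi
        fin_cases i <;> simp_all [lin]
      · refine ⟨((k : ℂ)⁻¹, 0), ?_⟩
        have : (k : ℂ) ≠ 0 := by exact_mod_cast hk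
        simp [lin, this]
    refine ⟨v, 2 * (k * p.1 + lin a p.2).re, Complex.normSq (k * p.1 + lin a p.2), fun t => ?_⟩
    have e : (k : ℂ) * (p + t • v).1 + lin a (p + t • v).2 = (k * p.1 + lin a p.2) + t := by
      have : (p + t • v).2 = p.2 + (t : ℂ) • v.2 := by
        ext i
        simp
      rw [this, lin_add_smul]
      simp only [Prod.fst_add, Prod.smul_fst, Complex.real_smul]
      linear_combination (t : ℂ) * hv
    dsimp only
    rw [e]
    generalize (k * p.1 + lin a p.2 : ℂ) = w
    simp only [Complex.normSq_apply, Complex.add_re, Complex.add_im, Complex.ofReal_re,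
      Complex.ofReal_im]
    ring
  have h2 : ∀ s : {s : (Fin 3 → ℤ) × (Fin 3 → ℤ) × Fin 3 × Fin 3 //
      s.1 s.2.2.1 * s.2.1 s.2.2.2 - s.1 s.2.2.2 * s.2.1 s.2.2.1 ≠ 0},
      Dense {p : X | (lin s.1.1 p.2 * (starRingEnd ℂ) (lin s.1.2.1 p.2)).im ≠ 0} := by
    rintro ⟨⟨a, b, i, j⟩, hs⟩
    dsimp only at hs ⊢
    refine dense_ne_zero_of_quadratic fun p => ?_
    -- With these values the coefficient of `t ^ 2` is the imaginary part of `I`. The vector comes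
    -- from Cramer's rule for the nonzero minor in columns `i, j`.
    obtain ⟨v, hv, hv'⟩ : ∃ v : Fin 3 → ℂ, lin a v = Complex.I ∧ lin b v = 1 := by
      have hm : (a i * b j - a j * b i : ℂ) ≠ 0 := by exact_mod_cast hs
      have hl : ∀ (c : Fin 3 → ℤ) (α β : ℂ), lin c (Pi.single i α + Pi.single j β) =
          c i * α + c j * β := by
        intro c α β
        fin_cases i <;> fin_cases j <;> simp [lin] <;> ring
      refine ⟨Pi.single i ((Complex.I * b j - a j) / (a i * b j - a j * b i)) +
        Pi.single j ((a i - Complex.I * b i) / (a i * b j - a j * b i)), ?_, ?_⟩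
      · rw [hl]
        field_simp
        ring
      · rw [hl, ← mul_div_assoc, ← mul_div_assoc, ← add_div, div_eq_one_iff_eq hm]
        ring
    refine ⟨(0, v), (lin a p.2).im + (lin b p.2).re,
      (lin a p.2 * (starRingEnd ℂ) (lin b p.2)).im, fun t => ?_⟩
    have e : (p + t • ((0, v) : X)).2 = p.2 + (t : ℂ) • v := by
      ext i
      simp
    rw [e, lin_add_smul, lin_add_smul, hv, hv']
    generalize lin a p.2 = w
    generalize lin b p.2 = u
    simp
    ring
  have key := (dense_iInter_of_isOpen (fun s => isOpen_ne_fun (by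
      have := continuous_lin s.1.2
      fun_prop) continuous_const) h1).inter_of_Gδ
    (.iInter_of_isOpen fun s => isOpen_ne_fun (by
      have := continuous_lin s.1.2
      fun_prop) continuous_const) (.iInter_of_isOpen fun s => isOpen_ne_fun (by
      have := continuous_lin s.1.1
      have := continuous_lin s.1.2.1
      fun_prop) continuous_const)
    (dense_iInter_of_isOpen (fun s => isOpen_ne_fun (by
      have := continuous_lin s.1.1
      have := continuous_lin s.1.2.1
      fun_prop) continuous_const) h2)
  refine key.mono fun p hp => ⟨fun k a e => ?_, fun a b i j hij => ?_⟩
  · by_contra hn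
    have := Set.mem_iInter.1 hp.1 ⟨(k, a), hn⟩
    simp [e] at this
  · exact Set.mem_iInter.1 hp.2 ⟨(a, b, i, j), hij⟩

namespace Generic

variable {p : X} {A B C : Fin 3 → ℤ}

theorem div_im (hp : Generic p) (i j : Fin 3) (h : A i * B j - A j * B i ≠ 0) :
    (lin A p.2 / lin B p.2).im ≠ 0 := by
  have hi := hp.im A B i j h
  intro h0
  refine hi ?_
  by_cases hb : lin B p.2 = 0
  · simp [hb]
  · have e := div_mul_cancel₀ (lin A p.2) hb
    rw [← e, mul_assoc, Complex.mul_conj, Complex.im_mul_ofReal, h0, zero_mul]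

/-- The determinant of three vectors in `ℤ³`. -/
def det₃ (A B C : Fin 3 → ℤ) : ℤ :=
  A 0 * (B 1 * C 2 - B 2 * C 1) - A 1 * (B 0 * C 2 - B 2 * C 0) + A 2 * (B 0 * C 1 - B 1 * C 0)

theorem det₃_rotate : det₃ A B C = det₃ B C A := by
  unfold det₃
  ring

theorem det₃_swap : det₃ A B C = -det₃ A C B := by
  unfold det₃
  ring

theorem div_im_of_det (hp : Generic p) (h : det₃ A B C ≠ 0) : (lin B p.2 / lin A p.2).im ≠ 0 := by
  by_contra h0
  have key : ∀ i j, B i * A j - B j * A i = 0 := fun i j => by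
    by_contra hij
    exact hp.div_im i j hij h0
  refine h ?_
  unfold det₃
  linear_combination -C 2 * key 0 1 - C 0 * key 1 2 + C 1 * key 0 2

/-- A nonzero determinant makes the three forms pairwise independent, which gives the conditions on
imaginary parts. A relation over `ℤ` between their values is a relation between the forms, which
Cramer's rule excludes. -/
theorem tripleGood (hp : Generic p) (h : det₃ A B C ≠ 0) :
    TripleGood (lin A p.2) (lin B p.2) (lin C p.2) := by
  refine ⟨hp.div_im_of_det h, hp.div_im_of_det (C := B) ?_, hp.div_im_of_det (C := A) ?_,
    fun a b c e => ?_⟩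
  · rwa [det₃_swap, neg_ne_zero]
  · rwa [← det₃_rotate]
  · have e' := (hp.indep 0 (a • A + b • B + c • C) (by
      rw [← e]
      simp only [lin, Pi.add_apply, Pi.smul_apply, smul_eq_mul]
      push_cast
      ring)).2
    have k : ∀ i, a * A i + b * B i + c * C i = 0 := fun i => by simpa using congrFun e' i
    refine ⟨(mul_eq_zero.1 ?_).resolve_right h, (mul_eq_zero.1 ?_).resolve_right h,
      (mul_eq_zero.1 ?_).resolve_right h⟩
    · unfold det₃
      linear_combination (B 1 * C 2 - B 2 * C 1) * k 0 - (B 0 * C 2 - B 2 * C 0) * k 1 +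
        (B 0 * C 1 - B 1 * C 0) * k 2
    · unfold det₃
      linear_combination (C 1 * A 2 - C 2 * A 1) * k 0 - (C 0 * A 2 - C 2 * A 0) * k 1 +
        (C 0 * A 1 - C 1 * A 0) * k 2
    · unfold det₃
      linear_combination (A 1 * B 2 - A 2 * B 1) * k 0 - (A 0 * B 2 - A 2 * B 0) * k 1 +
        (A 0 * B 1 - A 1 * B 0) * k 2

theorem avoid (hp : Generic p) (k A B C : Fin 3 → ℤ) :
    Avoid (p.1 + lin k p.2) (lin A p.2) (lin B p.2) (lin C p.2) := fun a b c e => by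
  refine one_ne_zero (hp.indep 1 (k - a • A - b • B - c • C) ?_).1
  simp only [lin, Pi.sub_apply, Pi.smul_apply, smul_eq_mul] at e ⊢
  push_cast
  linear_combination e

theorem gammaGood (hp : Generic p) (k : Fin 3 → ℤ) (h : det₃ A B C ≠ 0) :
    GammaGood ((p.1 + lin k p.2) / lin A p.2) (lin B p.2 / lin A p.2) (lin C p.2 / lin A p.2) :=
  (hp.avoid k A B C).gamma₁ (hp.tripleGood h)

theorem ne_zero (hp : Generic p) (i : Fin 3) : p.2 i ≠ 0 := by
  intro h
  have := (hp.indep 0 (Pi.single i 1) (by fin_cases i <;> simpa [lin] using h)).2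
  simpa using congrFun this i

end Generic

end Generic

/-! ### The three elements of `N`. -/

section Elements

/-- The element of `N` given by a homogeneous function. -/
def N.ofFun (F : X → ℂ) (h : ∀ p, Generic p → HolNZ F p)
    (hd : ∀ (c : ℂ), c ≠ 0 → ∀ z x, F (c * z, c • x) = F (z, x)) : N :=
  ⟨InvFun.mk (InvPair.ofHolNZ F dense_generic h), fun c =>
    InvFun.mk_eq.2 fun p _ => hd c c.ne_zero p.1 p.2⟩

theorem N.ofFun_isClassOf (F : X → ℂ) (h : ∀ p, Generic p → HolNZ F p)
    (hd : ∀ (c : ℂ), c ≠ 0 → ∀ z x, F (c * z, c • x) = F (z, x)) :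
    (N.ofFun F h hd : InvFun).IsClassOf F := ⟨_, rfl, fun _ _ => rfl⟩

variable {p : X}

theorem eventually_differentiableAt_div {f g : X → ℂ} (hf : Differentiable ℂ f)
    (hg : Differentiable ℂ g) (h : g p ≠ 0) : ∀ᶠ q in 𝓝 p, DifferentiableAt ℂ (fun q => f q / g q) q := by
  filter_upwards [hg.continuous.continuousAt.eventually_ne h] with q hq
  simp only [div_eq_mul_inv]
  exact (hf q).mul ((hg q).inv hq)

/-- The value of the cocycle at `e_{1,2}`. -/
def fU (p : X) : ℂ :=
  (ellGamma ((p.1 - p.2 1) / p.2 2) ((p.2 0 - p.2 1) / p.2 2) (-(p.2 0 / p.2 2)))⁻¹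

/-- The value of the cocycle at `e_{3,2}`. -/
def fV (p : X) : ℂ := ellGamma (p.1 / p.2 0) ((p.2 1 - p.2 2) / p.2 0) (p.2 2 / p.2 0)

/-- The value of the cocycle at `t_2`. -/
def fT (p : X) : ℂ := theta₀ ((p.1 - p.2 1) / p.2 0) (p.2 2 / p.2 0)

theorem fU_holNZ (hp : Generic p) : HolNZ fU p := by
  refine (ellGamma_holNZ ?_ ?_ ?_ ?_).inv
  · have := hp.gammaGood (A := ![0, 0, 1]) (B := ![1, -1, 0]) (C := ![-1, 0, 0]) ![0, -1, 0]
      (by decide)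
    simpa [lin, ← sub_eq_add_neg, neg_div] using this
  · exact eventually_differentiableAt_div (by fun_prop) (by fun_prop) (hp.ne_zero 2)
  · exact eventually_differentiableAt_div (by fun_prop) (by fun_prop) (hp.ne_zero 2)
  · filter_upwards [eventually_differentiableAt_div (f := fun p : X => p.2 0)
      (g := fun p : X => p.2 2) (by fun_prop) (by fun_prop) (hp.ne_zero 2)] with q hq
    exact hq.neg

theorem fV_holNZ (hp : Generic p) : HolNZ fV p := by
  refine ellGamma_holNZ ?_ ?_ ?_ ?_
  · have := hp.gammaGood (A := ![1, 0, 0]) (B := ![0, 1, -1]) (C := ![0, 0, 1]) 0 (by decide)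
    simpa [lin, ← sub_eq_add_neg] using this
  · exact eventually_differentiableAt_div (by fun_prop) (by fun_prop) (hp.ne_zero 0)
  · exact eventually_differentiableAt_div (by fun_prop) (by fun_prop) (hp.ne_zero 0)
  · exact eventually_differentiableAt_div (by fun_prop) (by fun_prop) (hp.ne_zero 0)

theorem fT_holNZ (hp : Generic p) : HolNZ fT p := by
  refine theta₀_holNZ ?_ ?_ ?_
  · have := (hp.gammaGood (A := ![1, 0, 0]) (B := ![0, 1, 0]) (C := ![0, 0, 1]) ![0, -1, 0]
      (by decide)).theta_right
    simpa [lin, ← sub_eq_add_neg] using this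
  · exact eventually_differentiableAt_div (by fun_prop) (by fun_prop) (hp.ne_zero 0)
  · exact eventually_differentiableAt_div (by fun_prop) (by fun_prop) (hp.ne_zero 0)

theorem fU_dilation (c : ℂ) (hc : c ≠ 0) (z : ℂ) (x : Fin 3 → ℂ) :
    fU (c * z, c • x) = fU (z, x) := by
  simp only [fU, Pi.smul_apply, smul_eq_mul, ← mul_sub, mul_div_mul_left _ _ hc]

theorem fV_dilation (c : ℂ) (hc : c ≠ 0) (z : ℂ) (x : Fin 3 → ℂ) :
    fV (c * z, c • x) = fV (z, x) := by
  simp only [fV, Pi.smul_apply, smul_eq_mul, ← mul_sub, mul_div_mul_left _ _ hc]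

theorem fT_dilation (c : ℂ) (hc : c ≠ 0) (z : ℂ) (x : Fin 3 → ℂ) :
    fT (c * z, c • x) = fT (z, x) := by
  simp only [fT, Pi.smul_apply, smul_eq_mul, ← mul_sub, mul_div_mul_left _ _ hc]

/-- The value at `e_{1,2}` of a cochain lifting the cocycle to `N`. -/
def U : N := N.ofFun fU (fun _ => fU_holNZ) fU_dilation

/-- The value at `e_{3,2}` of a cochain lifting the cocycle to `N`. -/
def V : N := N.ofFun fV (fun _ => fV_holNZ) fV_dilation

/-- The value at `t_2` of a cochain lifting the cocycle to `N`. -/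
def T : N := N.ofFun fT (fun _ => fT_holNZ) fT_dilation

theorem U_isClassOf : (U : InvFun).IsClassOf fU := N.ofFun_isClassOf _ _ _
theorem V_isClassOf : (V : InvFun).IsClassOf fV := N.ofFun_isClassOf _ _ _
theorem T_isClassOf : (T : InvFun).IsClassOf fT := N.ofFun_isClassOf _ _ _

end Elements

end EllGamma
end

noncomputable section

namespace EllGamma

/-! ### Pointwise identities behind the relations of `E`. -/

section Identities

variable {p : X}

/-- The integral coefficient vectors are supplied separately from the expressions for the periods,
so each use needs only one determinant check and four linear identities. -/
theorem Generic.good (hp : Generic p) {ζ A B C : ℂ} (k a b c : Fin 3 → ℤ)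
    (h : Generic.det₃ a b c ≠ 0) (hk : p.1 + lin k p.2 = ζ) (ha : lin a p.2 = A)
    (hb : lin b p.2 = B) (hc : lin c p.2 = C) : TripleGood A B C ∧ Avoid ζ A B C := by
  subst hk ha hb hc
  exact ⟨hp.tripleGood h, hp.avoid k a b c⟩

/-- Dividing two modular identities with a common period `B` leaves the difference of two Bernoulli
polynomials in the exponent. -/
theorem theta₀_mul_eq {ζ A A' B : ℂ} (h : thetaQuot ζ A B = 1) (h' : thetaQuot ζ A' B = 1) :
    theta₀ (ζ / A) (B / A) * theta₀ (ζ / B) (A / B) =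
      Complex.exp (Real.pi * Complex.I * (bern₂ ζ A' B - bern₂ ζ A B)) *
        (theta₀ (ζ / A') (B / A') * theta₀ (ζ / B) (A' / B)) := by
  unfold thetaQuot at h h'
  rw [mul_sub, Complex.exp_sub]
  have h0 := Complex.exp_ne_zero (Real.pi * Complex.I * bern₂ ζ A B)
  field_simp
  linear_combination h - h'

theorem fT_t₃ (hp : Generic p) :
    fT (p.1 - p.2 2, p.2) = Complex.exp (Complex.I * Real.pi * L32 p) * fT p := by
  obtain ⟨hω, h⟩ := hp.good (ζ := p.1 - p.2 1 - p.2 2) (A := p.2 0) (B := p.2 1) (C := p.2 2)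
    ![0, -1, -1] ![1, 0, 0] ![0, 1, 0] ![0, 0, 1] (by decide) (by simp [lin]; ring)
    (by simp [lin]) (by simp [lin]) (by simp [lin])
  have h0 := hω.ne₁
  have e := theta₀_add_period (h.gamma₁ hω).theta_right
  -- The sign in the quasi-periodicity of `θ₀` is `exp (iπ)`, which accounts for the summand `x₁` in
  -- the numerator of `L32`.
  have e' : Complex.exp (Complex.I * Real.pi * L32 p) = -ee ((p.1 - p.2 1 - p.2 2) / p.2 0) := by
    rw [← neg_one_mul, ← ee_half, ← ee_add, ee]
    congr 1
    simp only [L32]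
    field_simp
    ring
  rw [e', fT, fT, show (p.1 - p.2 1) / p.2 0 = (p.1 - p.2 1 - p.2 2) / p.2 0 + p.2 2 / p.2 0 by
    field_simp; ring, e, sub_right_comm]
  have := ee_ne_zero ((p.1 - p.2 1 - p.2 2) / p.2 0)
  field_simp

/-- Both sides are compared through their modular transforms, which coincide because the periods
`(x₁ - x₃)/x₃` and `x₁/x₃` differ by `1`. -/
theorem fT_e₁₃ (hp : Generic p) :
    fT (p.1, Function.update p.2 0 (p.2 0 - p.2 2)) =
      Complex.exp (Complex.I * Real.pi * L132 p) * fT p := by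
  obtain ⟨hω, h⟩ := hp.good (ζ := p.1 - p.2 1) (A := p.2 0 - p.2 2) (B := p.2 2) (C := p.2 1)
    ![0, -1, 0] ![1, 0, -1] ![0, 0, 1] ![0, 1, 0] (by decide) (by simp [lin]; ring)
    (by simp [lin]; ring) (by simp [lin]) (by simp [lin])
  obtain ⟨hω', h'⟩ := hp.good (ζ := p.1 - p.2 1) (A := p.2 0) (B := p.2 2) (C := p.2 1)
    ![0, -1, 0] ![1, 0, 0] ![0, 0, 1] ![0, 1, 0] (by decide) (by simp [lin]; ring)
    (by simp [lin]) (by simp [lin]) (by simp [lin])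
  have e := theta₀_mul_eq (thetaQuot_eq_one hω h) (thetaQuot_eq_one hω' h')
  have n1 := hω.ne₁
  have n2 := hω.ne₂
  have n3 := hω'.ne₁
  have n4 : p.2 2 - p.2 0 ≠ 0 := fun h => n1 (by linear_combination -h)
  have e1 : p.2 0 / p.2 2 = (p.2 0 - p.2 2) / p.2 2 + 1 := by field_simp; ring
  have e2 : Complex.I * Real.pi * L132 p = Real.pi * Complex.I *
      (bern₂ (p.1 - p.2 1) (p.2 0) (p.2 2) - bern₂ (p.1 - p.2 1) (p.2 0 - p.2 2) (p.2 2)) := by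
    simp only [L132, bern₂]
    field_simp
    ring
  rw [e1, theta₀_period_add_one, ← mul_assoc] at e
  rw [e2]
  have n := theta₀_ne_zero (h.gamma₂ hω).symm.theta_right
  simpa [fT] using mul_right_cancel₀ n e

theorem fU_t₁ (hp : Generic p) :
    fU (p.1 - p.2 0, p.2) = (theta₀ ((p.1 - p.2 1) / p.2 2) ((p.2 0 - p.2 1) / p.2 2))⁻¹ * fU p := by
  obtain ⟨hω, h⟩ := hp.good (ζ := p.1 - p.2 1) (A := p.2 2) (B := p.2 0 - p.2 1) (C := -p.2 0)
    ![0, -1, 0] ![0, 0, 1] ![1, -1, 0] ![-1, 0, 0] (by decide) (by simp [lin]; ring)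
    (by simp [lin]) (by simp [lin]; ring) (by simp [lin])
  have e := ellGamma_add_right (h.gamma₁ hω)
  rw [← add_div, neg_div] at e
  rw [fU, fU, ← mul_inv, ← e]
  congr 3
  ring

/-- The argument `z - 2 x₂` is reached from `z - x₁ - x₂`, the case of `fU_t₁`, by the period `x₁ -
x₂`. The resulting theta function has period `-x₁/x₃` and is inverted to have period `x₁/x₃`. -/
theorem fU_t₂ (hp : Generic p) :
    fU (p.1 - p.2 1, p.2) = theta₀ ((p.1 - p.2 1) / p.2 2) (p.2 0 / p.2 2) *
      (theta₀ ((p.1 - p.2 1) / p.2 2) ((p.2 0 - p.2 1) / p.2 2))⁻¹ * fU p := by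
  obtain ⟨hω, h⟩ := hp.good (ζ := p.1 - p.2 0 - p.2 1) (A := p.2 2) (B := p.2 0 - p.2 1)
    (C := -p.2 0) ![-1, -1, 0] ![0, 0, 1] ![1, -1, 0] ![-1, 0, 0] (by decide)
    (by simp [lin]; ring) (by simp [lin]) (by simp [lin]; ring) (by simp [lin])
  obtain ⟨hω', -⟩ := hp.good (ζ := p.1 - p.2 1) (A := p.2 2) (B := p.2 0) (C := p.2 1)
    ![0, -1, 0] ![0, 0, 1] ![1, 0, 0] ![0, 1, 0] (by decide)
    (by simp [lin]; ring) (by simp [lin]) (by simp [lin]) (by simp [lin])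
  have e := ellGamma_add_left (h.gamma₁ hω)
  rw [neg_div, theta₀_neg hω'.im₁₂, ← add_div, ← add_div] at e
  rw [mul_assoc, ← fU_t₁ hp, fU, fU, ← inv_inj, mul_inv, inv_inv, inv_inv]
  convert e using 2
  · congr 1
    ring
  · congr 3
    ring

/-- After `fU_t₂` the gamma functions cancel. What is left compares the theta identities for the
period pairs `x₁ - x₂, x₃` and `x₁, x₃`. -/
theorem fU_mul_fT_e₁₂ (hp : Generic p) :
    fU p * fT (p.1, Function.update p.2 0 (p.2 0 - p.2 1)) =
      Complex.exp (Complex.I * Real.pi * L122 p) * (fT p * fU (p.1 - p.2 1, p.2)) := by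
  obtain ⟨hω, h⟩ := hp.good (ζ := p.1 - p.2 1) (A := p.2 0 - p.2 1) (B := p.2 2) (C := p.2 1)
    ![0, -1, 0] ![1, -1, 0] ![0, 0, 1] ![0, 1, 0] (by decide) (by simp [lin]; ring)
    (by simp [lin]; ring) (by simp [lin]) (by simp [lin])
  obtain ⟨hω', h'⟩ := hp.good (ζ := p.1 - p.2 1) (A := p.2 0) (B := p.2 2) (C := p.2 1)
    ![0, -1, 0] ![1, 0, 0] ![0, 0, 1] ![0, 1, 0] (by decide) (by simp [lin]; ring)
    (by simp [lin]) (by simp [lin]) (by simp [lin])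
  have e := theta₀_mul_eq (thetaQuot_eq_one hω h) (thetaQuot_eq_one hω' h')
  have n1 := hω.ne₁
  have n2 := hω.ne₂
  have n3 := hω'.ne₁
  have n4 : p.2 1 - p.2 0 ≠ 0 := fun h => n1 (by linear_combination -h)
  have e2 : Complex.I * Real.pi * L122 p = Real.pi * Complex.I *
      (bern₂ (p.1 - p.2 1) (p.2 0) (p.2 2) - bern₂ (p.1 - p.2 1) (p.2 0 - p.2 1) (p.2 2)) := by
    simp only [L122, bern₂]
    field_simp
    ring
  have n := theta₀_ne_zero (h.gamma₂ hω).symm.theta_right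
  rw [← e2] at e
  rw [fU_t₂ hp]
  have e3 : fT (p.1, Function.update p.2 0 (p.2 0 - p.2 1)) =
    theta₀ ((p.1 - p.2 1) / (p.2 0 - p.2 1)) (p.2 2 / (p.2 0 - p.2 1)) := by simp [fT]
  rw [e3, fT]
  field_simp
  linear_combination fU p * e

theorem fT_mul_fU_t₂ (hp : Generic p) :
    fT p * fU (p.1 - p.2 1, p.2) =
      Complex.exp (Complex.I * Real.pi * L121 p) * fU (p.1 - p.2 0, p.2) := by
  obtain ⟨hω, h⟩ := hp.good (ζ := p.1 - p.2 1) (A := p.2 0) (B := p.2 2) (C := p.2 1)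
    ![0, -1, 0] ![1, 0, 0] ![0, 0, 1] ![0, 1, 0] (by decide) (by simp [lin]; ring)
    (by simp [lin]) (by simp [lin]) (by simp [lin])
  have e := thetaQuot_eq_one hω h
  have n1 := hω.ne₁
  have n2 := hω.ne₂
  have e2 : Complex.I * Real.pi * L121 p =
      -(Real.pi * Complex.I * bern₂ (p.1 - p.2 1) (p.2 0) (p.2 2)) := by
    simp only [L121, bern₂]
    field_simp
    ring
  rw [thetaQuot, ← eq_div_iff (Complex.exp_ne_zero _), one_div, ← Complex.exp_neg, ← e2] at e
  rw [fU_t₂ hp, fU_t₁ hp, ← e, fT]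
  ring

/-- The points `z`, `z - x₂` and `z - x₃` are connected by the periods `x₃` and `x₂ - x₃` of the
gamma function, so no modular transformation and no exponential factor occurs. -/
theorem fV_eq_t₂ (hp : Generic p) :
    fV p * fT (p.1, Function.update p.2 2 (p.2 2 - p.2 1)) = fT p * fV (p.1 - p.2 1, p.2) := by
  obtain ⟨hω, h⟩ := hp.good (ζ := p.1 - p.2 1) (A := p.2 0) (B := p.2 1 - p.2 2) (C := p.2 2)
    ![0, -1, 0] ![1, 0, 0] ![0, 1, -1] ![0, 0, 1] (by decide) (by simp [lin]; ring)
    (by simp [lin]) (by simp [lin]; ring) (by simp [lin])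
  obtain ⟨hω', h'⟩ := hp.good (ζ := p.1 - p.2 2) (A := p.2 0) (B := p.2 1 - p.2 2) (C := p.2 2)
    ![0, 0, -1] ![1, 0, 0] ![0, 1, -1] ![0, 0, 1] (by decide) (by simp [lin]; ring)
    (by simp [lin]) (by simp [lin]; ring) (by simp [lin])
  have e1 := ellGamma_add_left (h.gamma₁ hω)
  have e2 := ellGamma_add_right (h'.gamma₁ hω')
  rw [← add_div, show p.1 - p.2 1 + (p.2 1 - p.2 2) = p.1 - p.2 2 by ring] at e1
  rw [← add_div, show p.1 - p.2 2 + p.2 2 = p.1 by ring, e1] at e2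
  have e3 := theta₀_neg hω.im₁₂ ((p.1 - p.2 1) / p.2 0)
  rw [← add_div, ← neg_div, show p.1 - p.2 1 + (p.2 1 - p.2 2) = p.1 - p.2 2 by ring, neg_sub] at e3
  have e4 : fT (p.1, Function.update p.2 2 (p.2 2 - p.2 1)) =
    theta₀ ((p.1 - p.2 1) / p.2 0) ((p.2 2 - p.2 1) / p.2 0) := by simp [fT]
  have n := theta₀_ne_zero (h'.gamma₁ hω').symm.theta_right
  rw [e4, e3, fV, e2, fT, fV]
  field_simp

theorem fT_mul_fV_t₂ (hp : Generic p) :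
    fT p * fV (p.1 - p.2 1, p.2) = fV (p.1 - p.2 2, p.2) := by
  obtain ⟨hω, h⟩ := hp.good (ζ := p.1 - p.2 1) (A := p.2 0) (B := p.2 1 - p.2 2) (C := p.2 2)
    ![0, -1, 0] ![1, 0, 0] ![0, 1, -1] ![0, 0, 1] (by decide) (by simp [lin]; ring)
    (by simp [lin]) (by simp [lin]; ring) (by simp [lin])
  have e1 := ellGamma_add_left (h.gamma₁ hω)
  rw [← add_div, show p.1 - p.2 1 + (p.2 1 - p.2 2) = p.1 - p.2 2 by ring] at e1
  exact e1.symm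

theorem ellGamma_left_sub_one (z τ σ : ℂ) : ellGamma z (τ - 1) σ = ellGamma z τ σ := by
  rw [← ellGamma_left_add_one, sub_add_cancel]

theorem ellGamma_sub_one (z τ σ : ℂ) : ellGamma (z - 1) τ σ = ellGamma z τ σ := by
  rw [← ellGamma_add_one, sub_add_cancel]

theorem ellGamma_right_sub_one (z τ σ : ℂ) : ellGamma z τ (σ - 1) = ellGamma z τ σ := by
  rw [← ellGamma_right_add_one, sub_add_cancel]

/-- This is the modular identity of `Γ` for the periods `x₁ - x₃`, `x₃`, `x₁ - x₂` at `z + x₁ - x₂`.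
The three factors are put in the required form by integral shifts and by reversing the sign of a
period. -/
theorem fV_e₁₃ (hp : Generic p) :
    fV (p.1, Function.update p.2 0 (p.2 0 - p.2 2)) =
      Complex.exp (Complex.I * Real.pi * L1332 p) *
        (fU p * fV (p.1, Function.update p.2 0 (p.2 0 - p.2 1))) := by
  obtain ⟨hω, h⟩ := hp.good (ζ := p.1 + (p.2 0 - p.2 1)) (A := p.2 0 - p.2 2) (B := p.2 2)
    (C := p.2 0 - p.2 1) ![1, -1, 0] ![1, 0, -1] ![0, 0, 1] ![1, -1, 0] (by decide)
    (by simp [lin]; ring) (by simp [lin]; ring) (by simp [lin]) (by simp [lin]; ring)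
  have e := gammaQuot_eq_one hω h
  have n1 := hω.ne₁
  have n2 := hω.ne₂
  have n3 := hω.ne₃
  have n4 : p.2 1 - p.2 0 ≠ 0 := fun h => n3 (by linear_combination -h)
  have n5 : p.2 2 - p.2 0 ≠ 0 := fun h => n1 (by linear_combination -h)
  have e1 : fV (p.1, Function.update p.2 0 (p.2 0 - p.2 2)) =
      (ellGamma ((p.1 + (p.2 0 - p.2 1)) / (p.2 0 - p.2 2)) (p.2 2 / (p.2 0 - p.2 2))
        ((p.2 0 - p.2 1) / (p.2 0 - p.2 2)))⁻¹ := by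
    rw [ellGamma_comm, add_div, ← ellGamma_neg_left hω.im₁₃, ← ellGamma_left_add_one]
    simp only [fV, Function.update_self, ne_eq, Fin.isValue, Function.update_of_ne, Fin.reduceEq,
      not_false_eq_true]
    congr 1
    field_simp
    ring
  have e2 : fU p = ellGamma ((p.1 + (p.2 0 - p.2 1)) / p.2 2) ((p.2 0 - p.2 2) / p.2 2)
      ((p.2 0 - p.2 1) / p.2 2) := by
    rw [← inv_inj, fU, inv_inv, ellGamma_comm,
      show -(p.2 0 / p.2 2) = -((p.2 0 - p.2 2) / p.2 2) - 1 by field_simp; ring,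
      ellGamma_left_sub_one, ellGamma_neg_left (im_div_swap hω.im₁₂), ← ellGamma_sub_one (_ / _)]
    congr 2
    field_simp
    ring
  have e3 : fV (p.1, Function.update p.2 0 (p.2 0 - p.2 1)) =
      ellGamma ((p.1 + (p.2 0 - p.2 1)) / (p.2 0 - p.2 1)) ((p.2 0 - p.2 2) / (p.2 0 - p.2 1))
        (p.2 2 / (p.2 0 - p.2 1)) := by
    rw [add_div, div_self n3, ellGamma_add_one, ← ellGamma_left_sub_one]
    simp only [fV, Function.update_self, ne_eq, Fin.isValue, Function.update_of_ne, Fin.reduceEq,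
      not_false_eq_true]
    congr 1
    field_simp
    ring
  have e4 : Complex.I * Real.pi * L1332 p = Real.pi * Complex.I / 3 *
      bern₃ (p.1 + (p.2 0 - p.2 1)) (p.2 0 - p.2 2) (p.2 2) (p.2 0 - p.2 1) := by
    simp only [L1332, bern₃]
    field_simp
    ring
  rw [gammaQuot, gammaProd, ← e2, ← e3, ← e4] at e
  rw [e1]
  refine inv_eq_of_mul_eq_one_right ?_
  linear_combination e

/-- The modular identity is used for the periods `x₃ - x₁`, `x₃ - x₂`, `x₁` at `z + x₃ - x₂`; sign
reversals invert the last two factors, and the exponent changes sign. -/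
theorem fU_e₃₁ (hp : Generic p) :
    fU (p.1, Function.update p.2 2 (p.2 2 - p.2 0)) =
      Complex.exp (Complex.I * Real.pi * L3112 p) *
        (fV p * fU (p.1, Function.update p.2 2 (p.2 2 - p.2 1))) := by
  obtain ⟨hω, h⟩ := hp.good (ζ := p.1 + (p.2 2 - p.2 1)) (A := p.2 2 - p.2 0) (B := p.2 2 - p.2 1)
    (C := p.2 0) ![0, -1, 1] ![-1, 0, 1] ![0, -1, 1] ![1, 0, 0] (by decide)
    (by simp [lin]; ring) (by simp [lin]; ring) (by simp [lin]; ring) (by simp [lin])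
  have e := gammaQuot_eq_one hω h
  have n1 := hω.ne₁
  have n2 := hω.ne₂
  have n3 := hω.ne₃
  have n4 : p.2 1 - p.2 2 ≠ 0 := fun h => n2 (by linear_combination -h)
  have e1 : fU (p.1, Function.update p.2 2 (p.2 2 - p.2 0)) =
      ellGamma ((p.1 + (p.2 2 - p.2 1)) / (p.2 2 - p.2 0)) ((p.2 2 - p.2 1) / (p.2 2 - p.2 0))
        (p.2 0 / (p.2 2 - p.2 0)) := by
    simp only [fU, Function.update_self, ne_eq, Fin.isValue, Function.update_of_ne, Fin.reduceEq,
      not_false_eq_true]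
    rw [← inv_inj, inv_inv, ellGamma_comm, ellGamma_neg_left hω.im₁₃,
      show (p.2 0 - p.2 1) / (p.2 2 - p.2 0) = (p.2 2 - p.2 1) / (p.2 2 - p.2 0) - 1 by
        field_simp; ring, ellGamma_right_sub_one, ellGamma_comm, ← ellGamma_add_one]
    congr 2
    field_simp
    ring
  have e2 : fV p = (ellGamma ((p.1 + (p.2 2 - p.2 1)) / p.2 0) ((p.2 2 - p.2 0) / p.2 0)
      ((p.2 2 - p.2 1) / p.2 0))⁻¹ := by
    rw [ellGamma_comm, add_div, ← ellGamma_neg_left (im_div_swap hω.im₂₃), ← ellGamma_right_add_one,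
      fV]
    congr 1 <;> · field_simp; ring
  have e3 : fU (p.1, Function.update p.2 2 (p.2 2 - p.2 1)) =
      (ellGamma ((p.1 + (p.2 2 - p.2 1)) / (p.2 2 - p.2 1)) ((p.2 2 - p.2 0) / (p.2 2 - p.2 1))
        (p.2 0 / (p.2 2 - p.2 1)))⁻¹ := by
    simp only [fU, Function.update_self, ne_eq, Fin.isValue, Function.update_of_ne, Fin.reduceEq,
      not_false_eq_true]
    rw [ellGamma_comm, ellGamma_neg_left hω.im₂₃,
      show (p.2 0 - p.2 1) / (p.2 2 - p.2 1) = -((p.2 2 - p.2 0) / (p.2 2 - p.2 1)) + 1 by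
        field_simp; ring, ellGamma_right_add_one, ellGamma_comm,
      ellGamma_neg_left (im_div_swap hω.im₁₂), inv_inv]
    congr 2
    field_simp
    ring
  have e4 : Complex.I * Real.pi * L3112 p = -(Real.pi * Complex.I / 3 *
      bern₃ (p.1 + (p.2 2 - p.2 1)) (p.2 2 - p.2 0) (p.2 2 - p.2 1) (p.2 0)) := by
    have n5 : p.2 0 - p.2 2 ≠ 0 := fun h => n1 (by linear_combination -h)
    simp only [L3112, bern₃]
    field_simp
    ring
  rw [e1, e2, e3, e4, Complex.exp_neg, ← mul_inv, ← mul_inv]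
  refine eq_inv_of_mul_eq_one_left ?_
  rw [gammaQuot, gammaProd] at e
  linear_combination e

/-- Up to integral shifts, the two sides have the same periods and arguments related by the
reflection formula, which absorbs the inverse in `fU`. -/
theorem fV_e₁₃_eq_fU_e₃₁ (hp : Generic p) :
    fV (p.1, Function.update p.2 0 (p.2 0 - p.2 2)) =
      fU (p.1, Function.update p.2 2 (p.2 2 - p.2 0)) := by
  obtain ⟨hω, -⟩ := hp.good (ζ := p.1) (A := p.2 0 - p.2 2) (B := p.2 2) (C := p.2 1)
    0 ![1, 0, -1] ![0, 0, 1] ![0, 1, 0] (by decide) (by simp [lin]) (by simp [lin]; ring)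
    (by simp [lin]) (by simp [lin])
  have n1 := hω.ne₁
  have n2 : p.2 2 - p.2 0 ≠ 0 := fun h => n1 (by linear_combination -h)
  simp only [fU, fV, Function.update_self, ne_eq, Fin.isValue, Function.update_of_ne, Fin.reduceEq,
    not_false_eq_true]
  rw [← ellGamma_reflect,
    show (p.2 0 - p.2 1) / (p.2 2 - p.2 0) = (p.2 1 - p.2 2) / (p.2 0 - p.2 2) - 1 by
      rw [← neg_sub (p.2 0), div_neg]
      field_simp
      ring,
    show -(p.2 0 / (p.2 2 - p.2 0)) = p.2 2 / (p.2 0 - p.2 2) + 1 by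
      rw [← neg_sub (p.2 0), div_neg]
      field_simp
      ring]
  rw [show (p.2 1 - p.2 2) / (p.2 0 - p.2 2) - 1 + (p.2 2 / (p.2 0 - p.2 2) + 1) -
    (p.1 - p.2 1) / (p.2 2 - p.2 0) = p.1 / (p.2 0 - p.2 2) by
      rw [← neg_sub (p.2 0), div_neg]
      field_simp
      ring, ellGamma_left_sub_one, ellGamma_right_add_one]

/-- The left-hand sides of `fV_e₁₃` and `fU_e₃₁` coincide, so their right-hand sides do. The
exponent is the difference `L3112 - L1332`. -/
theorem fU_mul_fV_e₁₂ (hp : Generic p) :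
    fU p * fV (p.1, Function.update p.2 0 (p.2 0 - p.2 1)) =
      Complex.exp (Complex.I * Real.pi * L1232 p) *
        (fV p * fU (p.1, Function.update p.2 2 (p.2 2 - p.2 1))) := by
  have e := (fV_e₁₃ hp).symm.trans ((fV_e₁₃_eq_fU_e₃₁ hp).trans (fU_e₃₁ hp))
  obtain ⟨hω, -⟩ := hp.good (ζ := p.1) (A := p.2 0 - p.2 2) (B := p.2 1 - p.2 0)
    (C := p.2 0) 0 ![1, 0, -1] ![-1, 1, 0] ![1, 0, 0] (by decide) (by simp [lin])
    (by simp [lin]; ring) (by simp [lin]; ring) (by simp [lin])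
  obtain ⟨hω', -⟩ := hp.good (ζ := p.1) (A := p.2 1 - p.2 2) (B := p.2 2)
    (C := p.2 0) 0 ![0, 1, -1] ![0, 0, 1] ![1, 0, 0] (by decide) (by simp [lin])
    (by simp [lin]; ring) (by simp [lin]) (by simp [lin])
  have e' : Complex.I * Real.pi * L3112 p =
      Complex.I * Real.pi * L1332 p + Complex.I * Real.pi * L1232 p := by
    have n1 := hω.ne₁
    have n2 := hω.ne₂
    have n3 := hω.ne₃
    have n4 := hω'.ne₁
    have n5 := hω'.ne₂
    have n6 : p.2 2 - p.2 0 ≠ 0 := fun h => n1 (by linear_combination -h)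
    simp only [L3112, L1332, L1232]
    field_simp
    ring
  rw [e', Complex.exp_add] at e
  refine mul_left_cancel₀ (Complex.exp_ne_zero (Complex.I * Real.pi * L1332 p)) ?_
  linear_combination e

/-- Here and in the remaining identities of this kind the arguments and periods change by integers
or not at all, so the corresponding `L` is zero. -/
theorem fU_e₁₃ (hp : Generic p) : fU (p.1, Function.update p.2 0 (p.2 0 - p.2 2)) = fU p := by
  have h2 := hp.ne_zero 2
  simp only [fU, Function.update_self, ne_eq, Fin.isValue, Function.update_of_ne, Fin.reduceEq,
    not_false_eq_true]
  rw [← ellGamma_left_sub_one _ ((p.2 0 - p.2 1) / p.2 2), ← ellGamma_right_add_one _ _ (-(p.2 0 / p.2 2))]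
  congr 2 <;> · field_simp; ring

theorem fV_e₃₁ (hp : Generic p) : fV (p.1, Function.update p.2 2 (p.2 2 - p.2 0)) = fV p := by
  have h0 := hp.ne_zero 0
  simp only [fV, Function.update_self, ne_eq, Fin.isValue, Function.update_of_ne, Fin.reduceEq,
    not_false_eq_true]
  rw [← ellGamma_left_add_one _ ((p.2 1 - p.2 2) / p.2 0), ← ellGamma_right_sub_one _ _ (p.2 2 / p.2 0)]
  congr 1
  · field_simp
    ring
  · field_simp

theorem fT_e₃₁ (hp : Generic p) : fT (p.1, Function.update p.2 2 (p.2 2 - p.2 0)) = fT p := by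
  have h0 := hp.ne_zero 0
  simp only [fT, Function.update_self, ne_eq, Fin.isValue, Function.update_of_ne, Fin.reduceEq,
    not_false_eq_true]
  rw [← theta₀_period_add_one]
  congr 1
  field_simp
  ring

theorem fT_t₁ (hp : Generic p) : fT (p.1 - p.2 0, p.2) = fT p := by
  have h0 := hp.ne_zero 0
  simp only [fT]
  rw [← theta₀_add_one]
  congr 1
  field_simp
  ring

theorem fU_t₃ (hp : Generic p) : fU (p.1 - p.2 2, p.2) = fU p := by
  have h2 := hp.ne_zero 2
  simp only [fU]
  rw [← ellGamma_add_one]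
  congr 2
  field_simp
  ring

theorem fV_t₁ (hp : Generic p) : fV (p.1 - p.2 0, p.2) = fV p := by
  have h0 := hp.ne_zero 0
  simp only [fV]
  rw [← ellGamma_add_one]
  congr 1
  field_simp
  ring

theorem fT_t₁_e₂₁ (p : X) :
    fT (p.1 - p.2 0, Function.update p.2 1 (p.2 1 - p.2 0)) = fT p := by
  simp [fT]

theorem fT_t₃_e₂₃ (p : X) :
    fT (p.1 - p.2 2, Function.update p.2 1 (p.2 1 - p.2 2)) = fT p := by
  simp [fT]

theorem fU_e₁₃_e₂₃ (hp : Generic p) :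
    fU (p.1, Function.update (Function.update p.2 0 (p.2 0 - p.2 2)) 1 (p.2 1 - p.2 2)) = fU p := by
  have h2 := hp.ne_zero 2
  simp only [fU, Function.update_self, ne_eq, Fin.isValue, Function.update_of_ne, Fin.reduceEq,
    not_false_eq_true, sub_sub_sub_cancel_right]
  rw [← ellGamma_add_one ((p.1 - p.2 1) / p.2 2), ← ellGamma_right_add_one _ _ (-(p.2 0 / p.2 2))]
  congr 2 <;> · field_simp; ring

theorem fV_e₃₁_e₂₁ (hp : Generic p) :
    fV (p.1, Function.update (Function.update p.2 2 (p.2 2 - p.2 0)) 1 (p.2 1 - p.2 0)) = fV p := by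
  have h0 := hp.ne_zero 0
  simp only [fV, Function.update_self, ne_eq, Fin.isValue, Function.update_of_ne, Fin.reduceEq,
    not_false_eq_true, sub_sub_sub_cancel_right]
  rw [← ellGamma_right_sub_one _ _ (p.2 2 / p.2 0)]
  congr 1
  field_simp

end Identities

end EllGamma
end

noncomputable section

namespace EllGamma

/-! ### Verification of the defining relations in `N ⋊ G`. -/

section Relations

theorem G.elem_inv_smul {i j : Fin 3} (h : i ≠ j) (p : X) :
    (G.elem i j h)⁻¹ • p = (p.1, Function.update p.2 i (p.2 i - p.2 j)) := by
  rw [inv_smul_eq_iff, G.smul_def]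
  refine Prod.ext (by simp [G.elem]) (funext fun k => ?_)
  simp only [G.elem, G.cmat, Matrix.transvection, Matrix.mulVec, dotProduct, Fin.sum_univ_three]
  fin_cases i <;> fin_cases j <;> fin_cases k <;> first | exact absurd rfl h | simp [Matrix.single]

theorem G.trans_inv_smul (i : Fin 3) (p : X) : (G.trans i)⁻¹ • p = (p.1 - p.2 i, p.2) := by
  rw [inv_smul_eq_iff, G.smul_def]
  refine Prod.ext ?_ ?_
  · simp only [G.trans, Fin.sum_univ_three]
    fin_cases i <;> simp
  · simp [G.trans, G.cmat_one]

variable {a b : N} {F H : X → ℂ}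

theorem IsClassOf_e (ha : (a : InvFun).IsClassOf F) {i j : Fin 3} (h : i ≠ j) :
    ((G.elem i j h • a : N) : InvFun).IsClassOf fun p =>
      F (p.1, Function.update p.2 i (p.2 i - p.2 j)) := by
  have := ha.smul (G.elem i j h)
  simp only [G.elem_inv_smul] at this
  exact this

theorem IsClassOf_t (ha : (a : InvFun).IsClassOf F) (i : Fin 3) :
    ((G.trans i • a : N) : InvFun).IsClassOf fun p => F (p.1 - p.2 i, p.2) := by
  have := ha.smul (G.trans i)
  simp only [G.trans_inv_smul] at this
  exact this

theorem IsClassOf_mul (ha : (a : InvFun).IsClassOf F) (hb : (b : InvFun).IsClassOf H) :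
    ((a * b : N) : InvFun).IsClassOf fun p => F p * H p := ha.mul hb

theorem N.eq_of_generic (ha : (a : InvFun).IsClassOf F) (hb : (b : InvFun).IsClassOf H)
    (h : ∀ p, Generic p → F p = H p) : a = b :=
  Subtype.ext (ha.eq_of_dense hb dense_generic h)

theorem expPiI_zero : expPiI 0 = 1 :=
  Subtype.ext (Subtype.ext (((expPiI_isClassOf 0).congr isOpen_univ dense_univ
    fun p _ => by simp [show (0 : K).1 p = 0 from rfl]).unique
    (⟨InvPair.one, rfl, fun _ _ => rfl⟩ : (1 : InvFun).IsClassOf fun _ => 1)))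

theorem expPiI_neg (L : K) : expPiI (-L) = (expPiI L)⁻¹ :=
  Subtype.ext (Subtype.ext ((expPiI_isClassOf (-L)).unique
    ((expPiI_isClassOf L).inv.congr isOpen_univ dense_univ fun p _ => by
      simp [show (-L : K).1 p = -L.1 p from rfl, Complex.exp_neg])))

theorem T_t₃ : G.trans 2 • T = (expPiI ⟨L32, L32_mem⟩ : N) * T :=
  N.eq_of_generic (IsClassOf_t T_isClassOf 2) (IsClassOf_mul (expPiI_isClassOf _) T_isClassOf)
    fun _ => fT_t₃

theorem T_e₁₃ : G.elem 0 2 (by decide) • T = (expPiI ⟨L132, L132_mem⟩ : N) * T :=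
  N.eq_of_generic (IsClassOf_e T_isClassOf _) (IsClassOf_mul (expPiI_isClassOf _) T_isClassOf)
    fun _ => fT_e₁₃

theorem U_mul_T : U * G.elem 0 1 (by decide) • T =
    (expPiI ⟨L122, L122_mem⟩ : N) * (T * G.trans 1 • U) :=
  N.eq_of_generic (IsClassOf_mul U_isClassOf (IsClassOf_e T_isClassOf _))
    (IsClassOf_mul (expPiI_isClassOf _) (IsClassOf_mul T_isClassOf (IsClassOf_t U_isClassOf 1)))
    fun _ => fU_mul_fT_e₁₂

theorem T_mul_U : T * G.trans 1 • U = (expPiI ⟨L121, L121_mem⟩ : N) * G.trans 0 • U :=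
  N.eq_of_generic (IsClassOf_mul T_isClassOf (IsClassOf_t U_isClassOf 1))
    (IsClassOf_mul (expPiI_isClassOf _) (IsClassOf_t U_isClassOf 0)) fun _ => fT_mul_fU_t₂

theorem V_mul_T : V * G.elem 2 1 (by decide) • T = T * G.trans 1 • V :=
  N.eq_of_generic (IsClassOf_mul V_isClassOf (IsClassOf_e T_isClassOf _))
    (IsClassOf_mul T_isClassOf (IsClassOf_t V_isClassOf 1)) fun _ => fV_eq_t₂

theorem T_mul_V : T * G.trans 1 • V = G.trans 2 • V :=
  N.eq_of_generic (IsClassOf_mul T_isClassOf (IsClassOf_t V_isClassOf 1))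
    (IsClassOf_t V_isClassOf 2) fun _ => fT_mul_fV_t₂

theorem V_e₁₃ : G.elem 0 2 (by decide) • V =
    (expPiI ⟨L1332, L1332_mem⟩ : N) * (U * G.elem 0 1 (by decide) • V) :=
  N.eq_of_generic (IsClassOf_e V_isClassOf _) (IsClassOf_mul (expPiI_isClassOf _)
    (IsClassOf_mul U_isClassOf (IsClassOf_e V_isClassOf _))) fun _ => fV_e₁₃

theorem U_e₃₁ : G.elem 2 0 (by decide) • U =
    (expPiI ⟨L3112, L3112_mem⟩ : N) * (V * G.elem 2 1 (by decide) • U) :=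
  N.eq_of_generic (IsClassOf_e U_isClassOf _) (IsClassOf_mul (expPiI_isClassOf _)
    (IsClassOf_mul V_isClassOf (IsClassOf_e U_isClassOf _))) fun _ => fU_e₃₁

theorem U_mul_V : U * G.elem 0 1 (by decide) • V =
    (expPiI ⟨L1232, L1232_mem⟩ : N) * (V * G.elem 2 1 (by decide) • U) :=
  N.eq_of_generic (IsClassOf_mul U_isClassOf (IsClassOf_e V_isClassOf _))
    (IsClassOf_mul (expPiI_isClassOf _) (IsClassOf_mul V_isClassOf (IsClassOf_e U_isClassOf _)))
    fun _ => fU_mul_fV_e₁₂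

theorem U_e₁₃ : G.elem 0 2 (by decide) • U = U :=
  N.eq_of_generic (IsClassOf_e U_isClassOf _) U_isClassOf fun _ => fU_e₁₃

theorem V_e₃₁ : G.elem 2 0 (by decide) • V = V :=
  N.eq_of_generic (IsClassOf_e V_isClassOf _) V_isClassOf fun _ => fV_e₃₁

theorem T_e₃₁ : G.elem 2 0 (by decide) • T = T :=
  N.eq_of_generic (IsClassOf_e T_isClassOf _) T_isClassOf fun _ => fT_e₃₁

theorem T_t₁ : G.trans 0 • T = T :=
  N.eq_of_generic (IsClassOf_t T_isClassOf _) T_isClassOf fun _ => fT_t₁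

theorem U_t₃ : G.trans 2 • U = U :=
  N.eq_of_generic (IsClassOf_t U_isClassOf _) U_isClassOf fun _ => fU_t₃

theorem V_t₁ : G.trans 0 • V = V :=
  N.eq_of_generic (IsClassOf_t V_isClassOf _) V_isClassOf fun _ => fV_t₁

theorem T_t₁_e₂₁ : G.trans 0 • G.elem 1 0 (by decide) • T = T :=
  N.eq_of_generic (IsClassOf_t (IsClassOf_e T_isClassOf _) _) T_isClassOf fun p _ => fT_t₁_e₂₁ p

theorem T_t₃_e₂₃ : G.trans 2 • G.elem 1 2 (by decide) • T = T :=
  N.eq_of_generic (IsClassOf_t (IsClassOf_e T_isClassOf _) _) T_isClassOf fun p _ => fT_t₃_e₂₃ p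

theorem U_e₁₃_e₂₃ : G.elem 0 2 (by decide) • G.elem 1 2 (by decide) • U = U :=
  N.eq_of_generic (IsClassOf_e (IsClassOf_e U_isClassOf _) _) U_isClassOf
    fun _ => fU_e₁₃_e₂₃

theorem V_e₃₁_e₂₁ : G.elem 2 0 (by decide) • G.elem 1 0 (by decide) • V = V :=
  N.eq_of_generic (IsClassOf_e (IsClassOf_e V_isClassOf _) _) V_isClassOf
    fun _ => fV_e₃₁_e₂₁

theorem lift_sdImage_right {w : Gen → N} (a : FreeGroup Gen) :
    (FreeGroup.lift (sdImage w) a).right = FreeGroup.lift genImage a := by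
  have : SemidirectProduct.rightHom.comp (FreeGroup.lift (sdImage w)) =
      FreeGroup.lift genImage := by
    refine FreeGroup.ext_hom _ _ fun x => ?_
    change (FreeGroup.lift (sdImage w) (FreeGroup.of x)).right = _
    rw [FreeGroup.lift_apply_of, FreeGroup.lift_apply_of]
    rfl
  exact DFunLike.congr_fun this a

/-- The component in `G` is the computation for `E → G`. In the component in `N`, only generators
with second index `2` contribute, so each choice of indices is trivial or one of the identities
above. For `ê₃₂ ê₁₂` the inverse exponential from `expPiI_neg` enters. -/
theorem isLift_genValue : IsLift (genValue U V T) := by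
  refine ⟨fun _ => rfl, fun a b h => SemidirectProduct.ext ?_ ?_⟩
  swap
  · rw [lift_sdImage_right, lift_sdImage_right, genImage_rel h]
  have he : ∀ i j h, FreeGroup.lift (sdImage (genValue U V T)) (fe i j h) =
    ⟨genValue U V T (.e i j h), G.elem i j h⟩ := fun _ _ _ => FreeGroup.lift_apply_of
  have ht : ∀ i, FreeGroup.lift (sdImage (genValue U V T)) (ft i) =
    ⟨genValue U V T (.t i), G.trans i⟩ := fun _ => FreeGroup.lift_apply_of
  have hm : ∀ u, FreeGroup.lift (sdImage (genValue U V T)) (fm u) =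
    ⟨(u : N), 1⟩ := fun _ => FreeGroup.lift_apply_of
  have h1 : ((expPiI 0 : M) : N) = 1 := by rw [expPiI_zero]; rfl
  induction h with
  | m_mul u v => simp [hm]
  | e_m i j h u =>
    simp only [map_mul, he, hm, SD.mul_left, one_smul]
    exact mul_comm _ _
  | t_m i u =>
    simp only [map_mul, ht, hm, SD.mul_left, one_smul]
    exact mul_comm _ _
  | e_e_comm i j k l hij hkl hil hjk =>
    simp only [map_mul, he, hm, SD.mul_left, SemidirectProduct.mul_right, one_smul, one_mul]
    fin_cases i <;> fin_cases j <;> first | exact absurd rfl hij | skip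
    all_goals fin_cases k <;> first | exact absurd rfl hjk | skip
    all_goals fin_cases l <;> first | exact absurd rfl hkl | exact absurd rfl hil | skip
    all_goals simp [genValue, Lee, h1, mul_assoc, U_e₁₃, V_e₃₁, U_mul_V, expPiI_neg]
  | e_e i j k hij hjk hik =>
    simp only [map_mul, he, hm, SD.mul_left, SemidirectProduct.mul_right, one_smul, one_mul]
    fin_cases i <;> fin_cases j <;> first | exact absurd rfl hij | skip
    all_goals fin_cases k <;> first | exact absurd rfl hjk | exact absurd rfl hik | skip
    all_goals simp [genValue, Lee, h1, mul_assoc, mul_smul, V_e₁₃, U_e₃₁, U_e₁₃_e₂₃, V_e₃₁_e₂₁]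
  | e_pow =>
    simp only [map_mul, map_pow, map_inv, he, map_one]
    -- Both generators in this relation have trivial component in `N`, so the whole word lies in the
    -- copy of `G`.
    have e₁ : (⟨genValue U V T (.e 0 2 (by decide)), G.elem 0 2 (by decide)⟩ : SD) =
      SemidirectProduct.inr (G.elem 0 2 (by decide)) := rfl
    have e₂ : (⟨genValue U V T (.e 2 0 (by decide)), G.elem 2 0 (by decide)⟩ : SD) =
      SemidirectProduct.inr (G.elem 2 0 (by decide)) := rfl
    rw [e₁, e₂, ← map_inv, ← map_mul, ← map_mul, ← map_pow, SemidirectProduct.left_inr]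
    rfl
  | t_t i j =>
    simp only [map_mul, ht, hm, SD.mul_left, SemidirectProduct.mul_right, one_smul, one_mul]
    fin_cases i <;> fin_cases j <;> simp [genValue, Lt, h1, T_t₁, T_t₃, expPiI_neg]
  | e_t i j k hij hik =>
    simp only [map_mul, he, ht, hm, SD.mul_left, SemidirectProduct.mul_right, one_smul, one_mul]
    fin_cases i <;> fin_cases j <;> first | exact absurd rfl hij | skip
    all_goals fin_cases k <;> first | exact absurd rfl hik | skip
    all_goals simp [genValue, Let, h1, mul_assoc, U_mul_T, U_t₃, T_e₁₃, T_e₃₁, V_t₁, V_mul_T]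
  | t_e_t i j hij =>
    simp only [map_mul, he, ht, hm, SD.mul_left, SemidirectProduct.mul_right, one_smul, one_mul]
    fin_cases i <;> fin_cases j <;> first | exact absurd rfl hij | skip
    all_goals simp [genValue, Let, h1, mul_smul, T_mul_U, T_mul_V, T_t₁_e₂₁, T_t₃_e₂₃]

end Relations

end EllGamma
end

theorem mainTheorem3 :
    (∃ u : EllGamma.G → EllGamma.N ⧸ EllGamma.M,
      groupCohomology.IsMulCocycle₁ u ∧ EllGamma.HasGammaValues u) ∧
    ∃ S : GroupExtension EllGamma.M EllGamma.E EllGamma.G,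
      S.inl = EllGamma.E.ofM ∧
      (∀ (i j : Fin 3) (h : i ≠ j), S.rightHom (EllGamma.E.e i j h) = EllGamma.G.elem i j h) ∧
      (∀ i : Fin 3, S.rightHom (EllGamma.E.t i) = EllGamma.G.trans i) ∧
      EllGamma.IsExtensionOfModule S ∧
      ∀ (u : EllGamma.G → EllGamma.N ⧸ EllGamma.M) (hu : groupCohomology.IsMulCocycle₁ u),
        EllGamma.HasGammaValues u →
        EllGamma.IsCharacteristicClass S
          (EllGamma.connecting (groupCohomology.H1π
            (Rep.ofMulDistribMulAction EllGamma.G (EllGamma.N ⧸ EllGamma.M))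
            (groupCohomology.cocyclesOfIsMulCocycle₁ hu))) :=
  EllGamma.main_of_isLift EllGamma.isLift_genValue EllGamma.U_isClassOf
    EllGamma.V_isClassOf EllGamma.T_isClassOf
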